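/- **Setting.** A language consists of all terms built from $k$-ary operators (possibly constructed from names, with the free names of a term determined operator by operator). Let $\mathcal P_s,\mathcal P_t$ be two languages, and let $\mathcal P_s^\surd,\mathcal P_t^\surd$ be their extensions with a constant $\surd$ (without free names), equipped with a reduction relation $\longmapsto$ and a predicate $P{\downarrow}$ ("$P$ reports success"). Let $\Longmapsto$ be the reflexive-transitive closure of $\longmapsto$; write $P{\Downarrow}$ if $P\Longmapsto P'$ for some $P'{\downarrow}$, and $P\longmapsto^\omega$ if there is an infinite reduction sequence from $P$. A symmetric relation $\mathcal R$ on the disjoint union $\mathcal P_s^\surd\uplus\mathcal P_t^\surd$ is a *divergence-preserving, success-respecting weak reduction bisimulation* if $P\mathrel{\mathcal R}Q$ implies: (1) if $P{\downarrow}$ then $Q{\Downarrow}$; (2) if $P\longmapsto P'$ then $Q\Longmapsto Q'$ and $P'\mathrel{\mathcal R}Q'$ for some $Q'$; (3) $P\longmapsto^\omega$ iff $Q\longmapsto^\omega$. The largest such relation is denoted $\approx^\Delta$. An encoding is a map $\mathfrak T:\mathcal P_s\to\mathcal P_t$, extended to $\mathfrak T:\mathcal P_s^\surd\to\mathcal P_t^\surd$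 with $\mathfrak T(\surd)=\surd$. It is *compositional* if for every $k$-ary source operator $op$ and every set $N$ of names there is a $k$-ary target context $C^N_{op}$ such that $\mathfrak T(op(S_1,\dots,S_k))=C^N_{op}[\mathfrak T(S_1),\dots,\mathfrak T(S_k)]$ whenever $N$ is the set of free names of $S_1,\dots,S_k$ (the same contexts serving for $\mathfrak T$ and its extension). A compositional encoding is *valid up to* $\approx^\Delta$ if $\mathfrak T(P)\approx^\Delta P$ for all $P\in\mathcal P_s^\surd$. **Theorem.** (a) A compositional encoding $\mathfrak T$ is valid up to $\approx^\Delta$ if and only if it satisfies all of the following, for all $S,S'\in\mathcal P_s^\surd$ and $T\in\mathcal P_t^\surd$: - (success sensitiveness) $S{\Downarrow}\Leftrightarrow\mathfrak T(S){\Downarrow}$; - (divergence preservation) $\mathfrak T(S)\longmapsto^\omega\ \Leftrightarrow\ S\longmapsto^\omega$; - $(\mathfrak C')$ if $S\Longmapsto S'$ then there is a $T$ with $\mathfrak T(S)\Longmapsto T\approx^\Delta\mathfrak T(S')$; - $(\mathfrak W)$ if $\mathfrak T(S)\Longmapsto T$ then there is an $S'$ with $S\Longmapsto S'$ and $T\approx^\Delta\mathfrak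 T(S')$. (b) Let $\mathcal N$ be an infinite set of names and let $\pi$ be the synchronous $\pi$-calculus $P::=\mathbf 0\mid\bar xz.P\mid x(y).P\mid P|Q\mid(\nu y)P\mid{!P}$ over $\mathcal N$, with its usual reduction relation, closed under structural congruence (including $\alpha$-conversion), and let $\mathrm{a}\pi$ be its asynchronous sublanguage, in which outputs have the form $\bar xz.\mathbf 0$, written $\bar xz$; a process reports success if it has an occurrence of $\surd$ that is not inside a prefixed subterm. Then Boudol's encoding $\mathfrak T_{\rm B}$ and Honda and Tokoro's encoding $\mathfrak T_{\rm HT}$ of $\pi$ into $\mathrm{a}\pi$ are compositional and valid up to $\approx^\Delta$. Both are homomorphic for $\mathbf 0$, $|$, $!$, $(\nu y)$, and $$\mathfrak T_{\rm B}(\bar xz.P)=(\nu u)(\bar xu\,|\,u(v).(\bar vz\,|\,\mathfrak T_{\rm B}(P))),\qquad \mathfrak T_{\rm B}(x(y).P)=x(u).(\nu v)(\bar uv\,|\,v(y).\mathfrak T_{\rm B}(P)),$$ $$\mathfrak T_{\rm HT}(\bar xz.P)=x(u).(\bar uz\,|\,\mathfrak T_{\rm HT}(P)),\qquad \mathfrak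 T_{\rm HT}(x(y).P)=(\nu u)(\bar xu\,|\,u(y).\mathfrak T_{\rm HT}(P)),$$ where $u\ne v$ and, in the output clauses, $u,v\notin\mathrm{fn}(P)\cup\{x,z\}$ and, in the input clauses, $u,v\notin\mathrm{fn}(P)\cup\{x\}$. The result holds for every such choice of $u$ and $v$ as a function of the prefix and of $\mathrm{fn}(P)$. -/

import Mathlib

/-! ### Reduction systems with a success predicate -/

namespace Enc

universe u v u' v' w

/-- `P ⇓`: some reduct of `P` reports success. -/
def WeakSuccess {α : Type w} (red : α → α → Prop) (ok : α → Prop) (P : α) : Prop :=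
  ∃ P', Relation.ReflTransGen red P P' ∧ ok P'

/-- `P ⟼^ω`: there is an infinite reduction sequence starting in `P`. -/
def Diverges {α : Type w} (red : α → α → Prop) (P : α) : Prop :=
  ∃ f : ℕ → α, f 0 = P ∧ ∀ i, red (f i) (f (i + 1))

/-- Divergence-preserving, success-respecting weak reduction bisimulations. -/
structure IsDivBisimulation {α : Type w} (red : α → α → Prop) (ok : α → Prop)
    (R : α → α → Prop) : Prop where
  symm : ∀ P Q, R P Q → R Q P
  success : ∀ P Q, R P Q → ok P → WeakSuccess red ok Q
  step : ∀ P Q P', R P Q → red P P' → ∃ Q', Relation.ReflTransGen red Q Q' ∧ R P' Q'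
  divergence : ∀ P Q, R P Q → (Diverges red P ↔ Diverges red Q)

/-- The union of all divergence-preserving, success-respecting weak reduction bisimulations. -/
def DivBisimilar {α : Type w} (red : α → α → Prop) (ok : α → Prop) (P Q : α) : Prop :=
  ∃ R, IsDivBisimulation red ok R ∧ R P Q

/-- `DivBisimilar` is itself such a bisimulation, and it contains every other one. -/
theorem divBisimilar_largest {α : Type w} (red : α → α → Prop) (ok : α → Prop) :
    IsDivBisimulation red ok (DivBisimilar red ok) ∧
      ∀ R, IsDivBisimulation red ok R → ∀ P Q, R P Q → DivBisimilar red ok P Q := by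
  refine ⟨⟨?_, ?_, ?_, ?_⟩, fun R hR P Q h => ⟨R, hR, h⟩⟩
  · rintro P Q ⟨R, hR, h⟩
    exact ⟨R, hR, hR.symm P Q h⟩
  · rintro P Q ⟨R, hR, h⟩
    exact hR.success P Q h
  · rintro P Q P' ⟨R, hR, h⟩ hs
    obtain ⟨Q', h1, h2⟩ := hR.step P Q P' h hs
    exact ⟨Q', h1, R, hR, h2⟩
  · rintro P Q ⟨R, hR, h⟩
    exact hR.divergence P Q h

/-! ### Languages -/

/-- A signature: operators (possibly built from names) with their arities, and for each operator
the set of free names of `op(S₁,…,Sₖ)` as a function of the sets of free names of the `Sᵢ`. -/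
structure Signature where
  Name : Type u
  Op : Type v
  arity : Op → ℕ
  fnOp : (o : Op) → (Fin (arity o) → Set Name) → Set Name

/-- Terms built from the operators of `S` and extra constants from `X`.  The language itself
consists of `Term Empty`, its extension with the constant `√` of `Term Unit`, and the
`k`-ary contexts (with holes `0, …, k-1`) are `Term (Fin k)`. -/
inductive Signature.Term (S : Signature.{u, v}) (X : Type) : Type v
  | const : X → Signature.Term S X
  | op : (o : S.Op) → (Fin (S.arity o) → Signature.Term S X) → Signature.Term S X

/-- Replace every constant (hole) `x` by the term `f x`. -/
def Signature.Term.fill {S : Signature.{u, v}} {X Y : Type} (f : X → S.Term Y) :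
    S.Term X → S.Term Y
  | .const x => f x
  | .op o a => .op o (fun i => (a i).fill f)

/-- Free names; the extra constants have none. -/
def Signature.Term.fn {S : Signature.{u, v}} {X : Type} : S.Term X → Set S.Name
  | .const _ => ∅
  | .op o a => S.fnOp o (fun i => (a i).fn)

/-- The inclusion of the language in its extension with `√`. -/
def Signature.Term.incl {S : Signature.{u, v}} (P : S.Term Empty) : S.Term Unit :=
  P.fill (fun e => e.elim)

/-- The constant `√`. -/
def Signature.tick (S : Signature.{u, v}) : S.Term Unit := .const ()

/-- A language whose extension with `√` is equipped with a reduction relation and with the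
predicate "reports success". -/
structure Calculus extends Signature.{u, v} where
  red : toSignature.Term Unit → toSignature.Term Unit → Prop
  reports : toSignature.Term Unit → Prop

/-- The processes of the language extended with `√`. -/
abbrev Calculus.Proc (L : Calculus.{u, v}) : Type v := L.toSignature.Term Unit

/-- `P ⟹ Q`. -/
def Calculus.Reds (L : Calculus.{u, v}) : L.Proc → L.Proc → Prop :=
  Relation.ReflTransGen L.red

/-- Reduction on the disjoint union of two languages. -/
def unionRed (L : Calculus.{u, v}) (M : Calculus.{u', v'}) :
    L.Proc ⊕ M.Proc → L.Proc ⊕ M.Proc → Prop :=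
  Sum.LiftRel L.red M.red

/-- Reporting success on the disjoint union of two languages. -/
def unionReports (L : Calculus.{u, v}) (M : Calculus.{u', v'}) : L.Proc ⊕ M.Proc → Prop :=
  Sum.elim L.reports M.reports

/-- Divergence-preserving, success-respecting weak reduction bisimilarity on the disjoint union of
the source language `L` and the target language `M`, both extended with `√`. -/
def divBisim (L : Calculus.{u, v}) (M : Calculus.{u', v'}) :
    L.Proc ⊕ M.Proc → L.Proc ⊕ M.Proc → Prop :=
  DivBisimilar (unionRed L M) (unionReports L M)

/-- The restriction of that equivalence to the target language. -/
def divBisimTarget (L : Calculus.{u, v}) (M : Calculus.{u', v'}) (P Q : M.Proc) : Prop :=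
  divBisim L M (Sum.inr P) (Sum.inr Q)

/-! ### Encodings -/

/-- An encoding, together with its extension to the languages with `√`. -/
structure Encoding (S : Signature.{u, v}) (T : Signature.{u', v'}) where
  trans : S.Term Empty → T.Term Empty
  ext : S.Term Unit → T.Term Unit
  ext_tick : ext S.tick = T.tick
  ext_incl : ∀ P, ext P.incl = (trans P).incl

/-- Compositionality: for each `k`-ary operator and each set `N` of names there is a `k`-ary target
context that translates this operator whenever `N` is the set of free names of its arguments;
the extension with `√` uses the same contexts. -/
def Encoding.Compositional {S : Signature.{u, v}} {T : Signature.{u', v'}}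
    (E : Encoding S T) : Prop :=
  ∃ C : (o : S.Op) → Set S.Name → T.Term (Fin (S.arity o)),
    (∀ o a, E.trans (.op o a) = (C o (⋃ i, (a i).fn)).fill (fun i => E.trans (a i))) ∧
    (∀ o a, E.ext (.op o a) = (C o (⋃ i, (a i).fn)).fill (fun i => E.ext (a i)))

section Criteria

variable {L : Calculus.{u, v}} {M : Calculus.{u', v'}}

def Encoding.SuccessSensitive (E : Encoding L.toSignature M.toSignature) : Prop :=
  ∀ S : L.Proc, WeakSuccess L.red L.reports S ↔ WeakSuccess M.red M.reports (E.ext S)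

def Encoding.DivergencePreserving (E : Encoding L.toSignature M.toSignature) : Prop :=
  ∀ S : L.Proc, Diverges M.red (E.ext S) ↔ Diverges L.red S

/-- Operational completeness, up to a relation `r` on the target language. -/
def Encoding.OperationallyComplete (E : Encoding L.toSignature M.toSignature)
    (r : M.Proc → M.Proc → Prop) : Prop :=
  ∀ S S' : L.Proc, L.Reds S S' → ∃ T, M.Reds (E.ext S) T ∧ r T (E.ext S')

/-- Operational soundness in its strong form, up to a relation `r` on the target language. -/
def Encoding.OperationallySound (E : Encoding L.toSignature M.toSignature)
    (r : M.Proc → M.Proc → Prop) : Prop :=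
  ∀ (S : L.Proc) (T : M.Proc), M.Reds (E.ext S) T → ∃ S', L.Reds S S' ∧ r T (E.ext S')

/-- Validity up to a relation on the disjoint union of source and target language. -/
def Encoding.ValidUpTo (E : Encoding L.toSignature M.toSignature)
    (r : L.Proc ⊕ M.Proc → L.Proc ⊕ M.Proc → Prop) : Prop :=
  E.Compositional ∧ ∀ P : L.Proc, r (Sum.inr (E.ext P)) (Sum.inl P)

end Criteria

/-! ### The π-calculus with `√`: structural congruence and reduction -/

/-- Processes of the synchronous π-calculus extended with `√` (`tick`). -/
inductive Pi (N : Type u) : Type u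
  | nil : Pi N
  | tick : Pi N
  | out (x z : N) (P : Pi N) : Pi N
  | inp (x y : N) (P : Pi N) : Pi N
  | par (P Q : Pi N) : Pi N
  | res (y : N) (P : Pi N) : Pi N
  | rep (P : Pi N) : Pi N

namespace Pi

variable {N : Type u}

/-- All names occurring in a process, free or bound. -/
def names : Pi N → Set N
  | nil => ∅
  | tick => ∅
  | out x z P => {x, z} ∪ P.names
  | inp x y P => {x, y} ∪ P.names
  | par P Q => P.names ∪ Q.names
  | res y P => {y} ∪ P.names
  | rep P => P.names

/-- Free names. -/
def fn : Pi N → Set N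
  | nil => ∅
  | tick => ∅
  | out x z P => {x, z} ∪ P.fn
  | inp x y P => {x} ∪ (P.fn \ {y})
  | par P Q => P.fn ∪ Q.fn
  | res y P => P.fn \ {y}
  | rep P => P.fn

/-- Literal replacement of each free occurrence of `y` by `w` (bound names are not renamed). -/
def replace [DecidableEq N] (w y : N) : Pi N → Pi N
  | nil => nil
  | tick => tick
  | out x z P => out (if x = y then w else x) (if z = y then w else z) (P.replace w y)
  | inp x b P => inp (if x = y then w else x) b (if b = y then P else P.replace w y)
  | par P Q => par (P.replace w y) (Q.replace w y)
  | res b P => res b (if b = y then P else P.replace w y)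
  | rep P => rep (P.replace w y)

/-- No free occurrence of `y` lies in the scope of a binder of `w`, so that `replace w y`
captures nothing. -/
def NoCapture (w y : N) : Pi N → Prop
  | nil => True
  | tick => True
  | out _ _ P => P.NoCapture w y
  | inp _ b P => b = y ∨ (P.NoCapture w y ∧ (b = w → y ∉ P.fn))
  | par P Q => P.NoCapture w y ∧ Q.NoCapture w y
  | res b P => b = y ∨ (P.NoCapture w y ∧ (b = w → y ∉ P.fn))
  | rep P => P.NoCapture w y

/-- The smallest congruence containing the relation `Ax`. -/
inductive Cong (Ax : Pi N → Pi N → Prop) : Pi N → Pi N → Prop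
  | ax {P Q} : Ax P Q → Cong Ax P Q
  | refl (P) : Cong Ax P P
  | symm {P Q} : Cong Ax P Q → Cong Ax Q P
  | trans {P Q R} : Cong Ax P Q → Cong Ax Q R → Cong Ax P R
  | out (x z) {P Q} : Cong Ax P Q → Cong Ax (out x z P) (out x z Q)
  | inp (x y) {P Q} : Cong Ax P Q → Cong Ax (inp x y P) (inp x y Q)
  | par {P P' Q Q'} : Cong Ax P P' → Cong Ax Q Q' → Cong Ax (par P Q) (par P' Q')
  | res (y) {P Q} : Cong Ax P Q → Cong Ax (res y P) (res y Q)
  | rep {P Q} : Cong Ax P Q → Cong Ax (rep P) (rep Q)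

/-- Renaming of one bound name into a name that does not occur. -/
inductive AlphaAx [DecidableEq N] : Pi N → Pi N → Prop
  | res {y w P} : w ∉ names P → AlphaAx (res y P) (res w (P.replace w y))
  | inp {x y w P} : w ∉ names P → AlphaAx (inp x y P) (inp x w (P.replace w y))

/-- α-conversion. -/
def AlphaEq [DecidableEq N] : Pi N → Pi N → Prop := Cong AlphaAx

/-- `IsSubst z y P R`: `R` is a result of the capture-avoiding substitution of `z` for `y` in `P`,
i.e. of replacing `y` by `z` in an α-variant of `P` where nothing gets captured. -/
def IsSubst [DecidableEq N] (z y : N) (P R : Pi N) : Prop :=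
  ∃ P', AlphaEq P P' ∧ P'.NoCapture z y ∧ R = P'.replace z y

/-- The axioms of structural congruence. -/
inductive StructAx [DecidableEq N] : Pi N → Pi N → Prop
  | par_assoc (P Q R) : StructAx (par P (par Q R)) (par (par P Q) R)
  | par_comm (P Q) : StructAx (par P Q) (par Q P)
  | par_nil (P) : StructAx (par P nil) P
  | rep (P) : StructAx (rep P) (par P (rep P))
  | res_nil (y) : StructAx (res y nil) nil
  | res_comm (y u P) : StructAx (res y (res u P)) (res u (res y P))
  | res_par {w P} (Q) : w ∉ names P → StructAx (res w (par P Q)) (par P (res w Q))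
  | alpha {P Q} : AlphaAx P Q → StructAx P Q

/-- Structural congruence. -/
def StructEq [DecidableEq N] : Pi N → Pi N → Prop := Cong StructAx

/-- The reduction relation. -/
inductive Red [DecidableEq N] : Pi N → Pi N → Prop
  | comm {x y z P Q R} : IsSubst z y Q R → Red (par (out x z P) (inp x y Q)) (par P R)
  | par {P P'} (Q) : Red P P' → Red (par P Q) (par P' Q)
  | res (y) {P P'} : Red P P' → Red (res y P) (res y P')
  | struct {P P' Q Q'} : StructEq Q P → Red P P' → StructEq P' Q' → Red Q Q'

/-- There is a top-level unguarded occurrence of `√`, i.e. one not inside a prefixed subterm. -/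
def Reports : Pi N → Prop
  | nil => False
  | tick => True
  | out _ _ _ => False
  | inp _ _ _ => False
  | par P Q => P.Reports ∨ Q.Reports
  | res _ P => P.Reports
  | rep P => P.Reports

end Pi

/-! ### The synchronous and the asynchronous π-calculus as languages -/

/-- The operators of the synchronous π-calculus. -/
inductive SOp (N : Type u) : Type u
  | nil : SOp N
  | out (x z : N) : SOp N
  | inp (x y : N) : SOp N
  | par : SOp N
  | res (y : N) : SOp N
  | rep : SOp N

/-- The operators of the asynchronous π-calculus: outputs are constants. -/
inductive AOp (N : Type u) : Type u
  | nil : AOp N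
  | out (x z : N) : AOp N
  | inp (x y : N) : AOp N
  | par : AOp N
  | res (y : N) : AOp N
  | rep : AOp N

abbrev SOp.arity {N : Type u} : SOp N → ℕ
  | .nil => 0
  | .out _ _ => 1
  | .inp _ _ => 1
  | .par => 2
  | .res _ => 1
  | .rep => 1

abbrev AOp.arity {N : Type u} : AOp N → ℕ
  | .nil => 0
  | .out _ _ => 0
  | .inp _ _ => 1
  | .par => 2
  | .res _ => 1
  | .rep => 1

abbrev syncSig (N : Type u) : Signature.{u, u} where
  Name := N
  Op := SOp N
  arity := SOp.arity
  fnOp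
    | .nil, _ => ∅
    | .out x z, s => {x, z} ∪ s (0 : Fin 1)
    | .inp x y, s => {x} ∪ (s (0 : Fin 1) \ {y})
    | .par, s => s (0 : Fin 2) ∪ s (1 : Fin 2)
    | .res y, s => s (0 : Fin 1) \ {y}
    | .rep, s => s (0 : Fin 1)

abbrev asyncSig (N : Type u) : Signature.{u, u} where
  Name := N
  Op := AOp N
  arity := AOp.arity
  fnOp
    | .nil, _ => ∅
    | .out x z, _ => {x, z}
    | .inp x y, s => {x} ∪ (s (0 : Fin 1) \ {y})
    | .par, s => s (0 : Fin 2) ∪ s (1 : Fin 2)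
    | .res y, s => s (0 : Fin 1) \ {y}
    | .rep, s => s (0 : Fin 1)

/-- The evident identification of synchronous terms (with `√`) with the processes `Pi N`. -/
def syncToPi {N : Type u} : (syncSig N).Term Unit → Pi N
  | .const _ => .tick
  | .op .nil _ => .nil
  | .op (.out x z) a => .out x z (syncToPi (a (0 : Fin 1)))
  | .op (.inp x y) a => .inp x y (syncToPi (a (0 : Fin 1)))
  | .op .par a => .par (syncToPi (a (0 : Fin 2))) (syncToPi (a (1 : Fin 2)))
  | .op (.res y) a => .res y (syncToPi (a (0 : Fin 1)))
  | .op .rep a => .rep (syncToPi (a (0 : Fin 1)))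

/-- The inclusion of the asynchronous in the synchronous π-calculus: the output `x̄z` is the
process `x̄z.0`. -/
def asyncToPi {N : Type u} : (asyncSig N).Term Unit → Pi N
  | .const _ => .tick
  | .op .nil _ => .nil
  | .op (.out x z) _ => .out x z .nil
  | .op (.inp x y) a => .inp x y (asyncToPi (a (0 : Fin 1)))
  | .op .par a => .par (asyncToPi (a (0 : Fin 2))) (asyncToPi (a (1 : Fin 2)))
  | .op (.res y) a => .res y (asyncToPi (a (0 : Fin 1)))
  | .op .rep a => .rep (asyncToPi (a (0 : Fin 1)))

/-- The synchronous π-calculus. -/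
abbrev syncPi (N : Type u) [DecidableEq N] : Calculus.{u, u} where
  toSignature := syncSig N
  red P Q := Pi.Red (syncToPi P) (syncToPi Q)
  reports P := (syncToPi P).Reports

/-- The asynchronous π-calculus, as a sublanguage of the synchronous one. -/
abbrev asyncPi (N : Type u) [DecidableEq N] : Calculus.{u, u} where
  toSignature := asyncSig N
  red P Q := Pi.Red (asyncToPi P) (asyncToPi Q)
  reports P := (asyncToPi P).Reports

/-! ### The encodings of Boudol and of Honda and Tokoro -/

namespace Async

variable {N : Type u} {X : Type}

def nil : (asyncSig N).Term X := .op .nil ![]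
def out (x z : N) : (asyncSig N).Term X := .op (.out x z) ![]
def inp (x y : N) (P : (asyncSig N).Term X) : (asyncSig N).Term X := .op (.inp x y) ![P]
def par (P Q : (asyncSig N).Term X) : (asyncSig N).Term X := .op .par ![P, Q]
def res (y : N) (P : (asyncSig N).Term X) : (asyncSig N).Term X := .op (.res y) ![P]
def rep (P : (asyncSig N).Term X) : (asyncSig N).Term X := .op .rep ![P]

end Async

/-- A choice of the auxiliary names in Boudol's encoding, for each prefix and each finite set `F`
of names (to be used for the set of free names of the process under the prefix). -/
structure BoudolNames (N : Type u) where
  uOut (x z : N) (F : Set N) : N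
  vOut (x z : N) (F : Set N) : N
  uInp (x y : N) (F : Set N) : N
  vInp (x y : N) (F : Set N) : N
  fresh_uOut : ∀ x z F, F.Finite → uOut x z F ∉ F ∪ {x, z}
  fresh_vOut : ∀ x z F, F.Finite → vOut x z F ∉ F ∪ {x, z}
  ne_out : ∀ x z F, F.Finite → uOut x z F ≠ vOut x z F
  fresh_uInp : ∀ x y F, F.Finite → uInp x y F ∉ F ∪ {x}
  fresh_vInp : ∀ x y F, F.Finite → vInp x y F ∉ F ∪ {x}
  ne_inp : ∀ x y F, F.Finite → uInp x y F ≠ vInp x y F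

/-- A choice of the auxiliary name in Honda and Tokoro's encoding. -/
structure HondaTokoroNames (N : Type u) where
  uOut (x z : N) (F : Set N) : N
  uInp (x y : N) (F : Set N) : N
  fresh_uOut : ∀ x z F, F.Finite → uOut x z F ∉ F ∪ {x, z}
  fresh_uInp : ∀ x y F, F.Finite → uInp x y F ∉ F ∪ {x}

open Async in
/-- Boudol's translation; on terms over extra constants (such as `√`) it fixes the constants. -/
def boudolMap {N : Type u} (c : BoudolNames N) {X : Type} :
    (syncSig N).Term X → (asyncSig N).Term X
  | .const k => .const k
  | .op .nil _ => nil
  | .op (.out x z) a =>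
      let F : Set N := (a (0 : Fin 1)).fn
      let u := c.uOut x z F
      let v := c.vOut x z F
      res u (par (out x u) (inp u v (par (out v z) (boudolMap c (a (0 : Fin 1))))))
  | .op (.inp x y) a =>
      let F : Set N := (a (0 : Fin 1)).fn
      let u := c.uInp x y F
      let v := c.vInp x y F
      inp x u (res v (par (out u v) (inp v y (boudolMap c (a (0 : Fin 1))))))
  | .op .par a => par (boudolMap c (a (0 : Fin 2))) (boudolMap c (a (1 : Fin 2)))
  | .op (.res y) a => res y (boudolMap c (a (0 : Fin 1)))
  | .op .rep a => rep (boudolMap c (a (0 : Fin 1)))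

open Async in
/-- Honda and Tokoro's translation; on terms over extra constants it fixes the constants. -/
def hondaTokoroMap {N : Type u} (c : HondaTokoroNames N) {X : Type} :
    (syncSig N).Term X → (asyncSig N).Term X
  | .const k => .const k
  | .op .nil _ => nil
  | .op (.out x z) a =>
      let u := c.uOut x z (a (0 : Fin 1)).fn
      inp x u (par (out u z) (hondaTokoroMap c (a (0 : Fin 1))))
  | .op (.inp x y) a =>
      let u := c.uInp x y (a (0 : Fin 1)).fn
      res u (par (out x u) (inp u y (hondaTokoroMap c (a (0 : Fin 1)))))
  | .op .par a => par (hondaTokoroMap c (a (0 : Fin 2))) (hondaTokoroMap c (a (1 : Fin 2)))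
  | .op (.res y) a => res y (hondaTokoroMap c (a (0 : Fin 1)))
  | .op .rep a => rep (hondaTokoroMap c (a (0 : Fin 1)))

theorem Signature.Term.fn_incl {S : Signature.{u, v}} (P : S.Term Empty) :
    P.incl.fn = P.fn := by
  induction P with
  | const e => exact e.elim
  | op o a ih => exact congrArg (S.fnOp o) (funext ih)

section FillLemmas

variable {N : Type u} {X Y : Type} (f : X → (asyncSig N).Term Y)

theorem fill_nil : (Async.nil : (asyncSig N).Term X).fill f = Async.nil :=
  congrArg (Signature.Term.op (S := asyncSig N) AOp.nil) (funext fun i => i.elim0)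

theorem fill_out (x z : N) :
    (Async.out x z : (asyncSig N).Term X).fill f = Async.out x z :=
  congrArg (Signature.Term.op (S := asyncSig N) (AOp.out x z)) (funext fun i => i.elim0)

theorem fill_inp (x y : N) (P : (asyncSig N).Term X) :
    (Async.inp x y P).fill f = Async.inp x y (P.fill f) :=
  congrArg (Signature.Term.op (S := asyncSig N) (AOp.inp x y))
    (funext fun i => by fin_cases i; rfl)

theorem fill_par (P Q : (asyncSig N).Term X) :
    (Async.par P Q).fill f = Async.par (P.fill f) (Q.fill f) :=
  congrArg (Signature.Term.op (S := asyncSig N) AOp.par)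
    (funext fun i => by fin_cases i <;> rfl)

theorem fill_res (y : N) (P : (asyncSig N).Term X) :
    (Async.res y P).fill f = Async.res y (P.fill f) :=
  congrArg (Signature.Term.op (S := asyncSig N) (AOp.res y))
    (funext fun i => by fin_cases i; rfl)

theorem fill_rep (P : (asyncSig N).Term X) :
    (Async.rep P).fill f = Async.rep (P.fill f) :=
  congrArg (Signature.Term.op (S := asyncSig N) AOp.rep)
    (funext fun i => by fin_cases i; rfl)

end FillLemmas

theorem boudolMap_incl {N : Type u} (c : BoudolNames N) (P : (syncSig N).Term Empty) :
    boudolMap c P.incl = (boudolMap c P).incl := by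
  induction P with
  | const e => exact e.elim
  | op o a ih =>
    simp only [Signature.Term.incl] at ih
    have hfn : ∀ i, ((a i).fill (fun e => e.elim) : (syncSig N).Term Unit).fn = (a i).fn :=
      fun i => (a i).fn_incl
    cases o <;>
      simp only [Signature.Term.incl, Signature.Term.fill, boudolMap, fill_nil, fill_out,
        fill_inp, fill_par, fill_res, fill_rep, ih, hfn]

theorem hondaTokoroMap_incl {N : Type u} (c : HondaTokoroNames N) (P : (syncSig N).Term Empty) :
    hondaTokoroMap c P.incl = (hondaTokoroMap c P).incl := by
  induction P with
  | const e => exact e.elim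
  | op o a ih =>
    simp only [Signature.Term.incl] at ih
    have hfn : ∀ i, ((a i).fill (fun e => e.elim) : (syncSig N).Term Unit).fn = (a i).fn :=
      fun i => (a i).fn_incl
    cases o <;>
      simp only [Signature.Term.incl, Signature.Term.fill, hondaTokoroMap, fill_nil, fill_out,
        fill_inp, fill_par, fill_res, fill_rep, ih, hfn]

/-- Boudol's encoding of the synchronous into the asynchronous π-calculus. -/
def boudol {N : Type u} [DecidableEq N] (c : BoudolNames N) :
    Encoding (syncPi N).toSignature (asyncPi N).toSignature where
  trans := boudolMap c
  ext := boudolMap c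
  ext_tick := rfl
  ext_incl := boudolMap_incl c

/-- Honda and Tokoro's encoding of the synchronous into the asynchronous π-calculus. -/
def hondaTokoro {N : Type u} [DecidableEq N] (c : HondaTokoroNames N) :
    Encoding (syncPi N).toSignature (asyncPi N).toSignature where
  trans := hondaTokoroMap c
  ext := hondaTokoroMap c
  ext_tick := rfl
  ext_incl := hondaTokoroMap_incl c

end Enc

universe u₁ v₁ u₂ v₂ u₃

/-! # Validity of encodings up to divergence-preserving weak reduction bisimilarity

**The criteria.** Bisimilarity is itself a bisimulation, and it is transitive. Hence a valid
encoding satisfies the four criteria, since each of them transports a property along the pair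
`𝔗(S) ≈ S`. Conversely, the criteria yield the clauses of a bisimulation for the pairs `(S, T)` with
`T ≈ 𝔗(S)` (`Encoding.criteria_iff_validUpTo`).

**The two encodings of the π-calculus.** Processes are translated to de Bruijn notation (`Pi.toDB`),
where α-equivalence is equality and each of the two encodings becomes one function, whatever
auxiliary names were chosen (`toDB_boudolMap`, `toDB_hondaTokoroMap`). On nameless processes a late
labelled transition system `DB.Tr` is used. Structural congruence is a strong bisimulation for it
(`DB.SC.tr`), so reductions are its `τ`-transitions, up to structural congruence of the result only.
A readback of nameless processes as named ones (`DB.toPi`) shows that they give no more reductions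
than the named calculus has (`DB.Tr.namedRed`).

Both encodings translate a communication to a handshake on private channels: its first step is
visible to the environment, and the remaining ones are *inert* (`DB.Inert`), that is, communications
on a private channel with exactly one sender and one receiver. Inert reductions can neither disable
nor be disabled by another transition (`DB.Inert.diamond`) and do not remove occurrences of `√`.
Correctness of a handshake is stated for an output and an input in interaction (`DB.Handshake`,
`DB.Answers`), so that both encodings fall under one notion in spite of the opposite directions of
their first steps. Transitions of a process then correspond to first steps of
handshakes of its encoding (`DB.Handshake.complete`, `DB.Handshake.sound`).

The bisimulation relates `S` to every `T` from which finitely many inert reductions lead to the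
encoding of `S` (`DB.Handshake.Pending`). A reduction of `T` either shortens this sequence or
corresponds to a reduction of `S`, and each reduction of `S` is matched by at least one of `T`.
Therefore neither side can diverge without the other (`DB.Handshake.pending_diverges`). -/

namespace Enc

universe u v u' v' w

/-! ### Bisimilarity and the criteria for encodings -/

section Bisimilarity

variable {α : Type w} {red : α → α → Prop} {ok : α → Prop}

theorem IsDivBisimulation.reds {R : α → α → Prop} (hR : IsDivBisimulation red ok R) {P Q P' : α}
    (h : R P Q) (hP : Relation.ReflTransGen red P P') :
    ∃ Q', Relation.ReflTransGen red Q Q' ∧ R P' Q' := by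
  induction hP with
  | refl => exact ⟨Q, .refl, h⟩
  | tail _ hs ih =>
    obtain ⟨Q₁, h₁, h₂⟩ := ih
    obtain ⟨Q₂, h₃, h₄⟩ := hR.step _ _ _ h₂ hs
    exact ⟨Q₂, h₁.trans h₃, h₄⟩

theorem IsDivBisimulation.weakSuccess {R : α → α → Prop} (hR : IsDivBisimulation red ok R)
    {P Q : α} (h : R P Q) (hP : WeakSuccess red ok P) : WeakSuccess red ok Q := by
  obtain ⟨P', hP', hok⟩ := hP
  obtain ⟨Q', hQ', h'⟩ := hR.reds h hP'
  obtain ⟨Q'', hQ'', hok'⟩ := hR.success _ _ h' hok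
  exact ⟨Q'', hQ'.trans hQ'', hok'⟩

theorem DivBisimilar.symm {P Q : α} (h : DivBisimilar red ok P Q) : DivBisimilar red ok Q P :=
  (divBisimilar_largest red ok).1.symm P Q h

theorem DivBisimilar.trans {P Q R : α} (h : DivBisimilar red ok P Q)
    (h' : DivBisimilar red ok Q R) : DivBisimilar red ok P R := by
  have B := (divBisimilar_largest red ok).1
  refine ⟨Relation.Comp (DivBisimilar red ok) (DivBisimilar red ok), ⟨?_, ?_, ?_, ?_⟩, Q, h, h'⟩
  · rintro P R ⟨Q, h₁, h₂⟩
    exact ⟨Q, h₂.symm, h₁.symm⟩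
  · rintro P R ⟨Q, h₁, h₂⟩ hP
    exact B.weakSuccess h₂ (B.success _ _ h₁ hP)
  · rintro P R P' ⟨Q, h₁, h₂⟩ hP
    obtain ⟨Q', hQ', h₃⟩ := B.step _ _ _ h₁ hP
    obtain ⟨R', hR', h₄⟩ := B.reds h₂ hQ'
    exact ⟨R', hR', Q', h₃, h₄⟩
  · rintro P R ⟨Q, h₁, h₂⟩
    exact (B.divergence _ _ h₁).trans (B.divergence _ _ h₂)

end Bisimilarity

section Union

variable {L : Calculus.{u, v}} {M : Calculus.{u', v'}}

theorem reds_inl_iff {S : L.Proc} {X : L.Proc ⊕ M.Proc} :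
    Relation.ReflTransGen (unionRed L M) (.inl S) X ↔ ∃ S', X = .inl S' ∧ L.Reds S S' := by
  constructor
  · intro h
    induction h with
    | refl => exact ⟨S, rfl, .refl⟩
    | tail _ hs ih =>
      obtain ⟨S', rfl, h'⟩ := ih
      cases hs with
      | inl hs => exact ⟨_, rfl, h'.tail hs⟩
  · rintro ⟨S', rfl, h⟩
    exact Relation.ReflTransGen.lift Sum.inl (fun _ _ => Sum.LiftRel.inl) _ _ h

theorem reds_inr_iff {T : M.Proc} {X : L.Proc ⊕ M.Proc} :
    Relation.ReflTransGen (unionRed L M) (.inr T) X ↔ ∃ T', X = .inr T' ∧ M.Reds T T' := by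
  constructor
  · intro h
    induction h with
    | refl => exact ⟨T, rfl, .refl⟩
    | tail _ hs ih =>
      obtain ⟨T', rfl, h'⟩ := ih
      cases hs with
      | inr hs => exact ⟨_, rfl, h'.tail hs⟩
  · rintro ⟨T', rfl, h⟩
    exact Relation.ReflTransGen.lift Sum.inr (fun _ _ => Sum.LiftRel.inr) _ _ h

theorem weakSuccess_inl {S : L.Proc} :
    WeakSuccess (unionRed L M) (unionReports L M) (.inl S) ↔ WeakSuccess L.red L.reports S := by
  constructor
  · rintro ⟨X, h, hok⟩
    obtain ⟨S', rfl, h'⟩ := reds_inl_iff.1 h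
    exact ⟨S', h', hok⟩
  · rintro ⟨S', h, hok⟩
    exact ⟨.inl S', reds_inl_iff.2 ⟨S', rfl, h⟩, hok⟩

theorem weakSuccess_inr {T : M.Proc} :
    WeakSuccess (unionRed L M) (unionReports L M) (.inr T) ↔ WeakSuccess M.red M.reports T := by
  constructor
  · rintro ⟨X, h, hok⟩
    obtain ⟨T', rfl, h'⟩ := reds_inr_iff.1 h
    exact ⟨T', h', hok⟩
  · rintro ⟨T', h, hok⟩
    exact ⟨.inr T', reds_inr_iff.2 ⟨T', rfl, h⟩, hok⟩

theorem diverges_inl {S : L.Proc} : Diverges (unionRed L M) (.inl S) ↔ Diverges L.red S := by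
  constructor
  · rintro ⟨f, h0, hf⟩
    have : ∀ i, ∃ S', f i = .inl S' := by
      intro i
      induction i with
      | zero => exact ⟨S, h0⟩
      | succ i ih =>
        obtain ⟨S', hS'⟩ := ih
        have := hf i
        rw [hS'] at this
        generalize f (i + 1) = X at this
        cases this
        exact ⟨_, rfl⟩
    choose g hg using this
    refine ⟨g, Sum.inl_injective ((hg 0).symm.trans h0), fun i => ?_⟩
    have := hf i
    rw [hg, hg] at this
    exact Sum.liftRel_inl_inl.1 this
  · rintro ⟨f, rfl, hf⟩
    exact ⟨fun i => .inl (f i), rfl, fun i => .inl (hf i)⟩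

theorem diverges_inr {T : M.Proc} : Diverges (unionRed L M) (.inr T) ↔ Diverges M.red T := by
  constructor
  · rintro ⟨f, h0, hf⟩
    have : ∀ i, ∃ T', f i = .inr T' := by
      intro i
      induction i with
      | zero => exact ⟨T, h0⟩
      | succ i ih =>
        obtain ⟨T', hT'⟩ := ih
        have := hf i
        rw [hT'] at this
        generalize f (i + 1) = X at this
        cases this
        exact ⟨_, rfl⟩
    choose g hg using this
    refine ⟨g, Sum.inr_injective ((hg 0).symm.trans h0), fun i => ?_⟩
    have := hf i
    rw [hg, hg] at this
    exact Sum.liftRel_inr_inr.1 this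
  · rintro ⟨f, rfl, hf⟩
    exact ⟨fun i => .inr (f i), rfl, fun i => .inr (hf i)⟩

/-- A relation between source and target processes that satisfies the clauses of a bisimulation
in both directions is contained in bisimilarity. -/
theorem divBisim_of_relation (R : L.Proc → M.Proc → Prop)
    (success : ∀ S T, R S T → L.reports S → WeakSuccess M.red M.reports T)
    (success' : ∀ S T, R S T → M.reports T → WeakSuccess L.red L.reports S)
    (step : ∀ S T S', R S T → L.red S S' → ∃ T', M.Reds T T' ∧ R S' T')
    (step' : ∀ S T T', R S T → M.red T T' → ∃ S', L.Reds S S' ∧ R S' T')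
    (divergence : ∀ S T, R S T → (Diverges L.red S ↔ Diverges M.red T))
    {S : L.Proc} {T : M.Proc} (h : R S T) : divBisim L M (.inr T) (.inl S) := by
  let B : L.Proc ⊕ M.Proc → L.Proc ⊕ M.Proc → Prop
    | .inl S, .inr T => R S T
    | .inr T, .inl S => R S T
    | _, _ => False
  refine ⟨B, ⟨?_, ?_, ?_, ?_⟩, h⟩
  · rintro (S | T) (S' | T') h <;> exact h
  · rintro (S | T) (S' | T') h hok
    · exact h.elim
    · exact weakSuccess_inr.2 (success _ _ h hok)
    · exact weakSuccess_inl.2 (success' _ _ h hok)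
    · exact h.elim
  · rintro (S | T) (S' | T') X h hs
    · exact h.elim
    · cases hs with
      | inl hs =>
        obtain ⟨T₁, h₁, h₂⟩ := step _ _ _ h hs
        exact ⟨.inr T₁, reds_inr_iff.2 ⟨_, rfl, h₁⟩, h₂⟩
    · cases hs with
      | inr hs =>
        obtain ⟨S₁, h₁, h₂⟩ := step' _ _ _ h hs
        exact ⟨.inl S₁, reds_inl_iff.2 ⟨_, rfl, h₁⟩, h₂⟩
    · exact h.elim
  · rintro (S | T) (S' | T') h
    · exact h.elim
    · rw [diverges_inl, diverges_inr]; exact divergence _ _ h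
    · rw [diverges_inl, diverges_inr]; exact (divergence _ _ h).symm
    · exact h.elim

theorem divBisim_isDivBisimulation :
    IsDivBisimulation (unionRed L M) (unionReports L M) (divBisim L M) :=
  (divBisimilar_largest _ _).1

theorem divBisimTarget_weakSuccess {T T' : M.Proc} (h : divBisimTarget L M T T') :
    WeakSuccess M.red M.reports T ↔ WeakSuccess M.red M.reports T' := by
  rw [← weakSuccess_inr (L := L), ← weakSuccess_inr (L := L)]
  exact ⟨divBisim_isDivBisimulation.weakSuccess h, divBisim_isDivBisimulation.weakSuccess h.symm⟩

theorem divBisimTarget_reds {T U T' : M.Proc} (h : divBisimTarget L M T U) (hT : M.Reds T T') :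
    ∃ U', M.Reds U U' ∧ divBisimTarget L M T' U' := by
  obtain ⟨X, hX, h'⟩ := divBisim_isDivBisimulation.reds h (reds_inr_iff.2 ⟨_, rfl, hT⟩)
  obtain ⟨U', rfl, hU'⟩ := reds_inr_iff.1 hX
  exact ⟨U', hU', h'⟩

/-- Under compositionality, validity up to bisimilarity is the conjunction of success
sensitiveness, divergence preservation, operational completeness and operational soundness. -/
theorem Encoding.criteria_iff_validUpTo (E : Encoding L.toSignature M.toSignature)
    (hE : E.Compositional) :
    (E.SuccessSensitive ∧ E.DivergencePreserving ∧
      E.OperationallyComplete (divBisimTarget L M) ∧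
      E.OperationallySound (divBisimTarget L M)) ↔ E.ValidUpTo (divBisim L M) := by
  have B := divBisim_isDivBisimulation (L := L) (M := M)
  constructor
  · rintro ⟨hs, hd, hc, hw⟩
    refine ⟨hE, fun S => divBisim_of_relation (fun S T => divBisimTarget L M T (E.ext S))
      ?_ ?_ ?_ ?_ ?_ ?_⟩
    · intro S T h hok
      exact (divBisimTarget_weakSuccess h).2 ((hs S).1 ⟨S, .refl, hok⟩)
    · intro S T h hok
      exact (hs S).2 ((divBisimTarget_weakSuccess h).1 ⟨T, .refl, hok⟩)
    · intro S T S' h hS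
      obtain ⟨U, hU, h₁⟩ := hc S S' (.single hS)
      obtain ⟨T', hT', h₂⟩ := divBisimTarget_reds h.symm hU
      exact ⟨T', hT', h₂.symm.trans h₁⟩
    · intro S T T' h hT
      obtain ⟨U, hU, h₁⟩ := divBisimTarget_reds h (.single hT)
      obtain ⟨S', hS', h₂⟩ := hw S U hU
      exact ⟨S', hS', h₁.trans h₂⟩
    · intro S T h
      rw [← hd S, ← diverges_inr (L := L), ← diverges_inr (L := L)]
      exact (B.divergence _ _ h).symm
    · -- Bisimilarity is reflexive on encoded processes because the identity is a bisimulation.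
      refine ⟨Eq, ⟨?_, ?_, ?_, ?_⟩, rfl⟩
      · rintro P Q rfl; rfl
      · rintro P Q rfl h; exact ⟨P, .refl, h⟩
      · rintro P Q P' rfl h; exact ⟨P', .single h, rfl⟩
      · rintro P Q rfl; rfl
  · rintro ⟨-, h⟩
    refine ⟨fun S => ?_, fun S => ?_, fun S S' hS => ?_, fun S T hT => ?_⟩
    · rw [← weakSuccess_inl (M := M), ← weakSuccess_inr (L := L)]
      exact ⟨B.weakSuccess (h S).symm, B.weakSuccess (h S)⟩
    · exact (diverges_inr.symm.trans (B.divergence _ _ (h S))).trans diverges_inl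
    · obtain ⟨X, hX, h₁⟩ := B.reds (h S).symm (reds_inl_iff.2 ⟨S', rfl, hS⟩)
      obtain ⟨T, rfl, hT⟩ := reds_inr_iff.1 hX
      exact ⟨T, hT, h₁.symm.trans (h S').symm⟩
    · obtain ⟨X, hX, h₁⟩ := B.reds (h S) (reds_inr_iff.2 ⟨T, rfl, hT⟩)
      obtain ⟨S', rfl, hS'⟩ := reds_inl_iff.1 hX
      exact ⟨S', hS', h₁.trans (h S').symm⟩

end Union

/-! ### Nameless processes -/

/-- A reference to a name: a free name or the de Bruijn index of a binder. -/
inductive Ref (N : Type u) : Type u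
  | free : N → Ref N
  | bound : ℕ → Ref N

namespace Ref

variable {N : Type u}

/-- The reference to the innermost binder. -/
def zero : Ref N := bound 0

/-- Weakening of a reference under one more binder. -/
def sh : Ref N → Ref N
  | free a => free a
  | bound i => bound (i + 1)

/-- The function that sends the innermost index to `z` and a weakened reference `sh x` to `f x`. -/
def scons {X : Type*} (z : X) (f : Ref N → X) : Ref N → X
  | free a => f (free a)
  | bound 0 => z
  | bound (i + 1) => f (bound i)

/-- The action of a renaming under one binder. -/
def up (f : Ref N → Ref N) : Ref N → Ref N := scons zero (sh ∘ f)

/-- Instantiation of the innermost index. -/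
def inst (z : Ref N) : Ref N → Ref N := scons z id

/-- Exchange of the two innermost binders. -/
def swap : Ref N → Ref N := scons (sh zero) (scons zero (sh ∘ sh))

theorem zero_or_sh (x : Ref N) : x = zero ∨ ∃ y, x = sh y := by
  rcases x with a | _ | i
  · exact .inr ⟨free a, rfl⟩
  · exact .inl rfl
  · exact .inr ⟨bound i, rfl⟩

@[simp] theorem scons_zero {X : Type*} (z : X) (f : Ref N → X) : scons z f zero = z := rfl

@[simp] theorem scons_sh {X : Type*} (z : X) (f : Ref N → X) (x) : scons z f (sh x) = f x := by
  cases x <;> rfl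

@[simp] theorem up_zero (f : Ref N → Ref N) : up f zero = zero := rfl

@[simp] theorem up_sh (f : Ref N → Ref N) (x) : up f (sh x) = sh (f x) := by simp [up]

@[simp] theorem inst_zero (z : Ref N) : inst z zero = z := rfl

@[simp] theorem inst_sh (z x : Ref N) : inst z (sh x) = x := by simp [inst]

@[simp] theorem inst_free (z : Ref N) (a : N) : inst z (free a) = free a := rfl

@[simp] theorem swap_zero : swap (zero : Ref N) = sh zero := rfl

@[simp] theorem swap_sh_zero : swap (sh zero : Ref N) = zero := rfl

@[simp] theorem swap_sh_sh (x : Ref N) : swap (sh (sh x)) = sh (sh x) := by simp [swap]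

theorem sh_injective : Function.Injective (sh : Ref N → Ref N) := by
  rintro (a | i) (b | j) h <;> simp_all [sh]

@[simp] theorem sh_inj {x y : Ref N} : sh x = sh y ↔ x = y := sh_injective.eq_iff

@[simp] theorem sh_ne_zero (x : Ref N) : sh x ≠ zero := by cases x <;> simp [sh, zero]

@[simp] theorem zero_ne_sh (x : Ref N) : zero ≠ sh x := (sh_ne_zero x).symm

/-- Two renamings agree if they do so on the innermost index and on all weakened references. -/
theorem funext_sh {X : Type*} {f g : Ref N → X} (h0 : f zero = g zero)
    (hs : ∀ x, f (sh x) = g (sh x)) : f = g := by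
  funext x
  rcases zero_or_sh x with rfl | ⟨y, rfl⟩
  · exact h0
  · exact hs y

@[simp] theorem scons_comp_sh (z : Ref N) (f : Ref N → Ref N) : scons z f ∘ sh = f := by
  funext x; simp

@[simp] theorem scons_comp_sh_comp (z : Ref N) (f g : Ref N → Ref N) :
    scons z f ∘ sh ∘ g = f ∘ g := by
  funext x; simp

@[simp] theorem comp_scons (z : Ref N) (f g : Ref N → Ref N) :
    f ∘ scons z g = scons (f z) (f ∘ g) :=
  funext_sh (by simp) (by simp)

@[simp] theorem scons_zero_sh : scons zero (sh : Ref N → Ref N) = id :=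
  funext_sh rfl (by simp)

@[simp] theorem scons_comp_sh_self (f : Ref N → Ref N) : scons (f zero) (f ∘ sh) = f :=
  funext_sh rfl (by simp)

theorem up_id : up (id : Ref N → Ref N) = id := funext_sh rfl (by simp)

theorem up_comp (f g : Ref N → Ref N) : up f ∘ up g = up (f ∘ g) :=
  funext_sh rfl (by simp)

theorem up_injective {f : Ref N → Ref N} (hf : Function.Injective f) :
    Function.Injective (up f) := by
  intro x y h
  rcases zero_or_sh x with rfl | ⟨x, rfl⟩ <;> rcases zero_or_sh y with rfl | ⟨y, rfl⟩ <;>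
    simp_all [hf.eq_iff]

end Ref

open Ref

/-- Processes of the synchronous π-calculus with `√` in de Bruijn notation: the names bound by
`inp` and `res` are the innermost index of their scope, so that α-equivalence is equality. -/
inductive DB (N : Type u) : Type u
  | nil : DB N
  | tick : DB N
  | out (x z : Ref N) (P : DB N) : DB N
  | inp (x : Ref N) (P : DB N) : DB N
  | par (P Q : DB N) : DB N
  | res (P : DB N) : DB N
  | rep (P : DB N) : DB N

namespace DB

variable {N : Type u}

/-- Renaming of all references. Substitution in the π-calculus is a special case. -/
def ren (f : Ref N → Ref N) : DB N → DB N
  | nil => nil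
  | tick => tick
  | out x z P => out (f x) (f z) (P.ren f)
  | inp x P => inp (f x) (P.ren (up f))
  | par P Q => par (P.ren f) (Q.ren f)
  | res P => res (P.ren (up f))
  | rep P => rep (P.ren f)

@[simp] theorem ren_ren (f g : Ref N → Ref N) (P : DB N) :
    (P.ren g).ren f = P.ren (f ∘ g) := by
  induction P generalizing f g <;> simp_all [ren, up_comp]

@[simp] theorem ren_id (P : DB N) : P.ren id = P := by
  induction P <;> simp_all [ren, up_id]

/-- An unguarded occurrence of `√`. -/
def Reports : DB N → Prop
  | nil => False
  | tick => True
  | out _ _ _ => False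
  | inp _ _ => False
  | par P Q => P.Reports ∨ Q.Reports
  | res P => P.Reports
  | rep P => P.Reports

@[simp] theorem reports_ren (f : Ref N → Ref N) (P : DB N) :
    (P.ren f).Reports ↔ P.Reports := by
  induction P generalizing f <;> simp_all [ren, Reports]

/-- Structural congruence; there is no rule for α-conversion, and weakening replaces the
side condition of scope extrusion. -/
inductive SC : DB N → DB N → Prop
  | refl (P) : SC P P
  | symm {P Q} : SC P Q → SC Q P
  | trans {P Q R} : SC P Q → SC Q R → SC P R
  | out (x z) {P Q} : SC P Q → SC (out x z P) (out x z Q)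
  | inp (x) {P Q} : SC P Q → SC (inp x P) (inp x Q)
  | par {P P' Q Q'} : SC P P' → SC Q Q' → SC (par P Q) (par P' Q')
  | res {P Q} : SC P Q → SC (res P) (res Q)
  | rep {P Q} : SC P Q → SC (rep P) (rep Q)
  | par_assoc (P Q R) : SC (par P (par Q R)) (par (par P Q) R)
  | par_comm (P Q) : SC (par P Q) (par Q P)
  | par_nil (P) : SC (par P nil) P
  | rep_unfold (P) : SC (rep P) (par P (rep P))
  | res_nil : SC (res nil) nil
  | res_comm (P) : SC (res (res P)) (res (res (P.ren swap)))
  | res_par (P Q) : SC (res (par (P.ren sh) Q)) (par P (res Q))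

theorem SC.ren {P Q : DB N} (h : SC P Q) (f : Ref N → Ref N) : SC (P.ren f) (Q.ren f) := by
  induction h generalizing f with
  | refl => exact .refl _
  | symm _ ih => exact .symm (ih f)
  | trans _ _ ih1 ih2 => exact .trans (ih1 f) (ih2 f)
  | out x z _ ih => exact .out _ _ (ih f)
  | inp x _ ih => exact .inp _ (ih _)
  | par _ _ ih1 ih2 => exact .par (ih1 f) (ih2 f)
  | res _ ih => exact .res (ih _)
  | rep _ ih => exact .rep (ih _)
  | par_assoc => exact .par_assoc _ _ _
  | par_comm => exact .par_comm _ _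
  | par_nil => exact .par_nil _
  | rep_unfold => exact .rep_unfold _
  | res_nil => exact .res_nil
  | res_comm P =>
    have := SC.res_comm (P.ren (up (up f)))
    simpa [DB.ren, up, swap, Function.comp_assoc] using this
  | res_par P Q =>
    have := SC.res_par (P.ren f) (Q.ren (up f))
    simpa [DB.ren, up, Function.comp_assoc] using this

theorem SC.reports {P Q : DB N} (h : SC P Q) : P.Reports ↔ Q.Reports := by
  induction h <;> simp_all [Reports, or_assoc, or_comm]

instance scSetoid (N : Type u) : Setoid (DB N) where
  r := SC
  iseqv := ⟨SC.refl, SC.symm, SC.trans⟩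

/-- Processes up to structural congruence.  They form a commutative monoid under parallel
composition, which lets `abel` rearrange parallel components. -/
def Class (N : Type u) : Type u := Quotient (scSetoid N)

/-- The class of a process modulo structural congruence. -/
def cls (P : DB N) : Class N := Quotient.mk _ P

theorem cls_eq {P Q : DB N} : cls P = cls Q ↔ SC P Q := Quotient.eq

instance : Add (Class N) := ⟨Quotient.map₂ par (fun _ _ h _ _ h' => SC.par h h')⟩

instance : Zero (Class N) := ⟨cls nil⟩

instance : AddCommMonoid (Class N) where
  add_assoc := by
    rintro ⟨P⟩ ⟨Q⟩ ⟨R⟩; exact cls_eq.2 (SC.par_assoc P Q R).symm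
  add_comm := by
    rintro ⟨P⟩ ⟨Q⟩; exact cls_eq.2 (SC.par_comm P Q)
  add_zero := by
    rintro ⟨P⟩; exact cls_eq.2 (SC.par_nil P)
  zero_add := by
    rintro ⟨P⟩; exact cls_eq.2 ((SC.par_comm _ P).trans (SC.par_nil P))
  nsmul := nsmulRec

/-- Restriction on classes. -/
def Class.res : Class N → Class N := Quotient.map DB.res (fun _ _ h => SC.res h)

@[simp] theorem cls_par (P Q : DB N) : cls (par P Q) = cls P + cls Q := rfl

@[simp] theorem cls_nil : cls (nil : DB N) = 0 := rfl

@[simp] theorem cls_res (P : DB N) : cls (res P) = (cls P).res := rfl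

theorem cls_rep (P : DB N) : cls (rep P) = cls P + cls (rep P) := cls_eq.2 (SC.rep_unfold P)

theorem cls_swap (P : DB N) : (cls (P.ren swap)).res.res = (cls P).res.res :=
  (cls_eq.2 (SC.res_comm P)).symm

theorem res_cls_sh_add (P : DB N) (q : Class N) :
    (cls (P.ren sh) + q).res = cls P + q.res := by
  rcases q with ⟨Q⟩; exact cls_eq.2 (SC.res_par P Q)

theorem res_add_cls_sh (q : Class N) (P : DB N) :
    (q + cls (P.ren sh)).res = q.res + cls P := by
  rw [add_comm, res_cls_sh_add, add_comm]

theorem res_cls_sh_comp_add (f : Ref N → Ref N) (P : DB N) (q : Class N) :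
    (cls (P.ren (sh ∘ f)) + q).res = cls (P.ren f) + q.res := by
  rw [← ren_ren, res_cls_sh_add]

theorem res_add_cls_sh_comp (f : Ref N → Ref N) (q : Class N) (P : DB N) :
    (q + cls (P.ren (sh ∘ f))).res = q.res + cls (P.ren f) := by
  rw [← ren_ren, res_add_cls_sh]

@[simp] theorem res_zero : (0 : Class N).res = 0 := cls_eq.2 SC.res_nil

theorem res_cls_sh (P : DB N) : (cls (P.ren sh)).res = cls P := by
  simpa using res_cls_sh_add P 0

theorem cls_ren_congr {P Q : DB N} (h : cls P = cls Q) (f) : cls (P.ren f) = cls (Q.ren f) :=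
  cls_eq.2 ((cls_eq.1 h).ren f)

end DB

/-! ### Labelled transitions of nameless processes -/

/-- Labels of the late transition system. In the residual of an input or a bound output
the innermost index stands for the name received or extruded. -/
inductive Act (N : Type u) : Type u
  | tau
  | inp (x : Ref N)
  | out (x z : Ref N)
  | bout (x : Ref N)

namespace Act

variable {N : Type u}

/-- Renaming of a label. -/
def ren (f : Ref N → Ref N) : Act N → Act N
  | tau => tau
  | inp x => inp (f x)
  | out x z => out (f x) (f z)
  | bout x => bout (f x)

/-- The renaming that moves a process under the binder of a label, if there is one. -/
def wk : Act N → Ref N → Ref N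
  | tau => id
  | inp _ => sh
  | out _ _ => id
  | bout _ => sh

/-- The action of a renaming under the binder of a label. -/
def up : Act N → (Ref N → Ref N) → Ref N → Ref N
  | tau => id
  | inp _ => Ref.up
  | out _ _ => id
  | bout _ => Ref.up

/-- Exchange of the binder of a label with the binder of a restriction. -/
def sw : Act N → Ref N → Ref N
  | tau => id
  | inp _ => swap
  | out _ _ => id
  | bout _ => swap

@[simp] theorem wk_ren (α : Act N) (f) : (α.ren f).wk = α.wk := by cases α <;> rfl

@[simp] theorem up_ren (α : Act N) (f) : (α.ren f).up = α.up := by cases α <;> rfl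

@[simp] theorem sw_ren (α : Act N) (f) : (α.ren f).sw = α.sw := by cases α <;> rfl

@[simp] theorem ren_ren (α : Act N) (f g) : (α.ren g).ren f = α.ren (f ∘ g) := by cases α <;> rfl

@[simp] theorem ren_tau (f) : (tau : Act N).ren f = tau := rfl

@[simp] theorem ren_inp (f) (x : Ref N) : (inp x).ren f = inp (f x) := rfl

@[simp] theorem ren_out (f) (x z : Ref N) : (out x z).ren f = out (f x) (f z) := rfl

@[simp] theorem ren_bout (f) (x : Ref N) : (bout x).ren f = bout (f x) := rfl

@[simp] theorem wk_tau : (tau : Act N).wk = id := rfl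

@[simp] theorem wk_inp (x : Ref N) : (inp x).wk = sh := rfl

@[simp] theorem wk_out (x z : Ref N) : (out x z).wk = id := rfl

@[simp] theorem wk_bout (x : Ref N) : (bout x).wk = sh := rfl

@[simp] theorem up_inp (x : Ref N) : (inp x).up = Ref.up := rfl

@[simp] theorem up_out (x z : Ref N) : (out x z).up = id := rfl

@[simp] theorem up_bout (x : Ref N) : (bout x).up = Ref.up := rfl

@[simp] theorem sw_tau : (tau : Act N).sw = id := rfl

@[simp] theorem sw_inp (x : Ref N) : (inp x).sw = swap := rfl

@[simp] theorem sw_out (x z : Ref N) : (out x z).sw = id := rfl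

@[simp] theorem sw_bout (x : Ref N) : (bout x).sw = swap := rfl

theorem ren_injective {f : Ref N → Ref N} (hf : Function.Injective f) :
    Function.Injective (ren f) := by
  intro α β h
  cases α <;> cases β <;> simp_all [ren, hf.eq_iff]

theorem sw_comp_up_sh (α : Act N) : α.sw ∘ α.up sh = sh := by
  cases α <;> first | rfl | exact funext_sh (by rfl) (by simp [sw, up])

theorem sw_comp_wk (α : Act N) : α.sw ∘ α.wk = Ref.up α.wk := by
  cases α <;> first | exact up_id.symm | exact funext_sh rfl (by simp [sw, wk])

theorem up_comp_wk (α : Act N) (f : Ref N → Ref N) : α.up f ∘ α.wk = α.wk ∘ f := by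
  cases α <;> first | rfl | (funext x; simp [up, wk])

theorem sw_comp_up_up (α : Act N) (f : Ref N → Ref N) :
    α.sw ∘ α.up (Ref.up f) = Ref.up (α.up f) ∘ α.sw := by
  have key : swap ∘ Ref.up (Ref.up f) = Ref.up (Ref.up f) ∘ swap :=
    funext_sh (by simp) fun x => by rcases zero_or_sh x with rfl | ⟨y, rfl⟩ <;> simp
  cases α
  · rfl
  · exact key
  · rfl
  · exact key

theorem up_sw_braid (α : Act N) :
    Ref.up α.sw ∘ α.sw ∘ α.up swap = swap ∘ Ref.up α.sw ∘ α.sw := by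
  have key : Ref.up swap ∘ swap ∘ Ref.up swap = swap ∘ Ref.up swap ∘ (swap : Ref N → Ref N) :=
    funext_sh (by simp) fun x => by
      rcases zero_or_sh x with rfl | ⟨y, rfl⟩
      · simp
      · rcases zero_or_sh y with rfl | ⟨z, rfl⟩ <;> simp
  cases α
  · simp [sw, up, up_id]
  · exact key
  · simp [sw, up, up_id]
  · exact key

/-- If the image of `β` under a lifted renaming is a weakened label, then `β` itself is one. -/
theorem ren_sh_eq_ren_up {α β : Act N} {f : Ref N → Ref N} (h : α.ren sh = β.ren (Ref.up f)) :
    ∃ γ : Act N, β = γ.ren sh ∧ α = γ.ren f := by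
  have key : ∀ x y : Ref N, sh x = Ref.up f y → ∃ z, y = sh z ∧ x = f z := by
    intro x y hxy
    rcases zero_or_sh y with rfl | ⟨z, rfl⟩
    · simp at hxy
    · exact ⟨z, rfl, by simpa using hxy⟩
  cases α <;> cases β <;> simp [ren] at h
  · exact ⟨tau, rfl, rfl⟩
  · obtain ⟨z, rfl, rfl⟩ := key _ _ h
    exact ⟨inp z, rfl, rfl⟩
  · obtain ⟨z, rfl, rfl⟩ := key _ _ h.1
    obtain ⟨w, rfl, rfl⟩ := key _ _ h.2
    exact ⟨out z w, rfl, rfl⟩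
  · obtain ⟨z, rfl, rfl⟩ := key _ _ h
    exact ⟨bout z, rfl, rfl⟩

end Act

namespace DB

variable {N : Type u}

/-- `Comb α β P Q S`: the residuals `P` and `Q` of complementary actions `α` and `β` combine
to `S`. -/
inductive Comb : Act N → Act N → DB N → DB N → DB N → Prop
  | outInp (x z P Q) : Comb (.out x z) (.inp x) P Q (par P (Q.ren (inst z)))
  | inpOut (x z P Q) : Comb (.inp x) (.out x z) P Q (par (P.ren (inst z)) Q)
  | boutInp (x P Q) : Comb (.bout x) (.inp x) P Q (res (par P Q))
  | inpBout (x P Q) : Comb (.inp x) (.bout x) P Q (res (par P Q))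

/-- The late transition relation. -/
inductive Tr : DB N → Act N → DB N → Prop
  | out (x z P) : Tr (out x z P) (.out x z) P
  | inp (x P) : Tr (inp x P) (.inp x) P
  | parL {P α P'} (Q) : Tr P α P' → Tr (par P Q) α (par P' (Q.ren α.wk))
  | parR {Q α Q'} (P) : Tr Q α Q' → Tr (par P Q) α (par (P.ren α.wk) Q')
  | comm {P Q α β P' Q' S} : Tr P α P' → Tr Q β Q' → Comb α β P' Q' S → Tr (par P Q) .tau S
  | res {P α P'} : Tr P (α.ren sh) P' → Tr (res P) α (res (P'.ren α.sw))
  | opn {P x P'} : Tr P (.out (sh x) zero) P' → Tr (res P) (.bout x) P'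
  | rep {P α P'} : Tr P α P' → Tr (rep P) α (par P' ((rep P).ren α.wk))
  | repComm {P α β P' P'' S} : Tr P α P' → Tr P β P'' → Comb α β P' P'' S →
      Tr (rep P) .tau (par S (rep P))

theorem Comb.subject_eq {x z y : Ref N} {P Q S} (h : Comb (.out x z) (.inp y) P Q S) : x = y := by
  cases h; rfl

theorem Comb.symm {α β : Act N} {P Q S} (h : Comb α β P Q S) :
    ∃ S', Comb β α Q P S' ∧ SC S S' := by
  cases h
  · exact ⟨_, .inpOut _ _ _ _, .par_comm _ _⟩
  · exact ⟨_, .outInp _ _ _ _, .par_comm _ _⟩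
  · exact ⟨_, .inpBout _ _ _, .res (.par_comm _ _)⟩
  · exact ⟨_, .boutInp _ _ _, .res (.par_comm _ _)⟩

theorem Comb.congr {α β : Act N} {P Q S P₁ Q₁} (h : Comb α β P Q S) (hP : SC P P₁)
    (hQ : SC Q Q₁) : ∃ S', Comb α β P₁ Q₁ S' ∧ SC S S' := by
  cases h
  · exact ⟨_, .outInp _ _ _ _, .par hP (hQ.ren _)⟩
  · exact ⟨_, .inpOut _ _ _ _, .par (hP.ren _) hQ⟩
  · exact ⟨_, .boutInp _ _ _, .res (.par hP hQ)⟩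
  · exact ⟨_, .inpBout _ _ _, .res (.par hP hQ)⟩

theorem Comb.cast {α β : Act N} {P Q S S'} (h : Comb α β P Q S) (e : S = S') :
    Comb α β P Q S' := e ▸ h

theorem Comb.ren {α β : Act N} {P Q S} (h : Comb α β P Q S) (f : Ref N → Ref N) :
    Comb (α.ren f) (β.ren f) (P.ren (α.up f)) (Q.ren (β.up f)) (S.ren f) := by
  cases h with
  | outInp x z P Q =>
    refine (Comb.outInp (f x) (f z) (P.ren f) (Q.ren (Ref.up f))).cast ?_
    simp [DB.ren, inst, Ref.up]
  | inpOut x z P Q =>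
    refine (Comb.inpOut (f x) (f z) (P.ren (Ref.up f)) (Q.ren f)).cast ?_
    simp [DB.ren, inst, Ref.up]
  | boutInp x P Q => exact Comb.boutInp (f x) (P.ren (Ref.up f)) (Q.ren (Ref.up f))
  | inpBout x P Q => exact Comb.inpBout (f x) (P.ren (Ref.up f)) (Q.ren (Ref.up f))

theorem Comb.det {α β : Act N} {P Q S S'} (h : Comb α β P Q S) (h' : Comb α β P Q S') :
    S = S' := by
  cases h <;> cases h' <;> rfl

/-- Whether two actions are complementary does not depend on the residuals, and it is not
affected by an injective renaming. -/
theorem Comb.of_ren {α β : Act N} {P Q S} {f : Ref N → Ref N} (hf : Function.Injective f)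
    (h : Comb (α.ren f) (β.ren f) P Q S) (P' Q') : ∃ S', Comb α β P' Q' S' := by
  cases α <;> cases β <;> simp only [Act.ren] at h
  case inp.out x y z =>
    obtain rfl : x = y := hf (by generalize f z = c at h; generalize f x = a at *; cases h; rfl)
    exact ⟨_, .inpOut _ _ _ _⟩
  case inp.bout x y =>
    obtain rfl : x = y := hf (by generalize f x = a at *; cases h; rfl)
    exact ⟨_, .inpBout _ _ _⟩
  case out.inp x z y =>
    obtain rfl : x = y := hf (by generalize f z = c at h; generalize f x = a at *; cases h; rfl)
    exact ⟨_, .outInp _ _ _ _⟩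
  case bout.inp x y =>
    obtain rfl : x = y := hf (by generalize f x = a at *; cases h; rfl)
    exact ⟨_, .boutInp _ _ _⟩
  all_goals exact nomatch h

theorem Comb.ren_inv {α β : Act N} {P Q S} {f : Ref N → Ref N} (hf : Function.Injective f)
    (h : Comb (α.ren f) (β.ren f) (P.ren (α.up f)) (Q.ren (β.up f)) S) :
    ∃ S₀, Comb α β P Q S₀ ∧ S = S₀.ren f := by
  obtain ⟨S₀, h₀⟩ := h.of_ren hf P Q
  exact ⟨S₀, h₀, h.det (h₀.ren f)⟩

/-- A restriction around the second residual may be extended to the whole synchronisation. -/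
theorem Comb.res_right {α β : Act N} {P Q S : DB N} (h : Comb α β P (res (Q.ren β.sw)) S) :
    ∃ S', Comb (α.ren sh) (β.ren sh) (P.ren (α.up sh)) Q S' ∧ SC S (res S') := by
  have hs (P Q : DB N) : (cls P + (cls (Q.ren swap)).res).res =
      (cls (P.ren (Ref.up sh)) + cls Q).res.res := by
    have e : swap ∘ Ref.up sh = (sh : Ref N → Ref N) := Act.sw_comp_up_sh (.inp zero)
    have := cls_swap (par (P.ren (Ref.up sh)) Q)
    simp only [DB.ren, ren_ren, e, cls_par, res_cls_sh_add] at this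
    exact this
  cases h with
  | outInp x z =>
    refine ⟨_, .outInp _ _ _ _, cls_eq.1 ?_⟩
    have : Ref.up (inst z) ∘ swap = inst (sh z) :=
      funext_sh (by simp) fun x => by rcases zero_or_sh x with rfl | ⟨y, rfl⟩ <;> simp
    simp [DB.ren, res_cls_sh_add, this]
  | inpOut x z =>
    refine ⟨_, .inpOut _ _ _ _, cls_eq.1 ?_⟩
    have : inst (sh z) ∘ Ref.up sh = sh ∘ inst z := by simp [inst, Ref.up]
    rw [Act.up_inp]
    simp [this, res_cls_sh_comp_add]
  | boutInp x =>
    refine ⟨_, .boutInp _ _ _, cls_eq.1 ?_⟩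
    simpa using hs P Q
  | inpBout x =>
    refine ⟨_, .inpBout _ _ _, cls_eq.1 ?_⟩
    simpa using hs P Q

theorem Comb.of_res_right {α β : Act N} {P Q S : DB N}
    (h : Comb (α.ren sh) (β.ren sh) (P.ren (α.up sh)) Q S) :
    ∃ S', Comb α β P (res (Q.ren β.sw)) S' ∧ SC (res S) S' := by
  obtain ⟨S₀, h₀⟩ := h.of_ren sh_injective P (res (Q.ren β.sw))
  obtain ⟨S', h', e⟩ := h₀.res_right
  exact ⟨S₀, h₀, (h.det h') ▸ e.symm⟩

/-- A parallel component of the second residual may be kept out of a synchronisation. -/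
theorem Comb.par_right {α β : Act N} {P Q R S : DB N} (h : Comb α β P (par Q (R.ren β.wk)) S) :
    ∃ S', Comb α β P Q S' ∧ SC S (par S' R) := by
  cases h
  · refine ⟨_, .outInp _ _ _ _, cls_eq.1 ?_⟩
    simp [DB.ren, Act.wk, inst, add_assoc]
  · refine ⟨_, .inpOut _ _ _ _, cls_eq.1 ?_⟩
    simp [Act.wk, add_assoc]
  · refine ⟨_, .boutInp _ _ _, cls_eq.1 ?_⟩
    simp [Act.wk, ← add_assoc, res_add_cls_sh]
  · refine ⟨_, .inpBout _ _ _, cls_eq.1 ?_⟩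
    simp [Act.wk, ← add_assoc, res_add_cls_sh]

theorem Comb.add_right {α β : Act N} {P Q S : DB N} (h : Comb α β P Q S) (R : DB N) :
    ∃ S', Comb α β P (par Q (R.ren β.wk)) S' ∧ SC (par S R) S' := by
  cases h
  · refine ⟨_, .outInp _ _ _ _, cls_eq.1 ?_⟩
    simp [DB.ren, Act.wk, inst, add_assoc]
  · refine ⟨_, .inpOut _ _ _ _, cls_eq.1 ?_⟩
    simp [Act.wk, add_assoc]
  · refine ⟨_, .boutInp _ _ _, cls_eq.1 ?_⟩
    simp [Act.wk, ← add_assoc, res_add_cls_sh]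
  · refine ⟨_, .inpBout _ _ _, cls_eq.1 ?_⟩
    simp [Act.wk, ← add_assoc, res_add_cls_sh]

/-- A parallel component may be moved from the second residual of a synchronisation to the
first. -/
theorem Comb.par_mid {α β : Act N} {P Q R S : DB N} (h : Comb α β P (par (Q.ren β.wk) R) S) :
    ∃ S', Comb α β (par P (Q.ren α.wk)) R S' ∧ SC S S' := by
  cases h
  · refine ⟨_, .outInp _ _ _ _, cls_eq.1 ?_⟩
    simp [DB.ren, Act.wk, inst, add_assoc]
  · refine ⟨_, .inpOut _ _ _ _, cls_eq.1 ?_⟩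
    simp [DB.ren, Act.wk, inst, add_assoc]
  · refine ⟨_, .boutInp _ _ _, cls_eq.1 ?_⟩
    simp [Act.wk, add_assoc]
  · refine ⟨_, .inpBout _ _ _, cls_eq.1 ?_⟩
    simp [Act.wk, add_assoc]

theorem Comb.add_left {α β : Act N} {P Q S : DB N} (h : Comb α β P Q S) (R : DB N) :
    ∃ S', Comb α β (par (R.ren α.wk) P) Q S' ∧ SC (par R S) S' := by
  cases h
  · refine ⟨_, .outInp _ _ _ _, cls_eq.1 ?_⟩
    simp [Act.wk, add_assoc]
  · refine ⟨_, .inpOut _ _ _ _, cls_eq.1 ?_⟩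
    simp [DB.ren, Act.wk, inst, add_assoc]
  · refine ⟨_, .boutInp _ _ _, cls_eq.1 ?_⟩
    simp [Act.wk, add_assoc, res_cls_sh_add]
  · refine ⟨_, .inpBout _ _ _, cls_eq.1 ?_⟩
    simp [Act.wk, add_assoc, res_cls_sh_add]

theorem Comb.par_left {α β : Act N} {P Q R S : DB N} (h : Comb α β (DB.par P (R.ren α.wk)) Q S) :
    ∃ S', Comb α β P Q S' ∧ SC S (DB.par S' R) := by
  obtain ⟨S₁, h₁, e₁⟩ := h.symm
  obtain ⟨S₂, h₂, e₂⟩ := h₁.par_right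
  obtain ⟨S₃, h₃, e₃⟩ := h₂.symm
  exact ⟨S₃, h₃, e₁.trans (e₂.trans (.par e₃ (.refl _)))⟩

theorem Comb.res_left {α β : Act N} {P Q S : DB N} (h : Comb α β (DB.res (P.ren α.sw)) Q S) :
    ∃ S', Comb (α.ren sh) (β.ren sh) P (Q.ren (β.up sh)) S' ∧ SC S (DB.res S') := by
  obtain ⟨S₁, h₁, e₁⟩ := h.symm
  obtain ⟨S₂, h₂, e₂⟩ := h₁.res_right
  obtain ⟨S₃, h₃, e₃⟩ := h₂.symm
  exact ⟨S₃, h₃, e₁.trans (e₂.trans (.res e₃))⟩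

theorem Tr.cast {P : DB N} {α P' P''} (h : Tr P α P') (e : P' = P'') : Tr P α P'' := e ▸ h

theorem Tr.ren {P : DB N} {α P'} (h : Tr P α P') (f : Ref N → Ref N) :
    Tr (P.ren f) (α.ren f) (P'.ren (α.up f)) := by
  induction h generalizing f with
  | out x z P => exact .out _ _ _
  | inp x P => exact .inp _ _
  | @parL _ α _ Q _ ih =>
    refine (Tr.parL (Q.ren f) (ih f)).cast ?_
    simp [DB.ren, Act.up_comp_wk]
  | @parR _ α _ P _ ih =>
    refine (Tr.parR (P.ren f) (ih f)).cast ?_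
    simp [DB.ren, Act.up_comp_wk]
  | comm _ _ hc ih1 ih2 => exact .comm (ih1 f) (ih2 f) (hc.ren f)
  | @res _ α P' _ ih =>
    have h1 := ih (Ref.up f)
    have e : (α.ren sh).ren (Ref.up f) = (α.ren f).ren sh := by
      simp only [Act.ren_ren]; congr 1; funext x; simp
    rw [e] at h1
    refine (Tr.res h1).cast ?_
    simp [DB.ren, Act.sw_comp_up_up]
  | @opn _ x P' _ ih =>
    have h1 := ih (Ref.up f)
    simp only [Act.ren, up_sh, up_zero] at h1
    exact .opn h1
  | @rep P α _ _ ih =>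
    refine (Tr.rep (ih f)).cast ?_
    simp only [DB.ren, Act.wk_ren, ren_ren, Act.up_comp_wk]
  | repComm _ _ hc ih1 ih2 => exact .repComm (ih1 f) (ih2 f) (hc.ren f)

/-- An injective renaming adds no transitions. -/
theorem Tr.ren_inv {P : DB N} {f : Ref N → Ref N} (hf : Function.Injective f) {β Q}
    (h : Tr (P.ren f) β Q) : ∃ α P', Tr P α P' ∧ β = α.ren f ∧ Q = P'.ren (α.up f) := by
  induction P generalizing f β Q with
  | nil => cases h
  | tick => cases h
  | out x z P => cases h; exact ⟨_, _, .out x z P, rfl, rfl⟩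
  | inp x P => cases h; exact ⟨_, _, .inp x P, rfl, rfl⟩
  | par P₁ P₂ ih1 ih2 =>
    cases h with
    | parL _ h =>
      obtain ⟨α, P', h', rfl, rfl⟩ := ih1 hf h
      exact ⟨α, _, .parL _ h', rfl, by simp [DB.ren, Act.up_comp_wk]⟩
    | parR _ h =>
      obtain ⟨α, P', h', rfl, rfl⟩ := ih2 hf h
      exact ⟨α, _, .parR _ h', rfl, by simp [DB.ren, Act.up_comp_wk]⟩
    | comm h1 h2 hc =>
      obtain ⟨α, P', h1', rfl, rfl⟩ := ih1 hf h1
      obtain ⟨β, Q', h2', rfl, rfl⟩ := ih2 hf h2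
      obtain ⟨S₀, hc', rfl⟩ := hc.ren_inv hf
      exact ⟨_, _, .comm h1' h2' hc', rfl, rfl⟩
  | res P ih =>
    cases h with
    | res h =>
      obtain ⟨α, P', h', e, rfl⟩ := ih (up_injective hf) h
      obtain ⟨γ, rfl, rfl⟩ := Act.ren_sh_eq_ren_up e
      exact ⟨γ, _, .res h', rfl, by simp [DB.ren, Act.sw_comp_up_up]⟩
    | @opn _ x _ h =>
      obtain ⟨α, P', h', e, rfl⟩ := ih (up_injective hf) h
      cases α <;> simp [Act.ren] at e
      rename_i a b
      obtain ⟨ea, eb⟩ := e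
      rcases zero_or_sh a with rfl | ⟨a, rfl⟩
      · simp at ea
      rcases zero_or_sh b with rfl | ⟨b, rfl⟩
      · simp only [up_sh, sh_inj] at ea
        subst ea
        exact ⟨_, _, .opn h', rfl, rfl⟩
      · simp at eb
  | rep P ih =>
    cases h with
    | rep h =>
      obtain ⟨α, P', h', rfl, rfl⟩ := ih hf h
      refine ⟨α, _, .rep h', rfl, ?_⟩
      simp only [DB.ren, Act.wk_ren, ren_ren, Act.up_comp_wk]
    | repComm h1 h2 hc =>
      obtain ⟨α, P', h1', rfl, rfl⟩ := ih hf h1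
      obtain ⟨β, Q', h2', rfl, rfl⟩ := ih hf h2
      obtain ⟨S₀, hc', rfl⟩ := hc.ren_inv hf
      exact ⟨_, _, .repComm h1' h2' hc', rfl, rfl⟩

end DB

/-! ### Structural congruence is a strong bisimulation -/

namespace DB

variable {N : Type u}

/-- Every transition of `P` is matched by a transition of `Q` with the same label, up to
structural congruence. -/
def Sim (P Q : DB N) : Prop := ∀ α P', Tr P α P' → ∃ Q', Tr Q α Q' ∧ SC P' Q'

theorem Sim.trans {P Q R : DB N} (h : Sim P Q) (h' : Sim Q R) : Sim P R := by
  intro α P' t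
  obtain ⟨Q', t', e⟩ := h α P' t
  obtain ⟨R', t'', e'⟩ := h' α Q' t'
  exact ⟨R', t'', e.trans e'⟩

theorem Sim.par {P P₁ Q Q₁ : DB N} (hP : Sim P P₁) (hQ : Sim Q Q₁) (eP : SC P P₁)
    (eQ : SC Q Q₁) : Sim (par P Q) (par P₁ Q₁) := by
  intro α X t
  cases t with
  | parL _ t =>
    obtain ⟨P', t', e⟩ := hP _ _ t
    exact ⟨_, .parL _ t', .par e (eQ.ren _)⟩
  | parR _ t =>
    obtain ⟨Q', t', e⟩ := hQ _ _ t
    exact ⟨_, .parR _ t', .par (eP.ren _) e⟩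
  | comm t1 t2 hc =>
    obtain ⟨P', t1', e1⟩ := hP _ _ t1
    obtain ⟨Q', t2', e2⟩ := hQ _ _ t2
    obtain ⟨S, hc', e⟩ := hc.congr e1 e2
    exact ⟨S, .comm t1' t2' hc', e⟩

theorem Sim.res {P Q : DB N} (h : Sim P Q) : Sim (res P) (res Q) := by
  intro α X t
  cases t with
  | res t =>
    obtain ⟨P', t', e⟩ := h _ _ t
    exact ⟨_, .res t', .res (e.ren _)⟩
  | opn t =>
    obtain ⟨P', t', e⟩ := h _ _ t
    exact ⟨_, .opn t', e⟩

theorem Sim.rep {P Q : DB N} (h : Sim P Q) (e : SC P Q) : Sim (rep P) (rep Q) := by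
  intro α X t
  cases t with
  | rep t =>
    obtain ⟨P', t', e'⟩ := h _ _ t
    exact ⟨_, .rep t', .par e' ((SC.rep e).ren _)⟩
  | repComm t1 t2 hc =>
    obtain ⟨P', t1', e1⟩ := h _ _ t1
    obtain ⟨Q', t2', e2⟩ := h _ _ t2
    obtain ⟨S, hc', e'⟩ := hc.congr e1 e2
    exact ⟨_, .repComm t1' t2' hc', .par e' (.rep e)⟩

theorem sim_par_comm (P Q : DB N) : Sim (par P Q) (par Q P) := by
  intro α X t
  cases t with
  | parL _ t => exact ⟨_, .parR _ t, .par_comm _ _⟩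
  | parR _ t => exact ⟨_, .parL _ t, .par_comm _ _⟩
  | comm t1 t2 hc =>
    obtain ⟨S, hc', e⟩ := hc.symm
    exact ⟨S, .comm t2 t1 hc', e⟩

theorem sim_par_assoc (P Q R : DB N) : Sim (par P (par Q R)) (par (par P Q) R) := by
  intro α X t
  cases t with
  | parL _ t => exact ⟨_, .parL _ (.parL _ t), .par_assoc _ _ _⟩
  | parR _ t =>
    cases t with
    | parL _ t => exact ⟨_, .parL _ (.parR _ t), .par_assoc _ _ _⟩
    | parR _ t => exact ⟨_, .parR _ t, .par_assoc _ _ _⟩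
    | comm t1 t2 hc =>
      obtain ⟨S, hc', e⟩ := hc.add_left P
      exact ⟨_, .comm (.parR _ t1) t2 hc', by simpa using e⟩
  | comm t1 t2 hc =>
    cases t2 with
    | parL _ t2 =>
      obtain ⟨S, hc', e⟩ := hc.par_right
      exact ⟨_, .parL _ (.comm t1 t2 hc'), by simpa using e⟩
    | parR _ t2 =>
      obtain ⟨S, hc', e⟩ := hc.par_mid
      exact ⟨_, .comm (.parL _ t1) t2 hc', e⟩
    | comm _ _ _ => cases hc

theorem sim_rep_unfold (P : DB N) : Sim (rep P) (par P (rep P)) := by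
  intro α X t
  cases t with
  | rep t => exact ⟨_, .parL _ t, .refl _⟩
  | repComm t1 t2 hc =>
    obtain ⟨S, hc', e⟩ := hc.add_right (DB.rep P)
    exact ⟨_, .comm t1 (.rep t2) hc', e⟩

theorem sim_rep_fold (P : DB N) : Sim (par P (rep P)) (rep P) := by
  intro α X t
  cases t with
  | parL _ t => exact ⟨_, .rep t, .refl _⟩
  | parR _ t =>
    cases t with
    | rep t =>
      refine ⟨_, .rep t, cls_eq.1 ?_⟩
      simp only [DB.ren, cls_par]
      conv_rhs => rw [cls_rep]
      abel
    | repComm t1 t2 hc =>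
      refine ⟨_, .repComm t1 t2 hc, cls_eq.1 ?_⟩
      simp only [Act.wk, ren_id, cls_par]
      conv_rhs => rw [cls_rep]
      abel
  | comm t1 t2 hc =>
    cases t2 with
    | rep t2 =>
      obtain ⟨S, hc', e⟩ := hc.par_right
      exact ⟨_, .repComm t1 t2 hc', e⟩
    | repComm _ _ _ => cases hc

theorem sim_res_comm (P : DB N) : Sim (res (res P)) (res (res (P.ren swap))) := by
  intro α X t
  cases t with
  | res t =>
    generalize hβ : α.ren sh = β at t
    cases t with
    | res t =>
      subst hβ
      have t' := t.ren swap
      have e : ((α.ren sh).ren sh).ren swap = (α.ren sh).ren sh := by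
        simp only [Act.ren_ren]; congr 1; funext x; simp
      rw [e] at t'
      refine ⟨_, .res (.res t'), cls_eq.1 ?_⟩
      simp only [DB.ren, ren_ren, cls_res, Act.sw_ren, Act.up_ren]
      rw [Act.up_sw_braid, ← ren_ren swap, cls_swap]
    | opn t =>
      cases α <;> cases hβ
      have t' := t.ren swap
      simp only [Act.ren, swap_zero, swap_sh_sh] at t'
      exact ⟨_, .opn (.res t'), by simpa using SC.refl _⟩
  | opn t =>
    cases t with
    | res t =>
      have t' := t.ren swap
      simp only [Act.ren, swap_sh_zero, swap_sh_sh] at t'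
      refine ⟨_, .res (.opn t'), cls_eq.1 ?_⟩
      simp [swap]

theorem sim_res_par (P Q : DB N) : Sim (res (par (P.ren sh) Q)) (par P (res Q)) := by
  intro α X t
  cases t with
  | res t =>
    generalize hβ : α.ren sh = β at t
    cases t with
    | parL _ t =>
      obtain ⟨γ, P', t', e, rfl⟩ := t.ren_inv sh_injective
      obtain rfl : α = γ := Act.ren_injective sh_injective (hβ.trans e)
      subst e
      refine ⟨_, .parL _ t', cls_eq.1 ?_⟩
      simp [DB.ren, Act.sw_comp_up_sh, Act.sw_comp_wk, res_cls_sh_add]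
    | parR _ t =>
      subst hβ
      refine ⟨_, .parR _ (.res t), cls_eq.1 ?_⟩
      have : α.sw ∘ α.wk ∘ sh = sh ∘ α.wk := by
        rw [← Function.comp_assoc, Act.sw_comp_wk]; funext x; simp
      simp [DB.ren, this, res_cls_sh_comp_add]
    | comm t1 t2 hc =>
      cases α <;> cases hβ
      obtain ⟨γ, P', t3, rfl, rfl⟩ := t1.ren_inv sh_injective
      rename_i γ' _
      by_cases hγ : ∃ δ : Act N, γ' = δ.ren sh
      · obtain ⟨δ, rfl⟩ := hγ
        obtain ⟨S', hc', e⟩ := hc.of_res_right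
        refine ⟨_, .comm t3 (.res t2) hc', by simpa using e⟩
      · -- The only action that the restriction does not let through is the output of its name.
        cases γ with
        | tau => cases hc
        | inp x =>
          cases hc with
          | inpOut _ z =>
            rcases zero_or_sh z with rfl | ⟨z, rfl⟩
            · refine ⟨_, .comm t3 (.opn t2) (.inpBout _ _ _), cls_eq.1 ?_⟩
              simp [inst, Ref.up]
            · exact absurd ⟨.out x z, rfl⟩ hγ
          | inpBout => exact absurd ⟨.bout x, rfl⟩ hγ
        | out x z => cases hc; exact absurd ⟨.inp x, rfl⟩ hγ
        | bout x => cases hc; exact absurd ⟨.inp x, rfl⟩ hγ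
  | opn t =>
    generalize hβ : Act.out _ _ = β at t
    cases t with
    | parL _ t =>
      obtain ⟨γ, P', t', rfl, rfl⟩ := t.ren_inv sh_injective
      cases γ <;> simp [Act.ren] at hβ
    | parR _ t =>
      subst hβ
      exact ⟨_, .parR _ (.opn t), by simpa using SC.refl _⟩
    | comm t1 t2 hc => cases hβ

theorem sim_par_res (P Q : DB N) : Sim (par P (res Q)) (res (par (P.ren sh) Q)) := by
  intro α X t
  cases t with
  | parL _ t =>
    refine ⟨_, .res (.parL _ (t.ren sh)), cls_eq.1 ?_⟩
    simp [DB.ren, Act.sw_comp_up_sh, Act.sw_comp_wk, res_cls_sh_add]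
  | parR _ t =>
    cases t with
    | res t =>
      refine ⟨_, .res (.parR _ t), cls_eq.1 ?_⟩
      have : α.sw ∘ α.wk ∘ sh = sh ∘ α.wk := by
        rw [← Function.comp_assoc, Act.sw_comp_wk]; funext x; simp
      simp [DB.ren, this, res_cls_sh_comp_add]
    | opn t =>
      refine ⟨_, .opn (.parR _ t), cls_eq.1 ?_⟩
      simp
  | comm t1 t2 hc =>
    cases t2 with
    | res t2 =>
      obtain ⟨S', hc', e⟩ := hc.res_right
      exact ⟨_, .res (α := .tau) (.comm (t1.ren sh) t2 hc'), by simpa using e⟩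
    | opn t2 =>
      cases hc
      refine ⟨_, .res (α := .tau) (.comm (t1.ren sh) t2 (.inpOut _ _ _ _)), cls_eq.1 ?_⟩
      simp [inst, Ref.up]

theorem SC.sim {P Q : DB N} (h : SC P Q) : Sim P Q ∧ Sim Q P := by
  induction h with
  | refl P => exact ⟨fun _ _ t => ⟨_, t, .refl _⟩, fun _ _ t => ⟨_, t, .refl _⟩⟩
  | symm _ ih => exact ih.symm
  | trans _ _ ih1 ih2 => exact ⟨ih1.1.trans ih2.1, ih2.2.trans ih1.2⟩
  | out x z h =>
    constructor
    · intro α X t; cases t; exact ⟨_, .out _ _ _, h⟩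
    · intro α X t; cases t; exact ⟨_, .out _ _ _, h.symm⟩
  | inp x h =>
    constructor
    · intro α X t; cases t; exact ⟨_, .inp _ _, h⟩
    · intro α X t; cases t; exact ⟨_, .inp _ _, h.symm⟩
  | par h1 h2 ih1 ih2 => exact ⟨ih1.1.par ih2.1 h1 h2, ih1.2.par ih2.2 h1.symm h2.symm⟩
  | res _ ih => exact ⟨ih.1.res, ih.2.res⟩
  | rep h ih => exact ⟨ih.1.rep h, ih.2.rep h.symm⟩
  | par_assoc P Q R =>
    refine ⟨sim_par_assoc P Q R, ?_⟩
    have h1 := sim_par_comm (DB.par P Q) R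
    have h2 := Sim.par (sim_par_comm P Q) (fun _ _ t => ⟨_, t, .refl _⟩) (.par_comm _ _) (.refl R)
    have h3 := (sim_par_comm (DB.par Q P) R).trans (sim_par_assoc R Q P)
    have h4 := Sim.par (sim_par_comm R Q) (fun _ _ t => ⟨_, t, .refl _⟩) (.par_comm _ _) (.refl P)
    exact ((h2.trans h3).trans h4).trans (sim_par_comm _ _)
  | par_comm P Q => exact ⟨sim_par_comm P Q, sim_par_comm Q P⟩
  | par_nil P =>
    constructor
    · intro α X t
      cases t with
      | parL _ t => exact ⟨_, t, .par_nil _⟩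
      | parR _ t => cases t
      | comm _ t _ => cases t
    · intro α X t
      exact ⟨_, .parL _ t, (SC.par_nil _).symm⟩
  | rep_unfold P => exact ⟨sim_rep_unfold P, sim_rep_fold P⟩
  | res_nil =>
    constructor
    · intro α X t
      cases t with
      | res t => cases t
      | opn t => cases t
    · intro α X t; cases t
  | res_comm P =>
    refine ⟨sim_res_comm P, ?_⟩
    have h := sim_res_comm (P.ren swap)
    have e : swap ∘ swap = (id : Ref N → Ref N) :=
      funext_sh (by simp) fun x => by rcases zero_or_sh x with rfl | ⟨y, rfl⟩ <;> simp
    rwa [ren_ren, e, ren_id] at h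
  | res_par P Q => exact ⟨sim_res_par P Q, sim_par_res P Q⟩

/-- Transitions of structurally congruent processes match. -/
theorem SC.tr {P Q : DB N} (h : SC P Q) {α P'} (t : Tr P α P') :
    ∃ Q', Tr Q α Q' ∧ SC P' Q' := h.sim.1 _ _ t

end DB

/-! ### Inert reductions -/

namespace DB

variable {N : Type u}

/-- Inert reductions: a communication along a private channel that occurs nowhere else. The two
base cases are `(νu)(ūz | u(v).Q) ⟼ Q{z/v}` and
`(νu)(u(v).P | (νv)(ūv | v(w).Q)) ⟼ (νv)(P | v(w).Q)`, where `u` is not free in `P` and `Q`, nor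
`v` in `Q`. -/
inductive Inert : DB N → DB N → Prop
  | free (z : Ref N) (Q : DB N) : Inert (res (par (out zero (sh z) nil) (inp zero (Q.ren (up sh)))))
      (Q.ren (inst z))
  | bound (P Q : DB N) : Inert (res (par (inp zero (P.ren (up sh)))
        (res (par (out (sh zero) zero nil) (inp zero (Q.ren (up (sh ∘ sh))))))))
      (res (par P (inp zero (Q.ren (up sh)))))
  | par {P P'} (Q) : Inert P P' → Inert (par P Q) (par P' Q)
  | res {P P'} : Inert P P' → Inert (res P) (res P')
  | struct {P P₁ P₂ P'} : SC P P₁ → Inert P₁ P₂ → SC P₂ P' → Inert P P'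

theorem Inert.ren {P P' : DB N} (h : Inert P P') (f : Ref N → Ref N) :
    Inert (P.ren f) (P'.ren f) := by
  induction h generalizing f with
  | free z Q =>
    have := Inert.free (f z) (Q.ren (up f))
    simpa [DB.ren, up, inst, Function.comp_assoc] using this
  | bound P Q =>
    have := Inert.bound (P.ren (up f)) (Q.ren (up f))
    simpa [DB.ren, up, Function.comp_assoc] using this
  | par Q _ ih => exact .par _ (ih f)
  | res _ ih => exact .res (ih _)
  | struct e _ e' ih => exact .struct (e.ren f) (ih f) (e'.ren f)

theorem Inert.reports {P P' : DB N} (h : Inert P P') (hP : P.Reports) : P'.Reports := by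
  induction h with
  | free z Q => simp [Reports] at hP
  | bound P Q => simp [Reports] at hP
  | par Q _ ih => exact hP.imp ih id
  | res _ ih => exact ih hP
  | struct e _ e' ih => exact e'.reports.1 (ih (e.reports.1 hP))

theorem res_free_eq (z : Ref N) (Q : DB N) :
    (cls ((Q.ren (up sh)).ren (inst (sh z)))).res = cls (Q.ren (inst z)) := by
  have : inst (sh z) ∘ up sh = sh ∘ inst z := by simp [inst, up]
  rw [ren_ren, this, ← ren_ren, res_cls_sh]

theorem res_bound_eq (P Q : DB N) :
    (cls (P.ren (up sh)) + cls (inp zero (Q.ren (up (sh ∘ sh))))).res.res =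
      (cls P + cls (inp zero (Q.ren (up sh)))).res := by
  have e : swap ∘ up sh = (sh : Ref N → Ref N) := Act.sw_comp_up_sh (.inp zero)
  have e' : up swap ∘ up (sh ∘ sh) = up (sh ∘ sh : Ref N → Ref N) := by
    rw [up_comp]; congr 1; funext x; simp
  have e2 : (DB.par (P.ren (up sh)) (inp zero (Q.ren (up (sh ∘ sh))))).ren swap =
      (DB.par P (inp zero (Q.ren (up sh)))).ren sh := by
    simp only [DB.ren, ren_ren, e, e', up_comp, swap_zero]
  rw [← cls_par, ← cls_swap, e2, res_cls_sh, cls_par]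

/-- An inert reduction is a reduction. -/
theorem Inert.tr {P P' : DB N} (h : Inert P P') : ∃ P'', Tr P .tau P'' ∧ SC P'' P' := by
  induction h with
  | free z Q =>
    refine ⟨_, .res (α := .tau) (.comm (.out _ _ _) (.inp _ _) (.outInp _ _ _ _)), cls_eq.1 ?_⟩
    rw [Act.sw_tau, ren_id, cls_res, cls_par, cls_nil, zero_add, res_free_eq]
  | bound P Q =>
    refine ⟨_, .res (α := .tau) (.comm (.inp _ _) (.opn (.parL _ (.out _ _ _)))
      (.inpBout _ _ _)), cls_eq.1 ?_⟩
    rw [Act.sw_tau, ren_id, Act.wk_out, ren_id]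
    simp [res_bound_eq]
  | par Q _ ih =>
    obtain ⟨R, t, e⟩ := ih
    exact ⟨_, .parL _ t, by simpa using .par e (.refl Q)⟩
  | res _ ih =>
    obtain ⟨R, t, e⟩ := ih
    exact ⟨_, .res (α := .tau) t, by simpa using .res e⟩
  | struct e _ e' ih =>
    obtain ⟨R, t, e₁⟩ := ih
    obtain ⟨R', t', e₂⟩ := e.symm.tr t
    exact ⟨R', t', e₂.symm.trans (e₁.trans e')⟩

/-- The process `(νu)(x̄u | u(v).R)` can do nothing but send its private name. -/
theorem tr_res_out_inp {x : Ref N} {R : DB N} {α t}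
    (h : Tr (DB.res (DB.par (out (sh x) zero nil) (inp zero R))) α t) :
    α = .bout x ∧ cls t = cls (inp zero R) := by
  cases h with
  | res h =>
    generalize hγ : α.ren sh = γ at h
    cases h with
    | parL _ h => cases h; cases α <;> simp at hγ
    | parR _ h => cases h; cases α <;> simp at hγ
    | comm h₁ h₂ hc => cases h₁; cases h₂; exact absurd hc.subject_eq (sh_ne_zero x)
  | opn h =>
    generalize hγ : Act.out _ _ = γ at h
    cases h with
    | parL _ h =>
      cases h
      simp only [Act.out.injEq, sh_inj, and_true] at hγ
      subst hγ
      exact ⟨rfl, by simp⟩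
    | parR _ h => cases h; simp at hγ
    | comm _ _ _ => cases hγ

/-- Inert reductions commute with every transition: they neither disable nor are disabled. -/
theorem Inert.diamond {P P' : DB N} (h : Inert P P') {α Q} (t : Tr P α Q) :
    (α = .tau ∧ SC Q P') ∨ ∃ Q', Tr P' α Q' ∧ Inert Q Q' := by
  induction h generalizing α Q with
  | free z R =>
    left
    cases t with
    | res t =>
      generalize hβ : α.ren sh = β at t
      cases t with
      | parL _ t => cases t; cases α <;> simp at hβ
      | parR _ t => cases t; cases α <;> simp at hβ
      | comm t1 t2 hc =>
        cases α <;> cases hβ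
        cases t1; cases t2; cases hc
        refine ⟨rfl, cls_eq.1 ?_⟩
        rw [Act.sw_tau, ren_id, cls_res, cls_par, cls_nil, zero_add, res_free_eq]
    | opn t =>
      generalize hβ : Act.out _ _ = β at t
      cases t with
      | parL _ t => cases t; simp at hβ
      | parR _ t => cases t; simp at hβ
      | comm _ _ _ => cases hβ
  | bound R S =>
    left
    cases t with
    | res t =>
      generalize hβ : α.ren sh = β at t
      cases t with
      | parL _ t => cases t; cases α <;> simp at hβ
      | parR _ t =>
        obtain ⟨rfl, -⟩ := tr_res_out_inp t
        cases α <;> simp at hβ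
      | comm t1 t2 hc =>
        cases α <;> cases hβ
        obtain ⟨rfl, e⟩ := tr_res_out_inp t2
        cases t1; cases hc
        refine ⟨rfl, cls_eq.1 ?_⟩
        rw [Act.sw_tau, ren_id, cls_res, cls_res, cls_par, e]
        simp [res_bound_eq]
    | opn t =>
      generalize hβ : Act.out _ _ = β at t
      cases t with
      | parL _ t => cases t; simp at hβ
      | parR _ t => obtain ⟨rfl, -⟩ := tr_res_out_inp t; simp at hβ
      | comm _ _ _ => cases hβ
  | @par P P' R h ih =>
    cases t with
    | parL _ t =>
      rcases ih t with ⟨rfl, e⟩ | ⟨Q', t', i⟩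
      · exact .inl ⟨rfl, by simpa using .par e (.refl R)⟩
      · exact .inr ⟨_, .parL _ t', .par _ i⟩
    | parR _ t => exact .inr ⟨_, .parR _ t, .par _ (h.ren _)⟩
    | comm t1 t2 hc =>
      rcases ih t1 with ⟨rfl, e⟩ | ⟨Q', t', i⟩
      · cases hc
      · right
        cases hc with
        | outInp => exact ⟨_, .comm t' t2 (.outInp _ _ _ _), .par _ i⟩
        | inpOut => exact ⟨_, .comm t' t2 (.inpOut _ _ _ _), .par _ (i.ren _)⟩
        | boutInp => exact ⟨_, .comm t' t2 (.boutInp _ _ _), .res (.par _ i)⟩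
        | inpBout => exact ⟨_, .comm t' t2 (.inpBout _ _ _), .res (.par _ i)⟩
  | res h ih =>
    cases t with
    | res t =>
      rcases ih t with ⟨h, e⟩ | ⟨Q', t', i⟩
      · cases α <;> cases h
        exact .inl ⟨rfl, by simpa using .res e⟩
      · exact .inr ⟨_, .res t', .res (i.ren _)⟩
    | opn t =>
      rcases ih t with ⟨h, e⟩ | ⟨Q', t', i⟩
      · cases h
      · exact .inr ⟨_, .opn t', i⟩
  | struct e h e' ih =>
    obtain ⟨Q₁, t₁, e₁⟩ := e.tr t
    rcases ih t₁ with ⟨rfl, e₂⟩ | ⟨Q', t', i⟩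
    · exact .inl ⟨rfl, e₁.trans (e₂.trans e')⟩
    · obtain ⟨Q₂, t₂, e₂⟩ := e'.tr t'
      exact .inr ⟨Q₂, t₂, .struct e₁ i e₂⟩

/-- A sequence of `n` inert reductions, up to structural congruence. -/
inductive InertSeq : ℕ → DB N → DB N → Prop
  | zero {P Q} : SC P Q → InertSeq 0 P Q
  | succ {n P Q R} : Inert P Q → InertSeq n Q R → InertSeq (n + 1) P R

theorem InertSeq.struct_left {n} {P P' Q : DB N} (e : SC P P') (h : InertSeq n P' Q) :
    InertSeq n P Q := by
  cases h with
  | zero e' => exact .zero (e.trans e')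
  | succ i h => exact .succ (.struct e i (.refl _)) h

theorem InertSeq.struct_right {n} {P Q Q' : DB N} (h : InertSeq n P Q) (e : SC Q Q') :
    InertSeq n P Q' := by
  induction h with
  | zero e' => exact .zero (e'.trans e)
  | succ i _ ih => exact .succ i (ih e)

theorem InertSeq.par {n} {P Q : DB N} (h : InertSeq n P Q) (R) :
    InertSeq n (par P R) (par Q R) := by
  induction h with
  | zero e => exact .zero (.par e (.refl _))
  | succ i _ ih => exact .succ (.par _ i) ih

theorem InertSeq.res {n} {P Q : DB N} (h : InertSeq n P Q) : InertSeq n (res P) (res Q) := by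
  induction h with
  | zero e => exact .zero (.res e)
  | succ i _ ih => exact .succ (.res i) ih

theorem InertSeq.ren {n} {P Q : DB N} (h : InertSeq n P Q) (f : Ref N → Ref N) :
    InertSeq n (P.ren f) (Q.ren f) := by
  induction h with
  | zero e => exact .zero (e.ren f)
  | succ i _ ih => exact .succ (i.ren f) ih

theorem InertSeq.trans {m n} {P Q R : DB N} (h : InertSeq m P Q) (h' : InertSeq n Q R) :
    InertSeq (m + n) P R := by
  induction h with
  | zero e => simpa using h'.struct_left e
  | @succ k _ _ _ i _ ih =>
    rw [Nat.add_right_comm]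
    exact .succ i (ih h')

theorem InertSeq.reports {n} {P Q : DB N} (h : InertSeq n P Q) (hP : P.Reports) :
    Q.Reports := by
  induction h with
  | zero e => exact e.reports.1 hP
  | succ i _ ih => exact ih (i.reports hP)

/-- A reduction either is one of the pending inert reductions, or it survives them. -/
theorem InertSeq.diamond {n} {P P' : DB N} (h : InertSeq n P P') {Q} (t : Tr P .tau Q) :
    (∃ m < n, InertSeq m Q P') ∨ ∃ Q', Tr P' .tau Q' ∧ InertSeq n Q Q' := by
  induction h generalizing Q with
  | zero e =>
    obtain ⟨Q', t', e'⟩ := e.tr t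
    exact .inr ⟨Q', t', .zero e'⟩
  | @succ n P P₁ P' i h ih =>
    rcases i.diamond t with ⟨-, e⟩ | ⟨Q₁, t₁, i₁⟩
    · exact .inl ⟨n, n.lt_succ_self, h.struct_left e⟩
    · rcases ih t₁ with ⟨m, hm, h'⟩ | ⟨Q', t', h'⟩
      · exact .inl ⟨m + 1, Nat.succ_lt_succ hm, .succ i₁ h'⟩
      · exact .inr ⟨Q', t', .succ i₁ h'⟩

end DB

/-! ### Operational correspondence of handshake encodings -/

namespace Act

variable {N : Type u}

/-- The two kinds of labels with a binder. -/
def bnd : Bool → Ref N → Act N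
  | true, x => inp x
  | false, x => bout x

@[simp] theorem wk_bnd (b : Bool) (x : Ref N) : (bnd b x).wk = sh := by cases b <;> rfl

@[simp] theorem sw_bnd (b : Bool) (x : Ref N) : (bnd b x).sw = swap := by cases b <;> rfl

@[simp] theorem ren_bnd (f) (b : Bool) (x : Ref N) : (bnd b x).ren f = bnd b (f x) := by
  cases b <;> rfl

/-- The label with which an encoding answers a source label, if it translates an output prefix
to an input (`b = true`) or to a bound output (`b = false`) and an input prefix to the
complementary one. -/
def enc (b : Bool) : Act N → Act N
  | tau => tau
  | inp x => bnd (!b) x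
  | out x _ => bnd b x
  | bout x => bnd b x

@[simp] theorem enc_tau (b : Bool) : (tau : Act N).enc b = tau := rfl

@[simp] theorem enc_inp (b : Bool) (x : Ref N) : (inp x).enc b = bnd (!b) x := rfl

@[simp] theorem enc_out (b : Bool) (x z : Ref N) : (out x z).enc b = bnd b x := rfl

@[simp] theorem enc_bout (b : Bool) (x : Ref N) : (bout x).enc b = bnd b x := rfl

theorem ren_enc (b : Bool) (α : Act N) (f) : (α.enc b).ren f = (α.ren f).enc b := by
  cases α <;> simp

theorem enc_ne_out (b : Bool) (α : Act N) (x z) : α.enc b ≠ out x z := by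
  cases α <;> cases b <;> simp [enc, bnd]

theorem of_ren_sh_eq_bnd {γ : Act N} {b : Bool} {x : Ref N} (h : γ.ren sh = bnd b x) :
    ∃ y, x = sh y ∧ γ = bnd b y := by
  cases b <;> cases γ <;> simp [bnd] at h <;> exact ⟨_, h.symm, rfl⟩

end Act

namespace DB

variable {N : Type u}

theorem Comb.bnd (b : Bool) (x : Ref N) (P Q : DB N) :
    Comb (Act.bnd b x) (Act.bnd (!b) x) P Q (DB.res (DB.par P Q)) := by
  cases b
  · exact .boutInp _ _ _
  · exact .inpBout _ _ _

theorem Comb.bnd' (b : Bool) (x : Ref N) (P Q : DB N) :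
    Comb (Act.bnd (!b) x) (Act.bnd b x) P Q (DB.res (DB.par P Q)) := by
  cases b
  · exact .inpBout _ _ _
  · exact .boutInp _ _ _

/-- `P` can become `Q` by inert reductions alone. -/
def Settles (P Q : DB N) : Prop := ∃ n, InertSeq n P Q

theorem Settles.cls_congr {P P' Q Q' : DB N} (h : Settles P Q) (e : cls P' = cls P)
    (e' : cls Q = cls Q') : Settles P' Q' := by
  obtain ⟨n, h⟩ := h
  exact ⟨n, (h.struct_left (cls_eq.1 e)).struct_right (cls_eq.1 e')⟩

theorem Settles.par {P Q : DB N} (h : Settles P Q) (R) : Settles (par P R) (par Q R) :=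
  h.imp fun _ h => h.par R

theorem Settles.res {P Q : DB N} (h : Settles P Q) : Settles (res P) (res Q) :=
  h.imp fun _ h => h.res

theorem Settles.trans {P Q R : DB N} (h : Settles P Q) (h' : Settles Q R) : Settles P R := by
  obtain ⟨m, h⟩ := h
  obtain ⟨n, h'⟩ := h'
  exact ⟨_, h.trans h'⟩

theorem Inert.settles {P Q : DB N} (h : Inert P Q) : Settles P Q := ⟨1, .succ h (.zero (.refl _))⟩

/-- The process `t`, in which the innermost index stands for the private channel of a handshake,
encodes an input with continuation `s`, in which the innermost index stands for the name to be
received: whatever the name `z` offered by the partner `other z P`, the handshake ends by inert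
reductions in `P` and the encoding of the instantiated continuation. -/
def Receives (enc : DB N → DB N) (other : Ref N → DB N → DB N) (t s : DB N) : Prop :=
  ∀ f z P, Settles (res (par (other z P) (t.ren (up f)))) (par P (enc (s.ren (scons z f))))

/-- A homomorphic encoding of nameless processes, with the prefixes translated to a handshake:
the first step of an output prefix leads to `other z P`, and the first step of an input prefix to a
process that completes the handshake by inert reductions. The parameter `b` is that of `Act.enc`:
it tells which of the two prefixes is translated to an input. -/
structure Handshake (b : Bool) (enc : DB N → DB N) (other : Ref N → DB N → DB N) : Prop where
  nil : enc nil = nil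
  tick : enc tick = tick
  par : ∀ P Q, enc (par P Q) = par (enc P) (enc Q)
  res : ∀ P, enc (res P) = res (enc P)
  rep : ∀ P, enc (rep P) = rep (enc P)
  ren : ∀ f P, enc (P.ren f) = (enc P).ren f
  other_ren : ∀ f z P, (other z P).ren (up f) = other (f z) (P.ren f)
  out_step : ∀ x z P, ∃ t, Tr (enc (out x z P)) (Act.bnd b x) t
  out_tr : ∀ x z P α t, Tr (enc (out x z P)) α t →
    α = Act.bnd b x ∧ cls t = cls (other z (enc P))
  inp_step : ∀ x P, ∃ t, Tr (enc (inp x P)) (Act.bnd (!b) x) t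
  inp_tr : ∀ x P α t, Tr (enc (inp x P)) α t →
    α = Act.bnd (!b) x ∧ Receives enc other t P
  out_congr : ∀ x z P Q, SC (enc P) (enc Q) → SC (enc (out x z P)) (enc (out x z Q))
  inp_congr : ∀ x P Q, SC (enc P) (enc Q) → SC (enc (inp x P)) (enc (inp x Q))
  out_not_reports : ∀ x z P, ¬ (enc (out x z P)).Reports
  inp_not_reports : ∀ x P, ¬ (enc (inp x P)).Reports

/-- `Answers enc other α t s`: after the source action `α` to `s`, the encoding is in state `t`.
For outputs this is expressed by the interaction with all matching inputs. -/
def Answers (enc : DB N → DB N) (other : Ref N → DB N → DB N) :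
    Act N → DB N → DB N → Prop
  | .tau, t, s => Settles t (enc s)
  | .inp _, t, s => Receives enc other t s
  | .out _ z, t, s => ∀ t' s', Receives enc other t' s' →
      Settles (res (par t t')) (par (enc s) (enc (s'.ren (inst z))))
  | .bout _, t, s => ∀ t' s', Receives enc other t' s' →
      Settles (res (par t t')) (res (par (enc s) (enc s')))

theorem swap_sh_cls (P Q : DB N) :
    (cls P + cls (Q.ren (up sh))).res.res = ((cls (P.ren swap)).res + cls Q).res := by
  have e : swap ∘ up sh = (sh : Ref N → Ref N) := Act.sw_comp_up_sh (.inp zero)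
  rw [← res_add_cls_sh, ← cls_par, ← cls_swap]
  simp only [DB.ren, ren_ren, e, cls_par]

namespace Handshake

variable {b : Bool} {enc : DB N → DB N} {other : Ref N → DB N → DB N}

theorem receives_ren {t s : DB N} (ht : Receives enc other t s) (f) :
    Receives enc other (t.ren (up f)) (s.ren (up f)) := by
  intro g z P
  have := ht (g ∘ f) z P
  simpa [up, Function.comp_assoc] using this

theorem answers_congr {α : Act N} {t t' s s' : DB N}
    (ha : Answers enc other α t s) (et : cls t = cls t')
    (es : ∀ f, cls (enc (s.ren f)) = cls (enc (s'.ren f))) : Answers enc other α t' s' := by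
  have es' : cls (enc s) = cls (enc s') := by simpa using es id
  cases α with
  | tau => exact ha.cls_congr et.symm es'
  | inp x =>
    intro f z P
    exact (ha f z P).cls_congr (by simp [cls_ren_congr et]) (by simp [es])
  | out x z =>
    intro t₁ s₁ h₁
    exact (ha t₁ s₁ h₁).cls_congr (by simp [et]) (by simp [es'])
  | bout x =>
    intro t₁ s₁ h₁
    exact (ha t₁ s₁ h₁).cls_congr (by simp [et]) (by simp [es'])

theorem answers_par (h : Handshake b enc other) {α : Act N} {t s : DB N}
    (ha : Answers enc other α t s) (R : DB N) :
    Answers enc other α (DB.par t ((enc R).ren (α.enc b).wk)) (DB.par s (R.ren α.wk)) := by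
  cases α with
  | tau =>
    refine (Settles.par ha (enc R)).cls_congr ?_ ?_ <;> simp [h.par]
  | inp x =>
    intro f z P
    refine ((ha f z P).par ((enc R).ren f)).cls_congr ?_ ?_
    · have e : up f ∘ sh = sh ∘ f := by simp [up]
      simp [DB.ren, e, ← add_assoc, res_add_cls_sh_comp]
    · simp [DB.ren, h.par, h.ren, add_assoc]
  | out x z =>
    intro t₁ s₁ h₁
    refine ((ha t₁ s₁ h₁).par (enc R)).cls_congr ?_ ?_
    · simp only [Act.enc_out, Act.wk_bnd, cls_res, cls_par]
      rw [add_right_comm, res_add_cls_sh]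
    · simp [h.par, add_right_comm]
  | bout x =>
    intro t₁ s₁ h₁
    refine ((ha t₁ s₁ h₁).par (enc R)).cls_congr ?_ ?_
    · simp only [Act.enc_bout, Act.wk_bnd, cls_res, cls_par]
      rw [add_right_comm, res_add_cls_sh]
    · simp only [Act.wk_bout, h.par, h.ren, cls_res, cls_par]
      rw [add_right_comm, res_add_cls_sh]

theorem answers_res (h : Handshake b enc other) {α : Act N} {t s : DB N}
    (ha : Answers enc other (α.ren sh) t s) :
    Answers enc other α (DB.res (t.ren (α.enc b).sw)) (DB.res (s.ren α.sw)) := by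
  cases α with
  | tau =>
    refine (Settles.res ha).cls_congr ?_ ?_ <;> simp [h.res]
  | inp x =>
    intro f z P
    have e1 := (ha (up f) (sh z) (P.ren sh)).res
    refine e1.cls_congr ?_ ?_
    · simp only [Act.enc_inp, Act.sw_bnd, DB.ren, ren_ren, cls_res, cls_par]
      have e : up (up f) ∘ swap = swap ∘ up (up f) := (Act.sw_comp_up_up (.inp z) f).symm
      rw [← h.other_ren, e, add_comm, add_comm (cls (DB.ren _ _)), swap_sh_cls, ren_ren]
    · have e : up (scons z f) ∘ swap = scons (sh z) (up f) :=
        funext_sh (by simp) fun x => by rcases zero_or_sh x with rfl | ⟨y, rfl⟩ <;> simp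
      simp [DB.ren, h.res, e, res_cls_sh_add]
  | out x z =>
    intro t₁ s₁ h₁
    have e1 := (ha _ _ (receives_ren h₁ sh)).res
    refine e1.cls_congr ?_ ?_
    · simp [swap_sh_cls]
    · have e : inst (sh z) ∘ up sh = sh ∘ inst z := by simp [inst, up]
      simp only [Act.sw_out, ren_id, h.res, ren_ren, cls_res, cls_par]
      rw [e, ← ren_ren, h.ren, res_add_cls_sh]
  | bout x =>
    intro t₁ s₁ h₁
    have e1 := (ha _ _ (receives_ren h₁ sh)).res
    refine e1.cls_congr ?_ ?_
    · simp [swap_sh_cls]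
    · simp [h.res, h.ren, swap_sh_cls]

theorem answers_opn {x : Ref N} {t s : DB N}
    (ha : Answers enc other (.out (sh x) zero) t s) :
    Answers enc other (.bout x) (DB.res (t.ren swap)) s := by
  intro t₁ s₁ h₁
  have e1 := (ha _ _ (receives_ren h₁ sh)).res
  refine e1.cls_congr ?_ ?_
  · simp [swap_sh_cls]
  · have : inst zero ∘ up sh = (id : Ref N → Ref N) := by simp [inst, up]
    simp [this]

/-- Synchronisations of encoded processes correspond to those of the processes. -/
theorem answers_comb (h : Handshake b enc other) {α β : Act N} {t₁ t₂ s₁ s₂ S : DB N}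
    (h₁ : Answers enc other α t₁ s₁) (h₂ : Answers enc other β t₂ s₂)
    (hc : Comb α β s₁ s₂ S) :
    ∃ T, Comb (α.enc b) (β.enc b) t₁ t₂ T ∧ Answers enc other .tau T S := by
  cases hc with
  | outInp =>
    refine ⟨_, .bnd b _ _ _, ?_⟩
    exact (h₁ _ _ h₂).cls_congr rfl (by rw [h.par])
  | inpOut =>
    refine ⟨_, .bnd' b _ _ _, ?_⟩
    exact (h₂ _ _ h₁).cls_congr (by simp [add_comm]) (by rw [h.par]; simp [add_comm])
  | boutInp =>
    refine ⟨_, .bnd b _ _ _, ?_⟩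
    exact (h₁ _ _ h₂).cls_congr rfl (by rw [h.res, h.par])
  | inpBout =>
    refine ⟨_, .bnd' b _ _ _, ?_⟩
    exact (h₂ _ _ h₁).cls_congr (by simp [add_comm]) (by rw [h.res, h.par]; simp [add_comm])

theorem comb_of_enc {α β : Act N} {t₁ t₂ T : DB N}
    (hc : Comb (α.enc b) (β.enc b) t₁ t₂ T) (s₁ s₂ : DB N) : ∃ S, Comb α β s₁ s₂ S := by
  cases b <;> cases α <;> cases β <;>
    simp only [Act.enc, Act.bnd, Bool.not_true, Bool.not_false] at hc <;> cases hc <;>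
    exact ⟨_, by constructor⟩

/-- Each transition of a process is answered by its encoding. -/
theorem complete (h : Handshake b enc other) {s s' : DB N} {α} (t : Tr s α s') :
    ∃ t', Tr (enc s) (α.enc b) t' ∧ Answers enc other α t' s' := by
  induction t with
  | out x z P =>
    obtain ⟨t, ht⟩ := h.out_step x z P
    refine ⟨t, ht, fun t' s' h' => ?_⟩
    have := h' id z (enc P)
    refine this.cls_congr ?_ (by simp [inst])
    simp [(h.out_tr _ _ _ _ _ ht).2, up_id]
  | inp x P =>
    obtain ⟨t, ht⟩ := h.inp_step x P
    exact ⟨t, ht, (h.inp_tr _ _ _ _ ht).2⟩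
  | parL Q _ ih =>
    obtain ⟨t, ht, ha⟩ := ih
    rw [h.par]
    exact ⟨_, .parL _ ht, h.answers_par ha _⟩
  | parR P _ ih =>
    obtain ⟨t, ht, ha⟩ := ih
    rw [h.par]
    refine ⟨_, .parR _ ht, answers_congr (h.answers_par ha P) ?_ ?_⟩
    · simp [add_comm]
    · simp [DB.ren, h.par, add_comm]
  | comm _ _ hc ih₁ ih₂ =>
    obtain ⟨t₁, ht₁, ha₁⟩ := ih₁
    obtain ⟨t₂, ht₂, ha₂⟩ := ih₂
    obtain ⟨T, hc', ha⟩ := h.answers_comb ha₁ ha₂ hc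
    rw [h.par]
    exact ⟨T, .comm ht₁ ht₂ hc', ha⟩
  | res _ ih =>
    obtain ⟨t, ht, ha⟩ := ih
    rw [h.res]
    rw [← Act.ren_enc] at ht
    exact ⟨_, .res ht, h.answers_res ha⟩
  | opn _ ih =>
    obtain ⟨t, ht, ha⟩ := ih
    rw [h.res]
    refine ⟨_, .res (α := Act.bnd b _) (by simpa using ht), by simpa using answers_opn ha⟩
  | @rep P _ _ _ ih =>
    obtain ⟨t, ht, ha⟩ := ih
    rw [h.rep]
    have := h.answers_par ha (DB.rep P)
    rw [h.rep] at this
    exact ⟨_, .rep ht, this⟩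
  | @repComm P _ _ _ _ _ _ _ hc ih₁ ih₂ =>
    obtain ⟨t₁, ht₁, ha₁⟩ := ih₁
    obtain ⟨t₂, ht₂, ha₂⟩ := ih₂
    obtain ⟨T, hc', ha⟩ := h.answers_comb ha₁ ha₂ hc
    have := h.answers_par ha (DB.rep P)
    rw [h.rep] at this ⊢
    exact ⟨_, .repComm ht₁ ht₂ hc', by simpa using this⟩

/-- Each transition of an encoded process answers a transition of the process. -/
theorem sound (h : Handshake b enc other) {s t : DB N} {β} (ht : Tr (enc s) β t) :
    ∃ α s', Tr s α s' ∧ β = α.enc b ∧ Answers enc other α t s' := by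
  have hcomm : ∀ {α₁ α₂ : Act N} {t₁ t₂ s₁ s₂ T : DB N},
      Answers enc other α₁ t₁ s₁ → Answers enc other α₂ t₂ s₂ →
      Comb (α₁.enc b) (α₂.enc b) t₁ t₂ T →
      ∃ S, Comb α₁ α₂ s₁ s₂ S ∧ Answers enc other .tau T S := by
    intro α₁ α₂ t₁ t₂ s₁ s₂ T ha₁ ha₂ hc
    obtain ⟨S, hS⟩ := comb_of_enc hc s₁ s₂
    obtain ⟨T', hT', ha⟩ := h.answers_comb ha₁ ha₂ hS
    exact ⟨S, hS, hc.det hT' ▸ ha⟩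
  induction s generalizing β t with
  | nil => rw [h.nil] at ht; cases ht
  | tick => rw [h.tick] at ht; cases ht
  | out x z P =>
    obtain ⟨rfl, e⟩ := h.out_tr _ _ _ _ _ ht
    obtain ⟨t', ht', ha⟩ := h.complete (Tr.out x z P)
    refine ⟨_, _, .out x z P, rfl, answers_congr ha ?_ fun _ => rfl⟩
    rw [e, (h.out_tr _ _ _ _ _ ht').2]
  | inp x P =>
    obtain ⟨rfl, e⟩ := h.inp_tr _ _ _ _ ht
    exact ⟨_, _, .inp x P, rfl, e⟩
  | par P Q ihP ihQ =>
    rw [h.par] at ht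
    cases ht with
    | parL _ ht =>
      obtain ⟨α, s', hs, rfl, ha⟩ := ihP ht
      exact ⟨α, _, .parL _ hs, rfl, h.answers_par ha _⟩
    | parR _ ht =>
      obtain ⟨α, s', hs, rfl, ha⟩ := ihQ ht
      refine ⟨α, _, .parR _ hs, rfl, answers_congr (h.answers_par ha P) ?_ ?_⟩
      · simp [add_comm]
      · simp [DB.ren, h.par, add_comm]
    | comm ht₁ ht₂ hc =>
      obtain ⟨α₁, s₁, hs₁, rfl, ha₁⟩ := ihP ht₁
      obtain ⟨α₂, s₂, hs₂, rfl, ha₂⟩ := ihQ ht₂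
      obtain ⟨S, hS, ha⟩ := hcomm ha₁ ha₂ hc
      exact ⟨_, S, .comm hs₁ hs₂ hS, rfl, ha⟩
  | res P ih =>
    rw [h.res] at ht
    cases ht with
    | res ht =>
      obtain ⟨α, s', hs, e, ha⟩ := ih ht
      by_cases hα : ∃ γ : Act N, α = γ.ren sh
      · obtain ⟨γ, rfl⟩ := hα
        rw [← Act.ren_enc] at e
        obtain rfl := Act.ren_injective sh_injective e
        exact ⟨γ, _, .res hs, rfl, h.answers_res ha⟩
      · -- The only other source action with a visible translation outputs the restricted name.
        cases α with
        | tau => exact absurd ⟨.tau, rfl⟩ hα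
        | inp x =>
          obtain ⟨y, rfl, -⟩ := Act.of_ren_sh_eq_bnd e
          exact absurd ⟨.inp y, rfl⟩ hα
        | out x z =>
          obtain ⟨y, rfl, rfl⟩ := Act.of_ren_sh_eq_bnd e
          rcases zero_or_sh z with rfl | ⟨z, rfl⟩
          · exact ⟨_, _, .opn hs, rfl, by simpa using answers_opn ha⟩
          · exact absurd ⟨.out y z, rfl⟩ hα
        | bout x =>
          obtain ⟨y, rfl, -⟩ := Act.of_ren_sh_eq_bnd e
          exact absurd ⟨.bout y, rfl⟩ hα
    | opn ht =>
      obtain ⟨α, s', hs, e, ha⟩ := ih ht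
      exact absurd e.symm (Act.enc_ne_out _ _ _ _)
  | rep P ih =>
    rw [h.rep] at ht
    cases ht with
    | rep ht =>
      obtain ⟨α, s', hs, rfl, ha⟩ := ih ht
      have := h.answers_par ha (DB.rep P)
      rw [h.rep] at this
      exact ⟨α, _, .rep hs, rfl, this⟩
    | repComm ht₁ ht₂ hc =>
      obtain ⟨α₁, s₁, hs₁, rfl, ha₁⟩ := ih ht₁
      obtain ⟨α₂, s₂, hs₂, rfl, ha₂⟩ := ih ht₂
      obtain ⟨S, hS, ha⟩ := hcomm ha₁ ha₂ hc
      have := h.answers_par ha (DB.rep P)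
      rw [h.rep] at this
      exact ⟨_, _, .repComm hs₁ hs₂ hS, rfl, by simpa using this⟩

theorem sc_congr (h : Handshake b enc other) {P Q : DB N} (e : SC P Q) :
    SC (enc P) (enc Q) := by
  induction e with
  | refl => exact .refl _
  | symm _ ih => exact ih.symm
  | trans _ _ ih₁ ih₂ => exact ih₁.trans ih₂
  | out x z _ ih => exact h.out_congr _ _ _ _ ih
  | inp x _ ih => exact h.inp_congr _ _ _ ih
  | par _ _ ih₁ ih₂ => rw [h.par, h.par]; exact .par ih₁ ih₂
  | res _ ih => rw [h.res, h.res]; exact .res ih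
  | rep _ ih => rw [h.rep, h.rep]; exact .rep ih
  | par_assoc => simp only [h.par]; exact .par_assoc _ _ _
  | par_comm => simp only [h.par]; exact .par_comm _ _
  | par_nil => simp only [h.par, h.nil]; exact .par_nil _
  | rep_unfold => simp only [h.par, h.rep]; exact .rep_unfold _
  | res_nil => simp only [h.res, h.nil]; exact .res_nil
  | res_comm => simp only [h.res, h.ren]; exact .res_comm _
  | res_par => simp only [h.res, h.par, h.ren]; exact .res_par _ _

theorem reports_iff (h : Handshake b enc other) (s : DB N) : (enc s).Reports ↔ s.Reports := by
  induction s with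
  | nil => rw [h.nil]
  | tick => rw [h.tick]
  | out x z P => exact iff_of_false (h.out_not_reports x z P) id
  | inp x P => exact iff_of_false (h.inp_not_reports x P) id
  | par P Q ihP ihQ => rw [h.par]; exact or_congr ihP ihQ
  | res P ih => rw [h.res]; exact ih
  | rep P ih => rw [h.rep]; exact ih

end Handshake

end DB

/-! ### The two encodings on nameless processes -/

namespace DB

variable {N : Type u}

/-- Boudol's encoding. -/
def boudol : DB N → DB N
  | nil => nil
  | tick => tick
  | out x z P => res (par (out (sh x) zero nil)
      (inp zero (par (out zero (sh (sh z)) nil) (P.boudol.ren (sh ∘ sh)))))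
  | inp x P => inp x (res (par (out (sh zero) zero nil) (inp zero (P.boudol.ren (up (sh ∘ sh))))))
  | par P Q => par P.boudol Q.boudol
  | res P => res P.boudol
  | rep P => rep P.boudol

/-- Honda and Tokoro's encoding. -/
def hondaTokoro : DB N → DB N
  | nil => nil
  | tick => tick
  | out x z P => inp x (par (out zero (sh z) nil) (P.hondaTokoro.ren sh))
  | inp x P => res (par (out (sh x) zero nil) (inp zero (P.hondaTokoro.ren (up sh))))
  | par P Q => par P.hondaTokoro Q.hondaTokoro
  | res P => res P.hondaTokoro
  | rep P => rep P.hondaTokoro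

theorem boudol_ren (f : Ref N → Ref N) (P : DB N) : (P.ren f).boudol = P.boudol.ren f := by
  induction P generalizing f <;>
    simp_all [boudol, ren, up, Function.comp_assoc]

theorem hondaTokoro_ren (f : Ref N → Ref N) (P : DB N) :
    (P.ren f).hondaTokoro = P.hondaTokoro.ren f := by
  induction P generalizing f <;>
    simp_all [hondaTokoro, ren, up, Function.comp_assoc]

theorem handshake_hondaTokoro : Handshake (N := N) true hondaTokoro
    (fun z P => par (out zero (sh z) nil) (P.ren sh)) where
  nil := rfl
  tick := rfl
  par _ _ := rfl
  res _ := rfl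
  rep _ := rfl
  ren := hondaTokoro_ren
  other_ren f z P := by simp [ren, up]
  out_step x z P := ⟨_, .inp _ _⟩
  out_tr x z P α t h := by cases h; exact ⟨rfl, rfl⟩
  inp_step x P := ⟨_, .opn (.parL _ (.out _ _ _))⟩
  inp_tr x P α t h := by
    obtain ⟨rfl, e⟩ := tr_res_out_inp h
    refine ⟨rfl, fun f z Q => ?_⟩
    have := ((Inert.free z (P.hondaTokoro.ren (up f))).settles.par Q)
    refine this.cls_congr ?_ ?_
    · have e' : up (up f) ∘ up sh = (up sh ∘ up f : Ref N → Ref N) := by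
        rw [up_comp, up_comp]; congr 1; funext x; simp
      have e₁ := cls_ren_congr e (up f)
      simp only [ren, ren_ren, up_zero, e'] at e₁
      simp only [cls_res, cls_par, e₁, ren_ren]
      rw [add_right_comm, res_add_cls_sh]
    · have e' : inst z ∘ up f = scons z f := by simp [inst, up]
      simp [e', hondaTokoro_ren, add_comm]
  out_congr _ _ _ _ e := .inp _ (.par (.refl _) (e.ren _))
  inp_congr _ _ _ e := .res (.par (.refl _) (.inp _ (e.ren _)))
  out_not_reports _ _ _ h := h
  inp_not_reports _ _ h := by simp [hondaTokoro, Reports] at h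

theorem handshake_boudol : Handshake (N := N) false boudol
    (fun z P => inp zero (par (out zero (sh (sh z)) nil) (P.ren (sh ∘ sh)))) where
  nil := rfl
  tick := rfl
  par _ _ := rfl
  res _ := rfl
  rep _ := rfl
  ren := boudol_ren
  other_ren f z P := by simp [ren, up, Function.comp_assoc]
  out_step x z P := ⟨_, .opn (.parL _ (.out _ _ _))⟩
  out_tr x z P α t h := tr_res_out_inp h
  inp_step x P := ⟨_, .inp _ _⟩
  inp_tr x P α t h := by
    cases h
    refine ⟨rfl, fun f z Q => ?_⟩
    -- The first inert step transmits the second private name, and the second step the datum `z`.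
    have h₁ := (Inert.bound (DB.par (out zero (sh z) nil) (Q.ren sh))
      (P.boudol.ren (up f))).settles
    have h₂ := ((Inert.free z (P.boudol.ren (up f))).settles.par Q)
    refine (h₁.trans (h₂.cls_congr ?_ rfl)).cls_congr ?_ ?_
    · simp only [cls_res, cls_par]
      rw [add_right_comm, res_add_cls_sh]
    · simp [ren, up, Function.comp_assoc]
    · have e' : inst z ∘ up f = scons z f := by simp [inst, up]
      simp [e', boudol_ren, add_comm]
  out_congr _ _ _ _ e := .res (.par (.refl _) (.inp _ (.par (.refl _) (e.ren _))))
  inp_congr _ _ _ e := .inp _ (.res (.par (.refl _) (.inp _ (e.ren _))))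
  out_not_reports _ _ _ h := by simp [boudol, Reports] at h
  inp_not_reports _ _ h := h

/-! ### Reductions of nameless processes -/

/-- Reduction, closed under structural congruence. -/
def Red (P Q : DB N) : Prop := ∃ Q', Tr P .tau Q' ∧ SC Q' Q

theorem Red.struct {P P' Q Q' : DB N} (e : SC P P') (h : Red P' Q') (e' : SC Q' Q) :
    Red P Q := by
  obtain ⟨R, t, e₁⟩ := h
  obtain ⟨R', t', e₂⟩ := e.symm.tr t
  exact ⟨R', t', e₂.symm.trans (e₁.trans e')⟩

theorem Red.ren {P Q : DB N} (h : Red P Q) (f) : Red (P.ren f) (Q.ren f) := by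
  obtain ⟨R, t, e⟩ := h
  exact ⟨_, t.ren f, e.ren f⟩

theorem InertSeq.reds {n} {P Q : DB N} (h : InertSeq n P Q) :
    ∃ Q', Relation.ReflTransGen Red P Q' ∧ SC Q' Q := by
  induction h with
  | zero e => exact ⟨_, .refl, e⟩
  | succ i _ ih =>
    obtain ⟨Q', r, e⟩ := ih
    exact ⟨Q', .head i.tr r, e⟩

namespace Handshake

variable {b : Bool} {enc : DB N → DB N} {other : Ref N → DB N → DB N}

/-- A process with pending inert reductions to the encoding of `s` follows the reductions
of `s`. -/
theorem red_forward (h : Handshake b enc other) {n} {s s' t : DB N}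
    (ht : InertSeq n t (enc s)) (hs : Red s s') :
    ∃ m t' t'', Relation.ReflTransGen Red t t' ∧ Red t' t'' ∧ InertSeq m t'' (enc s') := by
  obtain ⟨s₁, hs₁, e⟩ := hs
  obtain ⟨t', ht', e'⟩ := ht.reds
  obtain ⟨t₁, ht₁, m, hm⟩ := h.complete hs₁
  exact ⟨m, t', t₁, ht', .struct e' ⟨t₁, ht₁, .refl _⟩ (.refl _),
    hm.struct_right (h.sc_congr e)⟩

/-- A reduction of a process with pending inert reductions to the encoding of `s` either brings it
closer to that encoding, or corresponds to a reduction of `s`. -/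
theorem red_backward (h : Handshake b enc other) {n} {s t t' : DB N}
    (ht : InertSeq n t (enc s)) (hs : Red t t') :
    (∃ m < n, InertSeq m t' (enc s)) ∨ ∃ m s', Red s s' ∧ InertSeq m t' (enc s') := by
  obtain ⟨t₁, ht₁, e⟩ := hs
  rcases ht.diamond ht₁ with ⟨m, hm, h'⟩ | ⟨Q, hQ, h'⟩
  · exact .inl ⟨m, hm, h'.struct_left e.symm⟩
  · obtain ⟨α, s', hs', hα, ha⟩ := h.sound hQ
    right
    cases α with
    | tau =>
      obtain ⟨k, hk⟩ := ha
      exact ⟨_, s', ⟨s', hs', .refl _⟩, (h'.trans hk).struct_left e.symm⟩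
    | inp => cases b <;> cases hα
    | out => cases b <;> cases hα
    | bout => cases b <;> cases hα

end Handshake

end DB

/-! ### From named to nameless processes -/

namespace Pi

variable {N : Type u} [DecidableEq N]

/-- The environment inside the scope of a binder of `y`. -/
def bind (y : N) (ρ : N → Ref N) : N → Ref N := Function.update (sh ∘ ρ) y zero

@[simp] theorem bind_self (y : N) (ρ : N → Ref N) : bind y ρ y = zero := by simp [bind]

theorem bind_of_ne {y a : N} (h : a ≠ y) (ρ : N → Ref N) : bind y ρ a = sh (ρ a) := by
  simp [bind, h]

/-- The nameless form of a process; the environment `ρ` interprets its free names. -/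
def toDB (ρ : N → Ref N) : Pi N → DB N
  | nil => .nil
  | tick => .tick
  | out x z P => .out (ρ x) (ρ z) (P.toDB ρ)
  | inp x y P => .inp (ρ x) (P.toDB (bind y ρ))
  | par P Q => .par (P.toDB ρ) (Q.toDB ρ)
  | res y P => .res (P.toDB (bind y ρ))
  | rep P => .rep (P.toDB ρ)

theorem bind_congr {y : N} {s : Set N} {ρ ρ' : N → Ref N} (h : ∀ a ∈ s \ {y}, ρ a = ρ' a) :
    ∀ a ∈ s, bind y ρ a = bind y ρ' a := by
  intro a ha
  by_cases hy : a = y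
  · simp [hy]
  · rw [bind_of_ne hy, bind_of_ne hy, h a ⟨ha, hy⟩]

theorem toDB_congr {P : Pi N} {ρ ρ' : N → Ref N} (h : ∀ a ∈ P.fn, ρ a = ρ' a) :
    P.toDB ρ = P.toDB ρ' := by
  induction P generalizing ρ ρ' with
  | nil => rfl
  | tick => rfl
  | out x z P ih =>
    simp only [toDB, h x (by simp [fn]), h z (by simp [fn]), ih fun a ha => h a (by simp [fn, ha])]
  | inp x y P ih =>
    simp only [toDB, h x (by simp [fn]), ih (bind_congr fun a ha => h a (by
      simp only [fn]; exact .inr ha))]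
  | par P Q ihP ihQ =>
    simp only [toDB, ihP fun a ha => h a (.inl ha), ihQ fun a ha => h a (.inr ha)]
  | res y P ih => simp only [toDB, ih (bind_congr h)]
  | rep P ih => simp only [toDB, ih h]

theorem comp_bind (f : Ref N → Ref N) (y : N) (ρ : N → Ref N) :
    up f ∘ bind y ρ = bind y (f ∘ ρ) := by
  funext a
  by_cases h : a = y
  · simp [h]
  · simp [bind_of_ne h]

theorem ren_toDB (f : Ref N → Ref N) (ρ : N → Ref N) (P : Pi N) :
    (P.toDB ρ).ren f = P.toDB (f ∘ ρ) := by
  induction P generalizing f ρ <;> simp_all [toDB, DB.ren, comp_bind]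

theorem reports_toDB (ρ : N → Ref N) (P : Pi N) : (P.toDB ρ).Reports ↔ P.Reports := by
  induction P generalizing ρ <;> simp_all [toDB, DB.Reports, Reports]

theorem fn_subset_names {N : Type u} (P : Pi N) : P.fn ⊆ P.names := by
  induction P with
  | nil => exact subset_rfl
  | tick => exact subset_rfl
  | out x z P ih => exact Set.union_subset_union_right _ ih
  | inp x y P ih =>
    rintro a (rfl | ha)
    · simp [names]
    · exact .inr (ih ha.1)
  | par P Q ihP ihQ => exact Set.union_subset_union ihP ihQ
  | res y P ih => exact fun a ha => .inr (ih ha.1)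
  | rep P ih => exact ih

theorem names_finite {N : Type u} (P : Pi N) : P.names.Finite := by
  induction P <;> simp_all [names]

theorem noCapture_of_notMem {N : Type u} {w : N} {P : Pi N} (y : N) (h : w ∉ P.names) :
    P.NoCapture w y := by
  induction P with
  | nil => trivial
  | tick => trivial
  | out x z P ih => exact ih fun hw => h (.inr hw)
  | inp x b P ih =>
    refine .inr ⟨ih fun hw => h (.inr hw), ?_⟩
    rintro rfl
    exact absurd (by simp [names]) h
  | par P Q ihP ihQ => exact ⟨ihP fun hw => h (.inl hw), ihQ fun hw => h (.inr hw)⟩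
  | res b P ih =>
    refine .inr ⟨ih fun hw => h (.inr hw), ?_⟩
    rintro rfl
    exact absurd (by simp [names]) h
  | rep P ih => exact ih h

theorem apply_replace (ρ : N → Ref N) (w y x : N) :
    ρ (if x = y then w else x) = Function.update ρ y (ρ w) x := by
  by_cases h : x = y <;> simp [h]

/-- Where nothing is captured, literal replacement is a change of the environment. -/
theorem toDB_replace {w y : N} {P : Pi N} (h : P.NoCapture w y) (ρ : N → Ref N) :
    (P.replace w y).toDB ρ = P.toDB (Function.update ρ y (ρ w)) := by
  have binder : ∀ (ρ : N → Ref N) {b : N} {P : Pi N}, (b = w → y ∉ P.fn) → b ≠ y → ∀ a ∈ P.fn,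
      Function.update (bind b ρ) y (bind b ρ w) a =
        bind b (Function.update ρ y (ρ w)) a := by
    intro ρ b P hb hby a ha
    by_cases hay : a = y
    · subst hay
      have hwb : w ≠ b := fun h => hb h.symm ha
      simp [bind_of_ne hby.symm, bind_of_ne hwb]
    · by_cases hab : a = b
      · subst hab; simp [hay]
      · simp [hay, bind_of_ne hab]
  have shadow : ∀ (ρ : N → Ref N) b, b = y → bind b (Function.update ρ y (ρ w)) = bind b ρ := by
    rintro ρ b rfl
    funext a
    by_cases h : a = b
    · simp [h]
    · simp [bind_of_ne h, h]
  induction P generalizing ρ with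
  | nil => rfl
  | tick => rfl
  | out x z P ih => simp only [replace, toDB, apply_replace, ih h]
  | inp x b P ih =>
    simp only [replace, toDB, apply_replace]
    split_ifs with hb
    · rw [shadow _ b hb]
    · obtain ⟨h₁, h₂⟩ := h.resolve_left hb
      rw [ih h₁, toDB_congr (binder _ h₂ hb)]
  | par P Q ihP ihQ => simp only [replace, toDB, ihP h.1, ihQ h.2]
  | res b P ih =>
    simp only [replace, toDB]
    split_ifs with hb
    · rw [shadow _ b hb]
    · obtain ⟨h₁, h₂⟩ := h.resolve_left hb
      rw [ih h₁, toDB_congr (binder _ h₂ hb)]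
  | rep P ih => simp only [replace, toDB, ih h]

theorem toDB_alphaAx {P Q : Pi N} (h : AlphaAx P Q) (ρ : N → Ref N) :
    P.toDB ρ = Q.toDB ρ := by
  have key : ∀ {y w : N} {P : Pi N}, w ∉ P.names →
      P.toDB (bind y ρ) = (P.replace w y).toDB (bind w ρ) := by
    intro y w P hw
    rw [toDB_replace (noCapture_of_notMem y hw), bind_self]
    refine toDB_congr fun a ha => ?_
    have haw : a ≠ w := by rintro rfl; exact hw (P.fn_subset_names ha)
    by_cases hay : a = y
    · simp [hay]
    · simp [hay, bind_of_ne hay, bind_of_ne haw]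
  cases h with
  | res hw => simp only [toDB, key hw]
  | inp hw => simp only [toDB, key hw]

/-- α-equivalent processes have the same nameless form. -/
theorem toDB_alphaEq {P Q : Pi N} (h : AlphaEq P Q) (ρ : N → Ref N) : P.toDB ρ = Q.toDB ρ := by
  induction h generalizing ρ with
  | ax h => exact toDB_alphaAx h ρ
  | _ => simp_all [toDB]

theorem toDB_isSubst {z y : N} {P R : Pi N} (h : IsSubst z y P R) (ρ : N → Ref N) :
    R.toDB ρ = P.toDB (Function.update ρ y (ρ z)) := by
  obtain ⟨P', hα, hc, rfl⟩ := h
  rw [toDB_replace hc, toDB_alphaEq hα]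

theorem toDB_structAx {P Q : Pi N} (h : StructAx P Q) (ρ : N → Ref N) :
    DB.SC (P.toDB ρ) (Q.toDB ρ) := by
  cases h with
  | par_assoc => exact .par_assoc _ _ _
  | par_comm => exact .par_comm _ _
  | par_nil => exact .par_nil _
  | rep => exact .rep_unfold _
  | res_nil => exact .res_nil
  | res_comm y u P =>
    by_cases hyu : y = u
    · subst hyu; exact .refl _
    · have e : bind y (bind u ρ) = swap ∘ bind u (bind y ρ) := by
        funext a
        by_cases hay : a = y
        · subst hay; simp [bind_of_ne hyu]
        · by_cases hau : a = u
          · subst hau; simp [bind_of_ne hay]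
          · simp [bind_of_ne hay, bind_of_ne hau]
      have := DB.SC.res_comm (P.toDB (bind u (bind y ρ)))
      rwa [ren_toDB, ← e] at this
  | @res_par w P Q hw =>
    have e : P.toDB (bind w ρ) = (P.toDB ρ).ren sh := by
      rw [ren_toDB]
      exact toDB_congr fun a ha => bind_of_ne (by rintro rfl; exact hw (P.fn_subset_names ha)) _
    simp only [toDB, e]
    exact .res_par _ _
  | alpha h => rw [toDB_alphaAx h]; exact .refl _

theorem toDB_structEq {P Q : Pi N} (h : StructEq P Q) (ρ : N → Ref N) :
    DB.SC (P.toDB ρ) (Q.toDB ρ) := by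
  induction h generalizing ρ with
  | ax h => exact toDB_structAx h ρ
  | refl => exact .refl _
  | symm _ ih => exact (ih ρ).symm
  | trans _ _ ih₁ ih₂ => exact (ih₁ ρ).trans (ih₂ ρ)
  | out x z _ ih => exact .out _ _ (ih ρ)
  | inp x y _ ih => exact .inp _ (ih _)
  | par _ _ ih₁ ih₂ => exact .par (ih₁ ρ) (ih₂ ρ)
  | res y _ ih => exact .res (ih _)
  | rep _ ih => exact .rep (ih ρ)

/-- Reductions of named processes are reductions of their nameless forms. -/
theorem toDB_red {P Q : Pi N} (h : Red P Q) (ρ : N → Ref N) : DB.Red (P.toDB ρ) (Q.toDB ρ) := by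
  induction h generalizing ρ with
  | @comm x y z P Q R hs =>
    refine ⟨_, .comm (.out _ _ _) (.inp _ _) (.outInp _ _ _ _), ?_⟩
    have e : Function.update ρ y (ρ z) = inst (ρ z) ∘ bind y ρ := by
      funext a
      by_cases h : a = y
      · simp [h]
      · simp [h, bind_of_ne h]
    simp only [toDB]
    rw [toDB_isSubst hs, ren_toDB, e]
    exact .refl _
  | par Q _ ih =>
    obtain ⟨R, t, e⟩ := ih ρ
    exact ⟨_, .parL _ t, by simpa using .par e (.refl _)⟩
  | res y _ ih =>
    obtain ⟨R, t, e⟩ := ih (bind y ρ)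
    exact ⟨_, .res (α := .tau) t, by simpa using .res e⟩
  | struct e _ e' ih => exact .struct (toDB_structEq e ρ) (ih ρ) (toDB_structEq e' ρ)

end Pi

/-! ### α-conversion and nameless forms -/

namespace Pi

variable {N : Type u} [DecidableEq N]

/-- The height of a process. It is invariant under renaming and so serves as the measure of
recursions that choose new bound names. -/
def height {N : Type u} : Pi N → ℕ
  | nil => 0
  | tick => 0
  | out _ _ P => P.height + 1
  | inp _ _ P => P.height + 1
  | par P Q => max P.height Q.height + 1
  | res _ P => P.height + 1
  | rep P => P.height + 1

@[simp] theorem height_replace (w y : N) (P : Pi N) : (P.replace w y).height = P.height := by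
  induction P <;> simp_all [height, replace] <;> split_ifs <;> simp_all

theorem exists_notMem_names {N : Type u} [Infinite N] (P Q : Pi N) (s : Set N) (hs : s.Finite) :
    ∃ w, w ∉ P.names ∧ w ∉ Q.names ∧ w ∉ s := by
  obtain ⟨w, hw⟩ := ((P.names_finite.union Q.names_finite).union hs).exists_notMem
  exact ⟨w, fun h => hw (.inl (.inl h)), fun h => hw (.inl (.inr h)), fun h => hw (.inr h)⟩

theorem toDB_replace_free {w y : N} {P : Pi N} (h : w ∉ P.names) :
    (P.replace w y).toDB free = (P.toDB (bind y free)).ren (inst (free w)) := by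
  rw [toDB_replace (noCapture_of_notMem y h), ren_toDB]
  congr 1
  funext a
  by_cases hay : a = y
  · simp [hay]
  · simp [hay, bind_of_ne hay]

/-- Processes with the same nameless form are α-equivalent. -/
theorem alphaEq_of_toDB_eq [Infinite N] {P Q : Pi N} (h : P.toDB free = Q.toDB free) :
    AlphaEq P Q := by
  induction hn : P.height using Nat.strong_induction_on generalizing P Q with
  | _ n ih =>
    subst hn
    have under : ∀ {y y' : N} {P' Q' : Pi N}, P'.height < P.height →
        P'.toDB (bind y free) = Q'.toDB (bind y' free) →
        ∃ w, w ∉ P'.names ∧ w ∉ Q'.names ∧ AlphaEq (P'.replace w y) (Q'.replace w y') := by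
      intro y y' P' Q' hlt h
      obtain ⟨w, hP, hQ, -⟩ := exists_notMem_names P' Q' ∅ Set.finite_empty
      refine ⟨w, hP, hQ, ih _ (by rwa [← height_replace w y] at hlt) ?_ rfl⟩
      rw [toDB_replace_free hP, toDB_replace_free hQ, h]
    cases P <;> cases Q <;> simp only [toDB, reduceCtorEq] at h
    case nil.nil => exact .refl _
    case tick.tick => exact .refl _
    case out.out x z P x' z' Q =>
      injection h with hx hz h
      injection hx with hx
      injection hz with hz
      subst hx hz
      exact .out _ _ (ih _ (by simp [height]) h rfl)
    case inp.inp x y P x' y' Q =>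
      injection h with hx h
      injection hx with hx
      subst hx
      obtain ⟨w, hP, hQ, hw⟩ := under (by simp [height]) h
      exact (Cong.ax (.inp hP)).trans ((Cong.inp x w hw).trans (Cong.ax (.inp hQ)).symm)
    case par.par P₁ P₂ Q₁ Q₂ =>
      injection h with h₁ h₂
      exact .par (ih _ (by simp [height]) h₁ rfl) (ih _ (by simp [height]) h₂ rfl)
    case res.res y P y' Q =>
      injection h with h
      obtain ⟨w, hP, hQ, hw⟩ := under (by simp [height]) h
      exact (Cong.ax (.res hP)).trans ((Cong.res w hw).trans (Cong.ax (.res hQ)).symm)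
    case rep.rep P Q =>
      injection h with h
      exact .rep (ih _ (by simp [height]) h rfl)

theorem AlphaEq.structEq {P Q : Pi N} (h : AlphaEq P Q) : StructEq P Q := by
  induction h with
  | ax h => exact .ax (.alpha h)
  | refl => exact .refl _
  | symm _ ih => exact .symm ih
  | trans _ _ ih₁ ih₂ => exact .trans ih₁ ih₂
  | out x z _ ih => exact .out x z ih
  | inp x y _ ih => exact .inp x y ih
  | par _ _ ih₁ ih₂ => exact .par ih₁ ih₂
  | res y _ ih => exact .res y ih
  | rep _ ih => exact .rep ih

/-- Bound names can be chosen such that replacing `y` by `z` captures nothing. -/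
theorem exists_alphaEq_noCapture [Infinite N] (z y : N) (P : Pi N) :
    ∃ P', AlphaEq P P' ∧ P'.NoCapture z y := by
  induction hn : P.height using Nat.strong_induction_on generalizing P with
  | _ n ih =>
    subst hn
    have under : ∀ (b : N) {Q : Pi N}, Q.height < P.height → ∃ w Q', w ≠ z ∧ w ∉ Q.names ∧
        AlphaEq (Q.replace w b) Q' ∧ Q'.NoCapture z y := by
      intro b Q hlt
      obtain ⟨w, hw, -, hz⟩ := exists_notMem_names Q Q {z} (Set.finite_singleton z)
      obtain ⟨Q', h, hQ'⟩ := ih _ (by rwa [← height_replace w b] at hlt) (Q.replace w b) rfl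
      exact ⟨w, Q', hz, hw, h, hQ'⟩
    cases P with
    | nil => exact ⟨_, .refl _, trivial⟩
    | tick => exact ⟨_, .refl _, trivial⟩
    | out x z P =>
      obtain ⟨P', h, h'⟩ := ih _ (by simp [height]) P rfl
      exact ⟨_, .out _ _ h, h'⟩
    | inp x b P =>
      obtain ⟨w, P', hwz, hw, h, h'⟩ := under b (Q := P) (by simp [height])
      exact ⟨_, (Cong.ax (.inp hw)).trans (Cong.inp x w h), .inr ⟨h', fun e => absurd e hwz⟩⟩
    | par P Q =>
      obtain ⟨P', h, h'⟩ := ih _ (by simp [height]) P rfl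
      obtain ⟨Q', k, k'⟩ := ih _ (by simp [height]) Q rfl
      exact ⟨_, .par h k, h', k'⟩
    | res b P =>
      obtain ⟨w, P', hwz, hw, h, h'⟩ := under b (Q := P) (by simp [height])
      exact ⟨_, (Cong.ax (.res hw)).trans (Cong.res w h), .inr ⟨h', fun e => absurd e hwz⟩⟩
    | rep P =>
      obtain ⟨P', h, h'⟩ := ih _ (by simp [height]) P rfl
      exact ⟨_, .rep h, h'⟩

end Pi

/-! ### From nameless to named processes -/

namespace DB

variable {N : Type u}

/-- The free references of a process. -/
def refs : DB N → Set (Ref N)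
  | nil => ∅
  | tick => ∅
  | out x z P => {x, z} ∪ P.refs
  | inp x P => {x} ∪ sh ⁻¹' P.refs
  | par P Q => P.refs ∪ Q.refs
  | res P => sh ⁻¹' P.refs
  | rep P => P.refs

theorem refs_finite (P : DB N) : P.refs.Finite := by
  induction P <;> simp_all [refs, Set.Finite.preimage sh_injective.injOn]

theorem ren_congr {P : DB N} {f g : Ref N → Ref N} (h : ∀ x ∈ P.refs, f x = g x) :
    P.ren f = P.ren g := by
  have binder : ∀ {P : DB N} {f g : Ref N → Ref N}, (∀ x, sh x ∈ P.refs → f x = g x) →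
      ∀ x ∈ P.refs, up f x = up g x := by
    intro P f g h x hx
    rcases zero_or_sh x with rfl | ⟨x, rfl⟩
    · rfl
    · simp [h x hx]
  induction P generalizing f g with
  | nil => rfl
  | tick => rfl
  | out x z P ih =>
    simp only [ren, h x (by simp [refs]), h z (by simp [refs]), ih fun a ha => h a (.inr ha)]
  | inp x P ih => simp only [ren, h x (by simp [refs]), ih (binder fun a ha => h a (.inr ha))]
  | par P Q ihP ihQ =>
    simp only [ren, ihP fun a ha => h a (.inl ha), ihQ fun a ha => h a (.inr ha)]
  | res P ih => simp only [ren, ih (binder h)]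
  | rep P ih => simp only [ren, ih h]

/-- The name `w` may be chosen for the binder of `P` if `σ` interprets the free references. -/
def Fresh (σ : Ref N → N) (P : DB N) (w : N) : Prop := ∀ x, sh x ∈ P.refs → σ x ≠ w

theorem fresh_cofinite (σ : Ref N → N) (P : DB N) : {w | ¬ P.Fresh σ w}.Finite := by
  refine ((P.refs_finite.preimage sh_injective.injOn).image σ).subset ?_
  intro w hw
  simp only [Fresh, Set.mem_ofPred_eq, not_forall, not_not] at hw
  obtain ⟨x, hx, rfl⟩ := hw
  exact ⟨x, hx, rfl⟩

variable [Infinite N]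

theorem exists_fresh (σ : Ref N → N) (P Q : DB N) (s : Set N) (hs : s.Finite) :
    ∃ w, P.Fresh σ w ∧ Q.Fresh σ w ∧ w ∉ s := by
  obtain ⟨w, hw⟩ := (((P.fresh_cofinite σ).union (Q.fresh_cofinite σ)).union hs).exists_notMem
  simp only [Set.mem_union, Set.mem_ofPred_eq, not_or, not_not] at hw
  exact ⟨w, hw.1.1, hw.1.2, hw.2⟩

open Classical in
/-- A name for the binder of `P`. -/
noncomputable def freshName {N : Type u} (σ : Ref N → N) (P : DB N) : N :=
  if h : ∃ w, P.Fresh σ w then h.choose else σ zero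

theorem fresh_freshName (σ : Ref N → N) (P : DB N) : P.Fresh σ (P.freshName σ) := by
  have h : ∃ w, P.Fresh σ w := by
    obtain ⟨w, h, -⟩ := exists_fresh σ P P ∅ Set.finite_empty
    exact ⟨w, h⟩
  rw [freshName, dif_pos h]
  exact h.choose_spec

/-- A named process with nameless form `P`, where `σ` chooses names for the free references. -/
noncomputable def toPi {N : Type u} (σ : Ref N → N) : DB N → Pi N
  | nil => .nil
  | tick => .tick
  | out x z P => .out (σ x) (σ z) (P.toPi σ)
  | inp x P => .inp (σ x) (P.freshName σ) (P.toPi (scons (P.freshName σ) σ))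
  | par P Q => .par (P.toPi σ) (Q.toPi σ)
  | res P => .res (P.freshName σ) (P.toPi (scons (P.freshName σ) σ))
  | rep P => .rep (P.toPi σ)

variable [DecidableEq N]

theorem Fresh.bind_scons {N : Type u} [DecidableEq N] {σ : Ref N → N} {P : DB N} {w : N}
    (h : P.Fresh σ w) (ρ : N → Ref N) : ∀ x ∈ P.refs, (Pi.bind w ρ ∘ scons w σ) x = up (ρ ∘ σ) x := by
  intro x hx
  rcases zero_or_sh x with rfl | ⟨x, rfl⟩
  · simp
  · simp [Pi.bind_of_ne (h x hx)]

theorem toDB_toPi (ρ : N → Ref N) (σ : Ref N → N) (P : DB N) :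
    (P.toPi σ).toDB ρ = P.ren (ρ ∘ σ) := by
  induction P generalizing ρ σ with
  | nil => rfl
  | tick => rfl
  | out x z P ih => simp [toPi, Pi.toDB, ren, ih]
  | inp x P ih =>
    simp [toPi, Pi.toDB, ren, ih, -comp_scons, ren_congr ((P.fresh_freshName σ).bind_scons ρ)]
  | par P Q ihP ihQ => simp [toPi, Pi.toDB, ren, ihP, ihQ]
  | res P ih =>
    simp [toPi, Pi.toDB, ren, ih, -comp_scons, ren_congr ((P.fresh_freshName σ).bind_scons ρ)]
  | rep P ih => simp [toPi, Pi.toDB, ren, ih]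

theorem structEq_toPi {σ : Ref N → N} {P : DB N} {Q : Pi N}
    (h : Q.toDB free = P.ren (free ∘ σ)) : Pi.StructEq Q (P.toPi σ) :=
  (Pi.alphaEq_of_toDB_eq (h.trans (toDB_toPi _ _ _).symm)).structEq

theorem res_structEq_toPi {σ : Ref N → N} {P : DB N} {w : N} (h : P.Fresh σ w) :
    Pi.StructEq (.res w (P.toPi (scons w σ))) ((res P).toPi σ) := by
  apply structEq_toPi
  rw [Pi.toDB, toDB_toPi, ren, ren_congr (h.bind_scons free)]

theorem inp_structEq_toPi {σ : Ref N → N} {P : DB N} {w : N} (x) (h : P.Fresh σ w) :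
    Pi.StructEq (.inp (σ x) w (P.toPi (scons w σ))) ((inp x P).toPi σ) := by
  apply structEq_toPi
  rw [Pi.toDB, toDB_toPi, ren, ren_congr (h.bind_scons free)]
  rfl

/-- Structural congruence of nameless processes is reflected by the named ones. -/
theorem SC.structEq {P Q : DB N} (h : SC P Q) (σ : Ref N → N) :
    Pi.StructEq (P.toPi σ) (Q.toPi σ) := by
  induction h generalizing σ with
  | refl => exact .refl _
  | symm _ ih => exact (ih σ).symm
  | trans _ _ ih₁ ih₂ => exact (ih₁ σ).trans (ih₂ σ)
  | out x z _ ih => exact .out _ _ (ih σ)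
  | @inp x P Q _ ih =>
    obtain ⟨w, hP, hQ, -⟩ := exists_fresh σ P Q ∅ Set.finite_empty
    exact (inp_structEq_toPi x hP).symm.trans ((Pi.Cong.inp _ w (ih _)).trans
      (inp_structEq_toPi x hQ))
  | par _ _ ih₁ ih₂ => exact .par (ih₁ σ) (ih₂ σ)
  | @res P Q _ ih =>
    obtain ⟨w, hP, hQ, -⟩ := exists_fresh σ P Q ∅ Set.finite_empty
    exact (res_structEq_toPi hP).symm.trans ((Pi.Cong.res w (ih _)).trans
      (res_structEq_toPi hQ))
  | rep _ ih => exact .rep (ih σ)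
  | par_assoc => exact .ax (.par_assoc _ _ _)
  | par_comm => exact .ax (.par_comm _ _)
  | par_nil => exact .ax (.par_nil _)
  | rep_unfold => exact .ax (.rep _)
  | res_nil => exact .ax (.res_nil _)
  | res_comm P =>
    obtain ⟨v, hv, -⟩ := exists_fresh σ P.res P.res ∅ Set.finite_empty
    obtain ⟨w, hw, -, hwv⟩ := exists_fresh (scons v σ) P P {v} (Set.finite_singleton v)
    have hwv : w ≠ v := hwv
    have h₁ := (Pi.Cong.res v (res_structEq_toPi hw)).trans (res_structEq_toPi hv)
    refine h₁.symm.trans ((Pi.Cong.ax (.res_comm _ _ _)).trans (structEq_toPi ?_))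
    simp only [Pi.toDB, toDB_toPi, DB.ren, ren_ren]
    refine congrArg (fun P : DB N => P.res.res) (ren_congr fun x hx => ?_)
    rcases zero_or_sh x with rfl | ⟨x, rfl⟩
    · simp [Pi.bind_of_ne hwv]
    · rcases zero_or_sh x with rfl | ⟨x, rfl⟩
      · simp
      · have h1 : σ x ≠ v := hv x hx
        have h2 : σ x ≠ w := by simpa using hw (sh x) hx
        simp [Pi.bind_of_ne h1, Pi.bind_of_ne h2]
  | res_par P Q =>
    obtain ⟨w, hQ, -, hw⟩ := exists_fresh σ Q Q _ (Pi.names_finite (P.toPi σ))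
    refine .trans (structEq_toPi ?_).symm ((Pi.Cong.ax (.res_par (Q.toPi (scons w σ)) hw)).trans
      (.par (.refl _) (res_structEq_toPi hQ)))
    simp only [Pi.toDB, toDB_toPi, DB.ren, ren_congr (hQ.bind_scons free)]
    have e : (P.toPi σ).toDB (Pi.bind w free) = (P.toPi σ).toDB (sh ∘ free) :=
      Pi.toDB_congr fun a ha => Pi.bind_of_ne
        (by rintro rfl; exact hw (Pi.fn_subset_names _ ha)) _
    rw [toDB_toPi, toDB_toPi] at e
    rw [e]
    simp [up, Function.comp_assoc]

end DB

/-! ### Reductions of named processes from transitions of nameless ones -/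

namespace DB

variable {N : Type u} [DecidableEq N]

/-- The named counterparts of `P` reduce to those of `Q`, for every choice of free names. -/
def NamedRed (P Q : DB N) : Prop := ∀ σ, Pi.Red (P.toPi σ) (Q.toPi σ)

variable [Infinite N]

theorem NamedRed.struct {P P' Q Q' : DB N} (e : SC P P') (h : NamedRed P' Q') (e' : SC Q' Q) :
    NamedRed P Q := fun σ => .struct (e.structEq σ) (h σ) (e'.structEq σ)

theorem NamedRed.cls_congr {P P' Q Q' : DB N} (h : NamedRed P' Q') (e : cls P = cls P')
    (e' : cls Q' = cls Q) : NamedRed P Q := h.struct (cls_eq.1 e) (cls_eq.1 e')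

theorem NamedRed.par {N : Type u} [DecidableEq N] {P Q : DB N} (h : NamedRed P Q) (R) :
    NamedRed (par P R) (par Q R) :=
  fun σ => .par _ (h σ)

theorem NamedRed.res {P Q : DB N} (h : NamedRed P Q) : NamedRed (res P) (res Q) := by
  intro σ
  obtain ⟨w, hP, hQ, -⟩ := exists_fresh σ P Q ∅ Set.finite_empty
  exact .struct (res_structEq_toPi hP).symm (.res w (h _)) (res_structEq_toPi hQ)

theorem NamedRed.comm (x z : Ref N) (P Q : DB N) :
    NamedRed (DB.par (out x z P) (inp x Q)) (DB.par P (Q.ren (inst z))) := by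
  intro σ
  set w := Q.freshName σ with hw
  obtain ⟨Q', hα, hc⟩ := Pi.exists_alphaEq_noCapture (σ z) w (Q.toPi (scons w σ))
  refine .struct (.refl _) (.comm ⟨Q', hα, hc, rfl⟩) (.par (.refl _) (structEq_toPi ?_))
  rw [Pi.toDB_replace hc, ← Pi.toDB_alphaEq hα, toDB_toPi, ren_ren]
  refine ren_congr fun x hx => ?_
  rcases zero_or_sh x with rfl | ⟨x, rfl⟩
  · simp
  · have := Q.fresh_freshName σ x hx
    simp [hw, this]

/-- An output transition gives rise to a communication with a matching input prefix. -/
theorem Tr.namedRed_inp {P P' : DB N} {α} (t : Tr P α P') {x R S}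
    (hc : Comb α (.inp x) P' R S) : NamedRed (DB.par P (DB.inp x R)) S := by
  induction t generalizing x R S with
  | out x z P => cases hc; exact .comm _ _ _ _
  | inp => cases hc
  | parL Q _ ih =>
    obtain ⟨S', hc', e⟩ := hc.par_left
    refine ((ih hc').par Q).cls_congr ?_ (cls_eq.2 e.symm)
    simp [add_right_comm]
  | parR Q _ ih =>
    obtain ⟨S₁, hc₁, e₁⟩ := hc.congr (.par_comm _ _) (.refl _)
    obtain ⟨S', hc', e⟩ := hc₁.par_left
    refine ((ih hc').par Q).cls_congr ?_ (cls_eq.2 (e₁.trans e).symm)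
    simp only [cls_par]; abel
  | comm => cases hc
  | res _ ih =>
    obtain ⟨S', hc', e⟩ := hc.res_left
    refine (ih hc').res.cls_congr ?_ (cls_eq.2 e.symm)
    simp only [cls_par, cls_res]
    exact (res_add_cls_sh _ (DB.inp x R)).symm
  | opn _ ih =>
    cases hc
    refine (ih (.outInp _ _ _ (R.ren (Ref.up sh)))).res.cls_congr ?_ ?_
    · simp only [cls_par, cls_res]
      exact (res_add_cls_sh _ (DB.inp _ R)).symm
    · have : inst zero ∘ up sh = (id : Ref N → Ref N) := by simp [inst, up]
      simp [this]
  | @rep P _ _ _ ih =>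
    obtain ⟨S', hc', e⟩ := hc.par_left
    refine ((ih hc').par (DB.rep P)).cls_congr ?_ (cls_eq.2 e.symm)
    rw [cls_par, cls_rep]
    simp [add_right_comm]
  | repComm => cases hc

/-- An output and an input transition give rise to a communication. -/
theorem Tr.namedRed_par {P P' Q Q' S : DB N} {α x} (t : Tr P α P') (t' : Tr Q (.inp x) Q')
    (hc : Comb α (.inp x) P' Q' S) : NamedRed (DB.par P Q) S := by
  generalize hβ : Act.inp x = β at t' hc
  induction t' generalizing x P P' S α with
  | out => cases hβ
  | inp => exact t.namedRed_inp hc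
  | parL R _ ih =>
    obtain ⟨S', hc', e⟩ := hc.par_right
    refine ((ih t hβ hc').par R).cls_congr ?_ (cls_eq.2 e.symm)
    simp [add_assoc]
  | parR R _ ih =>
    obtain ⟨S₁, hc₁, e₁⟩ := hc.congr (.refl _) (.par_comm _ _)
    obtain ⟨S', hc', e⟩ := hc₁.par_right
    refine ((ih t hβ hc').par R).cls_congr ?_ (cls_eq.2 (e₁.trans e).symm)
    simp only [cls_par]; abel
  | comm => cases hβ
  | res _ ih =>
    obtain ⟨S', hc', e⟩ := hc.res_right
    subst hβ
    refine (ih (t.ren sh) rfl hc').res.cls_congr ?_ (cls_eq.2 e.symm)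
    simp [res_cls_sh_add]
  | opn => cases hβ
  | @rep Q _ _ _ ih =>
    obtain ⟨S', hc', e⟩ := hc.par_right
    refine ((ih t hβ hc').par (DB.rep Q)).cls_congr ?_ (cls_eq.2 e.symm)
    rw [cls_par, cls_rep]
    simp [add_assoc]
  | repComm => cases hβ

theorem Tr.namedRed_comm {P P' Q Q' S : DB N} {α β} (t : Tr P α P') (t' : Tr Q β Q')
    (hc : Comb α β P' Q' S) : NamedRed (DB.par P Q) S := by
  have left : ∀ {P P' Q Q' S : DB N} {α x}, Tr P (.inp x) P' → Tr Q α Q' →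
      Comb (.inp x) α P' Q' S → NamedRed (DB.par P Q) S := by
    intro P P' Q Q' S α x t t' hc
    obtain ⟨S', hc', e⟩ := hc.symm
    exact (t'.namedRed_par t hc').struct (.par_comm _ _) e.symm
  cases α with
  | tau => cases hc
  | inp => exact left t t' hc
  | out => cases hc; exact t.namedRed_par t' (.outInp _ _ _ _)
  | bout => cases hc; exact t.namedRed_par t' (.boutInp _ _ _)

/-- Every `τ`-transition is a reduction of the named counterparts. -/
theorem Tr.namedRed {P P' : DB N} (t : Tr P .tau P') : NamedRed P P' := by
  generalize hα : Act.tau = α at t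
  induction t with
  | out => cases hα
  | inp => cases hα
  | parL R _ ih =>
    subst hα
    simpa using (ih rfl).par R
  | parR R _ ih =>
    subst hα
    refine ((ih rfl).par R).cls_congr (by simp [add_comm]) (by simp [add_comm])
  | comm t t' hc => exact t.namedRed_comm t' hc
  | @res _ α _ _ ih =>
    subst hα
    simpa using (ih rfl).res
  | opn => cases hα
  | @rep P _ _ _ ih =>
    subst hα
    refine ((ih rfl).par (DB.rep P)).cls_congr ?_ (by simp)
    rw [cls_rep, cls_par]
  | @repComm P _ _ _ _ _ t t' hc =>
    refine ((t.namedRed_comm t' hc).par (DB.rep P)).cls_congr ?_ rfl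
    rw [cls_rep, cls_rep]
    simp [add_assoc]

/-! ### Asynchronous processes -/

/-- Asynchronous processes: outputs have no continuation. -/
def Async {N : Type u} : DB N → Prop
  | nil => True
  | tick => True
  | out _ _ P => P = nil
  | inp _ P => P.Async
  | par P Q => P.Async ∧ Q.Async
  | res P => P.Async
  | rep P => P.Async

theorem Async.ren {N : Type u} {P : DB N} (h : P.Async) (f) : (P.ren f).Async := by
  induction P generalizing f <;> simp_all [Async, DB.ren]

theorem Comb.async {N : Type u} {α β : Act N} {P Q S} (h : Comb α β P Q S) (hP : P.Async)
    (hQ : Q.Async) : S.Async := by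
  cases h
  · exact ⟨hP, hQ.ren _⟩
  · exact ⟨hP.ren _, hQ⟩
  · exact ⟨hP, hQ⟩
  · exact ⟨hP, hQ⟩

theorem Tr.async {N : Type u} {P P' : DB N} {α} (t : Tr P α P') (h : P.Async) : P'.Async := by
  induction t with
  | out => subst h; trivial
  | inp => exact h
  | parL _ _ ih => exact ⟨ih h.1, h.2.ren _⟩
  | parR _ _ ih => exact ⟨h.1.ren _, ih h.2⟩
  | comm _ _ hc ih₁ ih₂ => exact hc.async (ih₁ h.1) (ih₂ h.2)
  | res _ ih => exact (ih h).ren _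
  | opn _ ih => exact ih h
  | rep _ ih => exact ⟨ih h, Async.ren (P := .rep _) h _⟩
  | repComm _ _ hc ih₁ ih₂ => exact ⟨hc.async (ih₁ h) (ih₂ h), h⟩

theorem Async.exists_asyncToPi {N : Type u} {P : DB N} (h : P.Async) (σ : Ref N → N) :
    ∃ T : (asyncSig N).Term Unit, asyncToPi T = P.toPi σ := by
  induction P generalizing σ with
  | nil => exact ⟨Async.nil, rfl⟩
  | tick => exact ⟨.const (), rfl⟩
  | out x z P => cases h; exact ⟨Async.out (σ x) (σ z), rfl⟩
  | inp x P ih =>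
    obtain ⟨T, hT⟩ := ih h (scons (P.freshName σ) σ)
    exact ⟨Async.inp (σ x) (P.freshName σ) T, by simp [Async.inp, asyncToPi, toPi, hT]⟩
  | par P Q ihP ihQ =>
    obtain ⟨T, hT⟩ := ihP h.1 σ
    obtain ⟨T', hT'⟩ := ihQ h.2 σ
    exact ⟨Async.par T T', by simp [Async.par, asyncToPi, toPi, hT, hT']⟩
  | res P ih =>
    obtain ⟨T, hT⟩ := ih h (scons (P.freshName σ) σ)
    exact ⟨Async.res (P.freshName σ) T, by simp [Async.res, asyncToPi, toPi, hT]⟩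
  | rep P ih =>
    obtain ⟨T, hT⟩ := ih h σ
    exact ⟨Async.rep T, by simp [Async.rep, asyncToPi, toPi, hT]⟩

theorem exists_syncToPi {N : Type u} (P : Pi N) :
    ∃ S : (syncSig N).Term Unit, syncToPi S = P := by
  induction P with
  | nil => exact ⟨.op .nil ![], rfl⟩
  | tick => exact ⟨.const (), rfl⟩
  | out x z P ih => obtain ⟨T, rfl⟩ := ih; exact ⟨.op (.out x z) ![T], rfl⟩
  | inp x y P ih => obtain ⟨T, rfl⟩ := ih; exact ⟨.op (.inp x y) ![T], rfl⟩
  | par P Q ihP ihQ =>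
    obtain ⟨T, rfl⟩ := ihP
    obtain ⟨T', rfl⟩ := ihQ
    exact ⟨.op .par ![T, T'], rfl⟩
  | res y P ih => obtain ⟨T, rfl⟩ := ih; exact ⟨.op (.res y) ![T], rfl⟩
  | rep P ih => obtain ⟨T, rfl⟩ := ih; exact ⟨.op .rep ![T], rfl⟩

theorem async_toDB_asyncToPi {N : Type u} [DecidableEq N] (T : (asyncSig N).Term Unit)
    (ρ : N → Ref N) : ((asyncToPi T).toDB ρ).Async := by
  induction T generalizing ρ with
  | const => trivial
  | op o a ih =>
    cases o with
    | nil => trivial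
    | out x z => rfl
    | inp x y => exact ih (0 : Fin 1) _
    | par => exact ⟨ih (0 : Fin 2) _, ih (1 : Fin 2) _⟩
    | res y => exact ih (0 : Fin 1) _
    | rep => exact ih (0 : Fin 1) _

end DB

/-! ### Validity of handshake encodings -/

section Divergence

variable {α : Type w} {red : α → α → Prop}

theorem diverges_iff_not_acc {P : α} : Diverges red P ↔ ¬ Acc (fun Q P => red P Q) P :=
  (not_acc_iff_exists_descending_chain (r := fun Q P => red P Q)).symm

end Divergence

namespace DB

variable {N : Type u} [Infinite N]

/-- The identity on free names, with an arbitrary choice for dangling indices. -/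
noncomputable def nameOf : Ref N → N
  | .free a => a
  | .bound _ => Classical.arbitrary N

/-- The renaming that closes a process; it fixes nameless forms of named processes. -/
noncomputable def close : Ref N → Ref N := free ∘ nameOf

theorem close_comp_free : close ∘ free = (free : N → Ref N) := rfl

theorem close_comp_close : close ∘ close = (close : Ref N → Ref N) := rfl

variable [DecidableEq N]

theorem ren_close_toDB (P : Pi N) : (P.toDB free).ren close = P.toDB free := by
  rw [Pi.ren_toDB, close_comp_free]

/-- A sublanguage of the π-calculus with an embedding `j` that reaches the named counterparts of
all reducts performs all reductions of nameless forms. -/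
theorem exists_red {X : Type*} {j : X → Pi N}
    (hj : ∀ x q, Tr ((j x).toDB free) .tau q → ∃ x', j x' = q.toPi nameOf)
    {x : X} {p q : DB N} (hx : SC ((j x).toDB free) (p.ren close)) (h : Red p q) :
    ∃ x', Pi.Red (j x) (j x') ∧ SC ((j x').toDB free) (q.ren close) := by
  obtain ⟨q', t, e⟩ := Red.struct hx (h.ren close) (.refl _)
  obtain ⟨x', hx'⟩ := hj x q' t
  refine ⟨x', ?_, ?_⟩
  · rw [hx']
    exact .struct (structEq_toPi (ren_close_toDB _).symm) (t.namedRed nameOf) (.refl _)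
  · rw [hx', toDB_toPi]
    have := e.ren close
    rwa [ren_ren, close_comp_close] at this

theorem exists_reds {X : Type*} {j : X → Pi N}
    (hj : ∀ x q, Tr ((j x).toDB free) .tau q → ∃ x', j x' = q.toPi nameOf)
    {x : X} {p q : DB N} (hx : SC ((j x).toDB free) (p.ren close))
    (h : Relation.ReflTransGen Red p q) :
    ∃ x', Relation.ReflTransGen (fun x y => Pi.Red (j x) (j y)) x x' ∧
      SC ((j x').toDB free) (q.ren close) := by
  induction h with
  | refl => exact ⟨x, .refl, hx⟩
  | tail _ hs ih =>
    obtain ⟨x₁, h₁, e₁⟩ := ih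
    obtain ⟨x₂, h₂, e₂⟩ := exists_red hj e₁ hs
    exact ⟨x₂, h₁.tail h₂, e₂⟩

theorem sync_reaches (S : (syncSig N).Term Unit) (q : DB N)
    (_ : Tr ((syncToPi S).toDB free) .tau q) : ∃ S', syncToPi S' = q.toPi nameOf :=
  exists_syncToPi _

theorem async_reaches (T : (asyncSig N).Term Unit) (q : DB N)
    (t : Tr ((asyncToPi T).toDB free) .tau q) : ∃ T', asyncToPi T' = q.toPi nameOf :=
  (t.async (async_toDB_asyncToPi T free)).exists_asyncToPi nameOf

namespace Handshake

variable {b : Bool} {enc : DB N → DB N} {other : Ref N → DB N → DB N}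

/-- The target process `T` has `n` inert reductions left to the encoding of `S`. -/
def Pending (enc : DB N → DB N) (n : ℕ) (S : (syncPi N).Proc) (T : (asyncPi N).Proc) : Prop :=
  InertSeq n ((asyncToPi T).toDB free) (enc ((syncToPi S).toDB free))

/-- Pending handshakes are insensitive to structural congruence and to closing. -/
theorem pending_of_sc (h : Handshake b enc other) {n S T} {s t : DB N} (hst : InertSeq n t (enc s))
    (hs : SC ((syncToPi S).toDB free) (s.ren close))
    (ht : SC ((asyncToPi T).toDB free) (t.ren close)) : Pending enc n S T := by
  have := ((hst.ren close).struct_left ht)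
  rw [← h.ren] at this
  exact this.struct_right (h.sc_congr hs.symm)

theorem pending_forward (h : Handshake b enc other) {n S T S'} (hp : Pending enc n S T)
    (hs : (syncPi N).red S S') :
    ∃ m T', Relation.TransGen (asyncPi N).red T T' ∧ Pending enc m S' T' := by
  obtain ⟨m, t', t'', h₁, h₂, h₃⟩ := h.red_forward hp (Pi.toDB_red hs free)
  have e : ∀ P : Pi N, SC (P.toDB free) ((P.toDB free).ren close) := fun P => by
    rw [ren_close_toDB]; exact .refl _
  obtain ⟨T₁, hT₁, e₁⟩ := exists_reds async_reaches (e _) h₁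
  obtain ⟨T₂, hT₂, e₂⟩ := exists_red async_reaches e₁ h₂
  exact ⟨m, T₂, .tail' hT₁ hT₂, h.pending_of_sc h₃ (e _) e₂⟩

theorem pending_backward (h : Handshake b enc other) {n S T T'} (hp : Pending enc n S T)
    (hs : (asyncPi N).red T T') :
    (∃ m < n, Pending enc m S T') ∨ ∃ m S', (syncPi N).red S S' ∧ Pending enc m S' T' := by
  have e : ∀ P : Pi N, SC (P.toDB free) ((P.toDB free).ren close) := fun P => by
    rw [ren_close_toDB]; exact .refl _
  rcases h.red_backward hp (Pi.toDB_red hs free) with h₁ | ⟨m, s', h₁, h₂⟩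
  · exact .inl h₁
  · obtain ⟨S', hS', e'⟩ := exists_red sync_reaches (e _) h₁
    exact .inr ⟨m, S', hS', h.pending_of_sc h₂ e' (e _)⟩

theorem pending_reds (h : Handshake b enc other) {n} {S : (syncPi N).Proc}
    {T : (asyncPi N).Proc} (hp : Pending enc n S T) :
    ∃ T', (asyncPi N).Reds T T' ∧ Pending enc 0 S T' := by
  obtain ⟨t, ht, e⟩ := InertSeq.reds hp
  obtain ⟨T', hT', e'⟩ := exists_reds async_reaches (by rw [ren_close_toDB]; exact .refl _) ht
  refine ⟨T', hT', .zero (e'.trans ?_)⟩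
  have := e.ren close
  rwa [← h.ren, ren_close_toDB] at this

/-- Divergence is preserved and reflected. If `S` terminates, then so does `T`, by induction on
the reductions of `S` and on the number of pending inert reductions; if `T` terminates, then so does
`S`, since each reduction of `S` is matched by at least one reduction of `T`. -/
theorem pending_diverges (h : Handshake b enc other) {n S T} (hp : Pending enc n S T) :
    Diverges (syncPi N).red S ↔ Diverges (asyncPi N).red T := by
  rw [diverges_iff_not_acc, diverges_iff_not_acc, not_iff_not]
  constructor
  · intro hS
    induction hS generalizing n T with
    | intro S _ ih =>
      induction n using Nat.strong_induction_on generalizing T with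
      | _ n ihn =>
        refine ⟨_, fun T' hT => ?_⟩
        rcases h.pending_backward hp hT with ⟨m, hm, hp'⟩ | ⟨m, S', hS', hp'⟩
        · exact ihn m hm hp'
        · exact ih S' hS' hp'
  · intro hT
    replace hT := hT.transGen
    induction hT generalizing n S with
    | intro T _ ih =>
      refine ⟨_, fun S' hS => ?_⟩
      obtain ⟨m, T', hT', hp'⟩ := h.pending_forward hp hS
      exact ih T' (Relation.transGen_swap.2 hT') hp'

/-- An encoding that is a handshake encoding on nameless forms is valid up to bisimilarity. -/
theorem divBisim (h : Handshake b enc other)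
    (E : Encoding (syncPi N).toSignature (asyncPi N).toSignature)
    (hE : ∀ S, (asyncToPi (E.ext S)).toDB free = enc ((syncToPi S).toDB free))
    (S : (syncPi N).Proc) :
    divBisim (syncPi N) (asyncPi N) (.inr (E.ext S)) (.inl S) := by
  refine divBisim_of_relation (fun S T => ∃ n, Pending enc n S T) ?_ ?_ ?_ ?_ ?_
    ⟨0, .zero (hE S ▸ .refl _)⟩
  · rintro S T ⟨n, hp⟩ hok
    obtain ⟨T', hT', hp'⟩ := h.pending_reds hp
    refine ⟨T', hT', ?_⟩
    cases hp' with
    | zero e =>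
      exact (Pi.reports_toDB free _).1 (e.reports.2 ((h.reports_iff _).2
        ((Pi.reports_toDB free _).2 hok)))
  · rintro S T ⟨n, hp⟩ hok
    exact ⟨S, .refl, (Pi.reports_toDB free _).1 ((h.reports_iff _).1
      (InertSeq.reports hp ((Pi.reports_toDB free _).2 hok)))⟩
  · rintro S T S' ⟨n, hp⟩ hS
    obtain ⟨m, T', hT', hp'⟩ := h.pending_forward hp hS
    exact ⟨T', hT'.to_reflTransGen, m, hp'⟩
  · rintro S T T' ⟨n, hp⟩ hT
    rcases h.pending_backward hp hT with ⟨m, -, hp'⟩ | ⟨m, S', hS', hp'⟩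
    · exact ⟨S, .refl, m, hp'⟩
    · exact ⟨S', .single hS', m, hp'⟩
  · rintro S T ⟨n, hp⟩
    exact h.pending_diverges hp

end Handshake
end DB

/-! ### The encodings of Boudol and of Honda and Tokoro -/

variable {N : Type u}

theorem fn_syncToPi (S : (syncSig N).Term Unit) : S.fn = (syncToPi S).fn := by
  induction S with
  | const => rfl
  | op o a ih =>
    cases o with
    | nil => rfl
    | out x z => exact congrArg ({x, z} ∪ ·) (ih (0 : Fin 1))
    | inp x y => exact congrArg (fun s => {x} ∪ (s \ {y})) (ih (0 : Fin 1))
    | par => exact congrArg₂ (· ∪ ·) (ih (0 : Fin 2)) (ih (1 : Fin 2))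
    | res y => exact congrArg (· \ {y}) (ih (0 : Fin 1))
    | rep => exact ih (0 : Fin 1)

theorem finite_fn (S : (syncSig N).Term Unit) : S.fn.Finite := by
  rw [fn_syncToPi]
  exact (Pi.names_finite _).subset (Pi.fn_subset_names _)

section Translation

variable [DecidableEq N]

/-- A binder of a name that is not free amounts to a weakening. -/
theorem Pi.bind_toDB {u : N} {P : Pi N} (h : u ∉ P.fn) (ρ : N → Ref N) :
    P.toDB (Pi.bind u ρ) = (P.toDB ρ).ren sh := by
  rw [Pi.ren_toDB]
  exact Pi.toDB_congr fun a ha => Pi.bind_of_ne (by rintro rfl; exact h ha) _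

/-- Above a binder of `y`, a binder of a name that is not free amounts to a weakening, also where
that name is `y` itself. -/
theorem Pi.bind_bind_toDB {u y : N} {P : Pi N} (h : u ∉ P.fn) (ρ : N → Ref N) :
    P.toDB (Pi.bind y (Pi.bind u ρ)) = (P.toDB (Pi.bind y ρ)).ren (up sh) := by
  rw [Pi.ren_toDB, Pi.comp_bind]
  refine Pi.toDB_congr (Pi.bind_congr fun a ha => Pi.bind_of_ne ?_ _)
  rintro rfl
  exact h ha.1

theorem toDB_boudolMap (c : BoudolNames N) (S : (syncSig N).Term Unit) (ρ : N → Ref N) :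
    (asyncToPi (boudolMap c S)).toDB ρ = ((syncToPi S).toDB ρ).boudol := by
  induction S generalizing ρ with
  | const => rfl
  | op o a ih =>
    cases o with
    | nil => rfl
    | out x z =>
      have ih := ih (0 : Fin 1)
      have hfin := finite_fn (a (0 : Fin 1))
      have hu := c.fresh_uOut x z _ hfin
      have hv := c.fresh_vOut x z _ hfin
      simp only [boudolMap]
      generalize c.uOut x z _ = u at *
      generalize c.vOut x z _ = v at *
      rw [fn_syncToPi] at hu hv
      simp only [Set.mem_union, Set.mem_insert_iff, Set.mem_singleton_iff, not_or] at hu hv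
      obtain ⟨hu, hxu, hzu⟩ := hu
      obtain ⟨hv, hxv, hzv⟩ := hv
      change DB.res (.par (.out (Pi.bind u ρ x) (Pi.bind u ρ u) .nil) (.inp (Pi.bind u ρ u)
        (.par (.out (Pi.bind v (Pi.bind u ρ) v) (Pi.bind v (Pi.bind u ρ) z) .nil)
          ((asyncToPi (boudolMap c (a (0 : Fin 1)))).toDB (Pi.bind v (Pi.bind u ρ)))))) = _
      rw [ih, Pi.bind_toDB hv, Pi.bind_toDB hu, Pi.bind_self, Pi.bind_self,
        Pi.bind_of_ne (Ne.symm hxu), Pi.bind_of_ne (Ne.symm hzv), Pi.bind_of_ne (Ne.symm hzu),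
        DB.ren_ren, DB.boudol_ren]
      rfl
    | inp x y =>
      have ih := ih (0 : Fin 1)
      have hfin := finite_fn (a (0 : Fin 1))
      have hu := c.fresh_uInp x y _ hfin
      have hv := c.fresh_vInp x y _ hfin
      have huv := c.ne_inp x y _ hfin
      simp only [boudolMap]
      generalize c.uInp x y _ = u at *
      generalize c.vInp x y _ = v at *
      rw [fn_syncToPi] at hu hv
      change DB.inp (ρ x) (.res (.par
        (.out (Pi.bind v (Pi.bind u ρ) u) (Pi.bind v (Pi.bind u ρ) v) .nil)
        (.inp (Pi.bind v (Pi.bind u ρ) v)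
          ((asyncToPi (boudolMap c (a (0 : Fin 1)))).toDB
            (Pi.bind y (Pi.bind v (Pi.bind u ρ))))))) = _
      rw [ih, Pi.bind_bind_toDB fun h => hv (.inl h), Pi.bind_bind_toDB fun h => hu (.inl h),
        Pi.bind_self, Pi.bind_of_ne huv, Pi.bind_self, DB.ren_ren, up_comp, DB.boudol_ren]
      rfl
    | par => exact congrArg₂ DB.par (ih (0 : Fin 2) ρ) (ih (1 : Fin 2) ρ)
    | res y => exact congrArg DB.res (ih (0 : Fin 1) _)
    | rep => exact congrArg DB.rep (ih (0 : Fin 1) ρ)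

theorem toDB_hondaTokoroMap (c : HondaTokoroNames N) (S : (syncSig N).Term Unit)
    (ρ : N → Ref N) :
    (asyncToPi (hondaTokoroMap c S)).toDB ρ = ((syncToPi S).toDB ρ).hondaTokoro := by
  induction S generalizing ρ with
  | const => rfl
  | op o a ih =>
    cases o with
    | nil => rfl
    | out x z =>
      have ih := ih (0 : Fin 1)
      have hu := c.fresh_uOut x z _ (finite_fn (a (0 : Fin 1)))
      simp only [hondaTokoroMap]
      generalize c.uOut x z _ = u at *
      rw [fn_syncToPi] at hu
      simp only [Set.mem_union, Set.mem_insert_iff, Set.mem_singleton_iff, not_or] at hu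
      obtain ⟨hu, -, hzu⟩ := hu
      change DB.inp (ρ x) (.par (.out (Pi.bind u ρ u) (Pi.bind u ρ z) .nil)
        ((asyncToPi (hondaTokoroMap c (a (0 : Fin 1)))).toDB (Pi.bind u ρ))) = _
      rw [ih, Pi.bind_toDB hu, Pi.bind_self, Pi.bind_of_ne (Ne.symm hzu), DB.hondaTokoro_ren]
      rfl
    | inp x y =>
      have ih := ih (0 : Fin 1)
      have hu := c.fresh_uInp x y _ (finite_fn (a (0 : Fin 1)))
      simp only [hondaTokoroMap]
      generalize c.uInp x y _ = u at *
      rw [fn_syncToPi] at hu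
      have hxu : x ≠ u := fun h => hu (.inr h.symm)
      change DB.res (.par (.out (Pi.bind u ρ x) (Pi.bind u ρ u) .nil) (.inp (Pi.bind u ρ u)
        ((asyncToPi (hondaTokoroMap c (a (0 : Fin 1)))).toDB (Pi.bind y (Pi.bind u ρ))))) = _
      rw [ih, Pi.bind_bind_toDB fun h => hu (.inl h), Pi.bind_self, Pi.bind_of_ne hxu,
        DB.hondaTokoro_ren]
      rfl
    | par => exact congrArg₂ DB.par (ih (0 : Fin 2) ρ) (ih (1 : Fin 2) ρ)
    | res y => exact congrArg DB.res (ih (0 : Fin 1) _)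
    | rep => exact congrArg DB.rep (ih (0 : Fin 1) ρ)

end Translation

/-! ### Compositionality of the two encodings -/

open Async in
/-- The context by which Boudol's encoding translates an operator. -/
def boudolContext (c : BoudolNames N) : (o : SOp N) → Set N → (asyncSig N).Term (Fin o.arity)
  | .nil, _ => nil
  | .out x z, F =>
      res (c.uOut x z F) (par (out x (c.uOut x z F)) (inp (c.uOut x z F) (c.vOut x z F)
        (par (out (c.vOut x z F) z) (.const (0 : Fin 1)))))
  | .inp x y, F =>
      inp x (c.uInp x y F) (res (c.vInp x y F) (par (out (c.uInp x y F) (c.vInp x y F))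
        (inp (c.vInp x y F) y (.const (0 : Fin 1)))))
  | .par, _ => par (.const (0 : Fin 2)) (.const (1 : Fin 2))
  | .res y, _ => res y (.const (0 : Fin 1))
  | .rep, _ => rep (.const (0 : Fin 1))

open Async in
/-- The context by which Honda and Tokoro's encoding translates an operator. -/
def hondaTokoroContext (c : HondaTokoroNames N) :
    (o : SOp N) → Set N → (asyncSig N).Term (Fin o.arity)
  | .nil, _ => nil
  | .out x z, F => inp x (c.uOut x z F) (par (out (c.uOut x z F) z) (.const (0 : Fin 1)))
  | .inp x y, F =>
      res (c.uInp x y F) (par (out x (c.uInp x y F)) (inp (c.uInp x y F) y (.const (0 : Fin 1))))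
  | .par, _ => par (.const (0 : Fin 2)) (.const (1 : Fin 2))
  | .res y, _ => res y (.const (0 : Fin 1))
  | .rep, _ => rep (.const (0 : Fin 1))

theorem boudolMap_op (c : BoudolNames N) {X : Type} (o : SOp N)
    (a : Fin o.arity → (syncSig N).Term X) :
    boudolMap c (.op o a) =
      (boudolContext c o (⋃ i, (a i).fn)).fill fun i => boudolMap c (a i) := by
  have unary (s : Fin 1 → Set N) : ⋃ i, s i = s 0 := iSup_unique s
  cases o <;>
    simp only [boudolMap, boudolContext, fill_nil, fill_out, fill_inp, fill_par, fill_res,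
      fill_rep, Signature.Term.fill]
  · rw [unary]
  · rw [unary]

theorem hondaTokoroMap_op (c : HondaTokoroNames N) {X : Type} (o : SOp N)
    (a : Fin o.arity → (syncSig N).Term X) :
    hondaTokoroMap c (.op o a) =
      (hondaTokoroContext c o (⋃ i, (a i).fn)).fill fun i => hondaTokoroMap c (a i) := by
  have unary (s : Fin 1 → Set N) : ⋃ i, s i = s 0 := iSup_unique s
  cases o <;>
    simp only [hondaTokoroMap, hondaTokoroContext, fill_nil, fill_out, fill_inp, fill_par,
      fill_res, fill_rep, Signature.Term.fill]
  · rw [unary]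
  · rw [unary]

theorem boudol_compositional [DecidableEq N] (c : BoudolNames N) : (boudol c).Compositional :=
  ⟨boudolContext c, boudolMap_op c, boudolMap_op c⟩

theorem hondaTokoro_compositional [DecidableEq N] (c : HondaTokoroNames N) :
    (hondaTokoro c).Compositional :=
  ⟨hondaTokoroContext c, hondaTokoroMap_op c, hondaTokoroMap_op c⟩

end Enc

theorem mainTheorem5 :
    (∀ (L : Enc.Calculus.{u₁, v₁}) (M : Enc.Calculus.{u₂, v₂})
        (E : Enc.Encoding L.toSignature M.toSignature), E.Compositional →
        ((E.SuccessSensitive ∧ E.DivergencePreserving ∧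
            E.OperationallyComplete (Enc.divBisimTarget L M) ∧
            E.OperationallySound (Enc.divBisimTarget L M)) ↔
          E.ValidUpTo (Enc.divBisim L M))) ∧
    (∀ (N : Type u₃) [DecidableEq N] [Infinite N],
        (∀ c : Enc.BoudolNames N,
          (Enc.boudol c).ValidUpTo (Enc.divBisim (Enc.syncPi N) (Enc.asyncPi N))) ∧
        (∀ c : Enc.HondaTokoroNames N,
          (Enc.hondaTokoro c).ValidUpTo (Enc.divBisim (Enc.syncPi N) (Enc.asyncPi N)))) := by
  refine ⟨fun L M E hE => E.criteria_iff_validUpTo hE,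
    fun N _ _ => ⟨fun c => ⟨?_, ?_⟩, fun c => ⟨?_, ?_⟩⟩⟩
  · exact Enc.boudol_compositional c
  · exact Enc.DB.handshake_boudol.divBisim (Enc.boudol c)
      fun S => Enc.toDB_boudolMap c S Enc.Ref.free
  · exact Enc.hondaTokoro_compositional c
  · exact Enc.DB.handshake_hondaTokoro.divBisim (Enc.hondaTokoro c)
      fun S => Enc.toDB_hondaTokoroMap c S Enc.Ref.free
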